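/- Let $X,X_1,X_2,\dots$ be i.i.d. random vectors in $\mathbb{R}^d$ that are regularly varying: there is a non-zero measure $\mu$ on $\mathbb{R}^d\setminus\{0\}$, finite on sets bounded away from $0$, such that $\mathbb{P}\{X/t\in B\}/\mathbb{P}\{\|X\|>t\}\to\mu(B)$ as $t\to\infty$ for every Borel set $B$ bounded away from $0$ with $\mu(\partial B)=0$ (Euclidean norm). Let $\omega:\mathbb{R}^d\to(0,\infty)$ be measurable, positively homogeneous of degree $-1$ on $\mathbb{R}^d\setminus\{0\}$, continuous at $\mu$-almost every point, and such that $\Theta:=\omega(X)X$ is almost surely bounded (for instance $\omega(x)=1/\|x\|$ for $x\neq 0$). Put $\Theta_i=\omega(X_i)X_i$, $R=\|X\|$, $R_i=\|X_i\|$. Let $k=k_n$ be natural numbers with $k\to\infty$ and $k/n\to0$, let $t_{n,k}$ be the $(1-k/n)$-quantile of $R$ and $\hat t_{n,k}$ the $(k+1)$-th largest of $R_1,\dots,R_n$. Define $$\hat\Sigma_{n,k}=\frac1k\sum_{i=1}^n\Theta_i\Theta_i^\top\mathbf 1\{R_i>\hat t_{n,k}\},\qquad \Sigma_{n,k}=\mathbb{E}(\Theta\Theta^\top\mid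 R>t_{n,k}),\qquad \Sigma_\infty=\mathbb{E}_\infty(\theta\theta^\top),$$ where $\mathbb{E}_\infty$ and $\mathrm{Cov}_\infty$ refer to $\mu$ restricted to $\{\|x\|>1\}$ and $\theta=\omega(x)x$. Assume condition (B): there is $\varepsilon>0$ with $$\sup_{s\in[1-\varepsilon,1+\varepsilon]}\big\|\mathbb{E}(\Theta\Theta^\top\mid R>s\,t_{n,k})-\Sigma_{n,k}\big\|_{op}=o(k^{-1/2}).$$ Let $\lambda_1^{(\infty)}\ge\dots\ge\lambda_d^{(\infty)}$ be the eigenvalues of $\Sigma_\infty$ with multiplicities, $\mu_1>\dots>\mu_{d_\infty}$ the distinct ones, and $W_j^{(\infty)}$ the eigenspace of $\Sigma_\infty$ for $\mu_j$. Let $v_1^{(n)},\dots,v_d^{(n)}$ and $\hat v_1^{(n)},\dots,\hat v_d^{(n)}$ be any orthonormal systems of eigenvectors of $\Sigma_{n,k}$ and $\hat\Sigma_{n,k}$, respectively, each ordered by decreasing eigenvalue, where the $\hat v_m^{(n)}$ are random vectors, and set $$W_j^{(n)}=\mathrm{span}\{v_m^{(n)}:\lambda_m^{(\infty)}=\mu_j\},\qquad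 \hat W_j^{(n)}=\mathrm{span}\{\hat v_m^{(n)}:\lambda_m^{(\infty)}=\mu_j\}.$$ Write $\mathbf\Pi_W$ for the matrix of the orthogonal projection onto $W$. Then there is a symmetric centered Gaussian random $d\times d$ matrix $\mathbf U=(U_{ij})$ with $\mathrm{Cov}(U_{ij},U_{\ell m})=\mathrm{Cov}_\infty(\theta_i\theta_j,\theta_\ell\theta_m)$ for all $i,j,\ell,m$ and, jointly in $j$, $$k^{1/2}\big(\mathbf\Pi_{\hat W_j^{(n)}}-\mathbf\Pi_{W_j^{(n)}}\big)_{1\le j\le d_\infty}\to\Big(\sum_{\ell\ne j}\frac1{\mu_\ell-\mu_j}\big(\mathbf\Pi_{W_\ell^{(\infty)}}\mathbf U\,\mathbf\Pi_{W_j^{(\infty)}}+\mathbf\Pi_{W_j^{(\infty)}}\mathbf U\,\mathbf\Pi_{W_\ell^{(\infty)}}\big)\Big)_{1\le j\le d_\infty}\quad\text{weakly as }n\to\infty.$$ -/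

import Mathlib

open MeasureTheory ProbabilityTheory Filter Topology

noncomputable section

namespace ExtremePCA

/-- The Borel σ-algebra (= product σ-algebra) on real matrices. -/
instance instMeasurableSpaceMatrix (d : ℕ) : MeasurableSpace (Matrix (Fin d) (Fin d) ℝ) :=
  inferInstanceAs (MeasurableSpace (Fin d → Fin d → ℝ))

instance instBorelSpaceMatrix (d : ℕ) : BorelSpace (Matrix (Fin d) (Fin d) ℝ) :=
  inferInstanceAs (BorelSpace (Fin d → Fin d → ℝ))

instance instSecondCountableMatrix (d : ℕ) :
    SecondCountableTopology (Matrix (Fin d) (Fin d) ℝ) :=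
  inferInstanceAs (SecondCountableTopology (Fin d → Fin d → ℝ))

variable {d : ℕ}

/-- The law `Q` on `ℝ^d` is (multivariate) regularly varying with limit measure `μ`. The measure
`μ` on `ℝ^d \ {0}` is represented as a measure on `ℝ^d` that does not charge the origin; it is
nonzero and finite on sets bounded away from the origin. For all `μ`-continuity sets `B` bounded
away from the origin, `Q (t B) / Q {‖x‖ > t} → μ B` as `t → ∞`. -/
structure IsRegularlyVarying (Q μ : Measure (EuclideanSpace ℝ (Fin d))) : Prop where
  ne_zero : μ ≠ 0
  zero_singleton : μ {0} = 0
  finite_away : ∀ r : ℝ, 0 < r → μ {x | r ≤ ‖x‖} < ⊤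
  tendsto : ∀ B : Set (EuclideanSpace ℝ (Fin d)), MeasurableSet B →
    (∃ r : ℝ, 0 < r ∧ ∀ x ∈ B, r ≤ ‖x‖) → μ (frontier B) = 0 →
    Tendsto (fun t : ℝ => Q {x | t⁻¹ • x ∈ B} / Q {x | t < ‖x‖}) atTop (𝓝 (μ B))

/-- The scaling functions: measurable, positive, positively homogeneous of degree `-1`, continuous
at `μ`-almost every point, and such that `ω(X) X` is bounded (almost surely) if `X` has law `Q`.
For example `ω x = 1 / ‖x‖` for `x ≠ 0`. -/
structure IsScaling (Q μ : Measure (EuclideanSpace ℝ (Fin d)))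
    (ω : EuclideanSpace ℝ (Fin d) → ℝ) : Prop where
  measurable : Measurable ω
  pos : ∀ x, 0 < ω x
  homogeneous : ∀ c : ℝ, 0 < c → ∀ x, x ≠ 0 → ω (c • x) = c⁻¹ * ω x
  ae_continuousAt : ∀ᵐ x ∂μ, ContinuousAt ω x
  bounded : ∃ C : ℝ, ∀ᵐ x ∂Q, ‖ω x • x‖ ≤ C

/-- The rescaled vector `θ = ω(x) x`. -/
def angle (ω : EuclideanSpace ℝ (Fin d) → ℝ) (x : EuclideanSpace ℝ (Fin d)) :
    EuclideanSpace ℝ (Fin d) := ω x • x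

/-- The matrix `E_ν (θ θᵀ)` of mixed second moments of `θ = ω(x) x` under `ν`. -/
def momentMatrix (ω : EuclideanSpace ℝ (Fin d) → ℝ) (ν : Measure (EuclideanSpace ℝ (Fin d))) :
    Matrix (Fin d) (Fin d) ℝ :=
  Matrix.of fun i j => ∫ x, angle ω x i * angle ω x j ∂ν

/-- `E_t (θ θᵀ)`: mixed second moments conditionally on `‖X‖ > t`, where `X` has law `Q`. -/
def exceedMatrix (ω : EuclideanSpace ℝ (Fin d) → ℝ) (Q : Measure (EuclideanSpace ℝ (Fin d)))
    (t : ℝ) : Matrix (Fin d) (Fin d) ℝ :=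
  momentMatrix ω (cond Q {x | t < ‖x‖})

/-- The limit model: `μ` restricted to the complement of the unit ball. -/
def limitModel (μ : Measure (EuclideanSpace ℝ (Fin d))) : Measure (EuclideanSpace ℝ (Fin d)) :=
  μ.restrict {x | 1 < ‖x‖}

/-- `Σ_∞ = E_∞ (θ θᵀ)`. -/
def sigmaInf (ω : EuclideanSpace ℝ (Fin d) → ℝ) (μ : Measure (EuclideanSpace ℝ (Fin d))) :
    Matrix (Fin d) (Fin d) ℝ :=
  momentMatrix ω (limitModel μ)

/-- `t_{n,k}`: the `(1 - k/n)`-quantile of `‖X‖`, where `X` has law `Q`. -/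
def radiusQuantile (Q : Measure (EuclideanSpace ℝ (Fin d))) (n k : ℕ) : ℝ :=
  sInf {r : ℝ | 1 - (k : ℝ) / n ≤ Q.real {x | ‖x‖ ≤ r}}

/-- `Σ_{n,k} = E (θ θᵀ | ‖X‖ > t_{n,k})`. -/
def sigmaPop (ω : EuclideanSpace ℝ (Fin d) → ℝ) (Q : Measure (EuclideanSpace ℝ (Fin d)))
    (n k : ℕ) : Matrix (Fin d) (Fin d) ℝ :=
  exceedMatrix ω Q (radiusQuantile Q n k)

/-- The `(k+1)`-th largest of the numbers `r 0, …, r (n-1)` (meaningful for `k < n`). -/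
def upperOrderStat {n : ℕ} (k : ℕ) (r : Fin n → ℝ) : ℝ :=
  if h : k < n then r (Tuple.sort r ⟨n - 1 - k, by omega⟩) else 0

open scoped Classical in
/-- The empirical matrix `k⁻¹ ∑ θ_i θ_iᵀ 1{‖x_i‖ > t̂}` of a sample `x`, with `t̂` the
`(k+1)`-th largest norm. -/
def sigmaHat (ω : EuclideanSpace ℝ (Fin d) → ℝ) {n : ℕ} (k : ℕ)
    (x : Fin n → EuclideanSpace ℝ (Fin d)) : Matrix (Fin d) (Fin d) ℝ :=
  (k : ℝ)⁻¹ • ∑ i, if upperOrderStat k (fun l => ‖x l‖) < ‖x i‖ then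
    Matrix.vecMulVec (angle ω (x i)).ofLp (angle ω (x i)).ofLp else 0

/-- The operator norm of a matrix with respect to the Euclidean norm. -/
def opNorm (A : Matrix (Fin d) (Fin d) ℝ) : ℝ := ‖Matrix.toEuclideanCLM (𝕜 := ℝ) A‖

/-- Condition (B): for some `ε > 0`, `‖E_{s t_{n,k}} (θ θᵀ) - Σ_{n,k}‖ = o(k^{-1/2})`, uniformly in
`s ∈ [1 - ε, 1 + ε]`. -/
def BiasCondition (ω : EuclideanSpace ℝ (Fin d) → ℝ) (Q : Measure (EuclideanSpace ℝ (Fin d)))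
    (k : ℕ → ℕ) : Prop :=
  ∃ ε : ℝ, 0 < ε ∧ ∀ δ : ℝ, 0 < δ → ∀ᶠ n : ℕ in atTop, ∀ s ∈ Set.Icc (1 - ε) (1 + ε),
    opNorm (exceedMatrix ω Q (s * radiusQuantile Q n (k n)) - sigmaPop ω Q n (k n))
      ≤ δ / √(k n)

/-- `v 0, …, v (d-1)` is an orthonormal system of eigenvectors of `A` belonging to the eigenvalues
`lam 0 ≥ … ≥ lam (d-1)` of `A` (with multiplicities). -/
structure IsOrderedEigensystem (A : Matrix (Fin d) (Fin d) ℝ) (lam : Fin d → ℝ)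
    (v : Fin d → EuclideanSpace ℝ (Fin d)) : Prop where
  antitone : Antitone lam
  orthonormal : Orthonormal ℝ v
  eigen : ∀ m, Matrix.toEuclideanLin A (v m) = lam m • v m

/-- The distinct values `μ_j` among `lam 0, …, lam (d-1)`. -/
def distinctValues (lam : Fin d → ℝ) : Finset ℝ := Finset.univ.image lam

/-- The span of those `v m` whose index `m` satisfies `lam m = x`. If `lam` is decreasing and `x`
is its `j`-th distinct value `μ_j`, these are the consecutive indices `N_{j-1} < m ≤ N_j`
(counted from one). -/
def matchedSpan (lam : Fin d → ℝ) (v : Fin d → EuclideanSpace ℝ (Fin d)) (x : ℝ) :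
    Submodule ℝ (EuclideanSpace ℝ (Fin d)) :=
  Submodule.span ℝ (v '' {m | lam m = x})

/-- The eigenspace of the matrix `A` at `x`. -/
def eigenspaceOf (A : Matrix (Fin d) (Fin d) ℝ) (x : ℝ) :
    Submodule ℝ (EuclideanSpace ℝ (Fin d)) :=
  Module.End.eigenspace (Matrix.toEuclideanLin A) x

/-- The matrix of the orthogonal projection onto `W`. -/
def projMatrix (W : Submodule ℝ (EuclideanSpace ℝ (Fin d))) : Matrix (Fin d) (Fin d) ℝ :=
  (Matrix.toEuclideanCLM (𝕜 := ℝ) (n := Fin d)).symm W.starProjection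

/-- The component at `x` of the limit: the sum over the distinct eigenvalues `y ≠ x` of `A` of
`(y - x)⁻¹ (Π_y U Π_x + Π_x U Π_y)`, with `Π_y` the projection on the eigenspace of `A` at `y`. -/
def limitMap (A : Matrix (Fin d) (Fin d) ℝ) (values : Finset ℝ) (U : Matrix (Fin d) (Fin d) ℝ)
    (x : ℝ) : Matrix (Fin d) (Fin d) ℝ :=
  ∑ y ∈ values.erase x, (y - x)⁻¹ •
    (projMatrix (eigenspaceOf A y) * U * projMatrix (eigenspaceOf A x) +
      projMatrix (eigenspaceOf A x) * U * projMatrix (eigenspaceOf A y))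

/-- Under `ν` the random matrix `U` is almost surely symmetric, centered, and
`Cov (U_ij, U_lm) = Cov_∞ (θ_i θ_j, θ_l θ_m)`. -/
structure HasLimitMoments (ω : EuclideanSpace ℝ (Fin d) → ℝ)
    (μ : Measure (EuclideanSpace ℝ (Fin d))) (ν : Measure (Matrix (Fin d) (Fin d) ℝ)) :
    Prop where
  symmetric : ∀ᵐ U ∂ν, U.IsSymm
  centered : ∀ i j, ∫ U, U i j ∂ν = 0
  covariance : ∀ i j l m,
    covariance (fun U : Matrix (Fin d) (Fin d) ℝ => U i j) (fun U => U l m) ν =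
      covariance (fun x => angle ω x i * angle ω x j) (fun x => angle ω x l * angle ω x m)
        (limitModel μ)

end ExtremePCA

end

open MeasureTheory ProbabilityTheory Filter Topology

namespace ExtremePCA

/-! ### Regular variation: the tail function of the limit measure. -/

section RegularVariation

variable {d : ℕ} {Q μ : Measure (EuclideanSpace ℝ (Fin d))}

/-! Write t̂ for the (k+1)-th largest norm, N for the number of observations strictly above it, and
E_t for the second moment matrix of θ conditionally on norm > t. The proof joins a central limit
theorem at the random level t̂ to a perturbation expansion of spectral projections.

Central limit theorem. The exceedance set equals I exactly when the values on I lie above the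
maximum over the complement and a condition on the complement alone holds. Hence, given t̂ and the
exceedance set, the exceedances are iid with law Q conditioned on norm > t̂
(`integral_prod_exceedances`). For the sum of E_t̂ - θθᵀ over the exceedances, divided by √k, the
characteristic function is therefore the mean of φ(t̂)^N, with φ(t) the characteristic function of
one centered summand at level t. Regular variation yields t̂/t_{n,k} → 1 and N/k → 1 in probability
and makes the conditional variances converge to those of the limit model, so the limit is Gaussian
(`tendsto_integral_cexp_sum`, `tendstoInDistribution_extremeSum`). The law of the norm may have
atoms: ties, hence N < k, are allowed, and only N/k → 1 is used.

Perturbation. The base point Σ_{n,k} moves with n and may split a multiple eigenvalue of Σ_∞. What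
is needed is strict differentiability at Σ_∞ of the projections obtained by grouping eigenvectors as
Σ_∞ does: an expansion uniform over pairs of matrices near Σ_∞ (`exists_opNorm_projMatrix_sub_le`).
It follows from block identities for two resolutions of the identity (`SpectralFamily`) together
with Weyl's inequality.

Combination. Eigenvectors do not change when a matrix is multiplied by a positive number, so Σ̂ may
be replaced by (k/N) Σ̂, the average of θθᵀ over the exceedances, whose conditional mean is E_t̂.
Condition (B) at s = t̂/t_{n,k} makes E_t̂ - Σ_{n,k} negligible. Thus √k((k/N) Σ̂ - Σ_{n,k}) is
minus the normalized sum above, up to o_P(1); this sign is the one that turns the usual factor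
1/(μ_j - μ_ℓ) into 1/(μ_ℓ - μ_j). Slutsky's lemma and the continuous mapping theorem conclude. -/

lemma measurableSet_lt_norm (t : ℝ) :
    MeasurableSet {x : EuclideanSpace ℝ (Fin d) | t < ‖x‖} :=
  measurableSet_lt measurable_const measurable_norm

lemma exists_notMem_of_countable {C : Set ℝ} (hC : C.Countable) {a b : ℝ} (hab : a < b) :
    ∃ x ∈ Set.Ioo a b, x ∉ C := by
  obtain ⟨x, hx, hx'⟩ := hC.dense_compl ℝ |>.exists_between hab
  exact ⟨x, hx', hx⟩

/-- Dominated convergence of indicators, for a general filter so that it serves for continuity of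
the tail at a point, for right continuity, and for the limit at infinity. -/
lemma tendsto_measure_lt_norm {ρ : Measure (EuclideanSpace ℝ (Fin d))} {l : Filter ℝ}
    [l.IsCountablyGenerated] {c : ℝ} (hfin : ρ {x | c ≤ ‖x‖} ≠ ⊤) (hc : ∀ᶠ s in l, c ≤ s)
    {A : Set (EuclideanSpace ℝ (Fin d))} (hA : MeasurableSet A)
    (h : ∀ᵐ x ∂ρ, ∀ᶠ s in l, s < ‖x‖ ↔ x ∈ A) :
    Tendsto (fun s => ρ.real {x | s < ‖x‖}) l (𝓝 (ρ.real A)) := by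
  rcases l.eq_or_neBot with rfl | hl
  · exact tendsto_bot
  have hAfin : ρ A ≠ ⊤ := by
    refine ne_top_of_le_ne_top hfin (measure_mono_ae ?_)
    filter_upwards [h] with x hx hxA
    obtain ⟨s, hs1, hs2⟩ := (hx.and hc).exists
    exact hs2.trans (hs1.2 hxA).le
  refine (ENNReal.tendsto_toReal hAfin).comp ?_
  refine tendsto_measure_of_ae_tendsto_indicator l hA (fun s => measurableSet_lt_norm s)
    (measurableSet_le measurable_const measurable_norm) hfin ?_ h
  filter_upwards [hc] with s hs x hx
  exact hs.trans (le_of_lt hx)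

namespace IsRegularlyVarying

lemma measure_lt_top (h : IsRegularlyVarying Q μ) {s : ℝ} (hs : 0 < s) :
    μ {x | s < ‖x‖} < ⊤ :=
  lt_of_le_of_lt (measure_mono (Set.ofPred_subset_ofPred.2 fun _ hx => le_of_lt hx))
    (h.finite_away s hs)

lemma sigmaFinite (h : IsRegularlyVarying Q μ) : SigmaFinite μ := by
  refine ⟨⟨⟨fun n : ℕ => {0} ∪ {x | ((n : ℝ) + 1)⁻¹ ≤ ‖x‖}, fun _ => trivial, fun n => ?_, ?_⟩⟩⟩
  · refine (measure_union_le _ _).trans_lt ?_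
    rw [h.zero_singleton, zero_add]
    exact h.finite_away _ (by positivity)
  · refine Set.eq_univ_of_forall fun x => Set.mem_iUnion.2 ?_
    by_cases hx : x = 0
    · exact ⟨0, Or.inl hx⟩
    · obtain ⟨n, hn⟩ := exists_nat_one_div_lt (norm_pos_iff.2 hx)
      exact ⟨n, Or.inr (by simpa using hn.le)⟩

lemma countable_atoms (h : IsRegularlyVarying Q μ) :
    {s : ℝ | μ {x | ‖x‖ = s} ≠ 0}.Countable := by
  have := h.sigmaFinite
  simpa [pos_iff_ne_zero] using
    Measure.countable_meas_level_set_pos (μ := μ) (measurable_norm (α := EuclideanSpace ℝ (Fin d)))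

lemma tendsto_tail_aux (h : IsRegularlyVarying Q μ) {s : ℝ} (hs : 0 < s)
    (h0 : μ {x | ‖x‖ = s} = 0) :
    Tendsto (fun t : ℝ => Q {x | s * t < ‖x‖} / Q {x | t < ‖x‖}) atTop
      (𝓝 (μ {x | s < ‖x‖})) := by
  have hfr : μ (frontier {x : EuclideanSpace ℝ (Fin d) | s < ‖x‖}) = 0 := by
    refine measure_mono_null (frontier_lt_subset_eq continuous_const continuous_norm) ?_
    simpa [eq_comm] using h0
  refine (h.tendsto _ (measurableSet_lt_norm s) ⟨s, hs, fun x hx => le_of_lt hx⟩ hfr).congr' ?_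
  filter_upwards [eventually_gt_atTop 0] with t ht
  congr 2
  ext x
  simp only [Set.mem_ofPred_eq, norm_smul, norm_inv, Real.norm_eq_abs, abs_of_pos ht]
  rw [inv_mul_eq_div, lt_div_iff₀ ht]

/-- If the norm were almost surely at most `t`, all ratios at high levels would vanish, and with
them every tail of `μ`. Consequently conditioning on any exceedance event gives a probability
measure. -/
lemma measure_lt_norm_ne_zero (h : IsRegularlyVarying Q μ) (t : ℝ) : Q {x | t < ‖x‖} ≠ 0 := by
  intro h0
  apply h.ne_zero
  have hz (u : ℝ) (hu : t ≤ u) : Q {x | u < ‖x‖} = 0 :=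
    measure_mono_null (fun x hx => lt_of_le_of_lt hu hx) h0
  have h1 (ε : ℝ) (hε : 0 < ε) : μ {x | ε < ‖x‖} = 0 := by
    obtain ⟨s, hs, hs'⟩ := exists_notMem_of_countable h.countable_atoms hε
    refine measure_mono_null (fun x hx => lt_trans hs.2 hx) (?_ : μ {x | s < ‖x‖} = 0)
    refine tendsto_nhds_unique (h.tendsto_tail_aux hs.1 (by simpa using hs')) ?_
    refine tendsto_const_nhds.congr' ?_
    filter_upwards [eventually_ge_atTop (t / s)] with u hu
    rw [div_le_iff₀ hs.1] at hu
    -- The denominator may vanish too; `0 / 0 = 0` in `ENNReal`.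
    rw [hz (s * u) (by linarith), ENNReal.zero_div]
  rw [← Measure.measure_univ_eq_zero]
  have : (Set.univ : Set (EuclideanSpace ℝ (Fin d))) ⊆
      {0} ∪ ⋃ n : ℕ, {x | ((n : ℝ) + 1)⁻¹ < ‖x‖} := by
    intro x _
    by_cases hx : x = 0
    · exact Or.inl hx
    · obtain ⟨n, hn⟩ := exists_nat_one_div_lt (norm_pos_iff.2 hx)
      exact Or.inr (Set.mem_iUnion.2 ⟨n, by simpa using hn⟩)
  refine measure_mono_null this (measure_union_null h.zero_singleton ?_)
  exact measure_iUnion_null fun n => h1 _ (by positivity)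

variable [IsProbabilityMeasure Q]

lemma measureReal_lt_norm_pos (h : IsRegularlyVarying Q μ) (t : ℝ) : 0 < Q.real {x | t < ‖x‖} :=
  ENNReal.toReal_pos (h.measure_lt_norm_ne_zero t) (measure_ne_top _ _)

omit [IsProbabilityMeasure Q] in
lemma tendsto_tail_of_no_atom (h : IsRegularlyVarying Q μ) {s : ℝ} (hs : 0 < s)
    (h0 : μ {x | ‖x‖ = s} = 0) :
    Tendsto (fun t : ℝ => Q.real {x | s * t < ‖x‖} / Q.real {x | t < ‖x‖}) atTop
      (𝓝 (μ.real {x | s < ‖x‖})) := by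
  have := (ENNReal.tendsto_toReal (h.measure_lt_top hs).ne).comp (h.tendsto_tail_aux hs h0)
  simpa [Function.comp_def, ENNReal.toReal_div, measureReal_def] using this

/-- The ratio of tails at abt and t telescopes through bt. The three radii must be free of mass
because regular variation only tests continuity sets. -/
lemma tail_mul_of_no_atom (h : IsRegularlyVarying Q μ) {a b : ℝ} (ha : 0 < a) (hb : 0 < b)
    (ha0 : μ {x | ‖x‖ = a} = 0) (hb0 : μ {x | ‖x‖ = b} = 0) (hab0 : μ {x | ‖x‖ = a * b} = 0) :
    μ.real {x | a * b < ‖x‖} = μ.real {x | a < ‖x‖} * μ.real {x | b < ‖x‖} := by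
  refine tendsto_nhds_unique (h.tendsto_tail_of_no_atom (by positivity) hab0) ?_
  have h1 := (h.tendsto_tail_of_no_atom ha ha0).comp (tendsto_id.const_mul_atTop hb)
  refine (h1.mul (h.tendsto_tail_of_no_atom hb hb0)).congr fun t => ?_
  have := (h.measureReal_lt_norm_pos (b * t)).ne'
  simp only [Function.comp_apply, id]
  rw [div_mul_div_cancel₀ this, mul_assoc]

/-- Not a case of the product rule: the unit sphere is not yet known to be null, so the value at
radius 1 is unavailable. Here the product of the two ratios is identically 1. -/
lemma tail_mul_tail_inv_of_no_atom (h : IsRegularlyVarying Q μ) {a : ℝ} (ha : 0 < a)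
    (ha0 : μ {x | ‖x‖ = a} = 0) (hb0 : μ {x | ‖x‖ = a⁻¹} = 0) :
    μ.real {x | a < ‖x‖} * μ.real {x | a⁻¹ < ‖x‖} = 1 := by
  have h1 := (h.tendsto_tail_of_no_atom ha ha0).comp (tendsto_id.const_mul_atTop (inv_pos.2 ha))
  refine tendsto_nhds_unique (h1.mul (h.tendsto_tail_of_no_atom (inv_pos.2 ha) hb0)) ?_
  refine tendsto_const_nhds.congr fun t => ?_
  have h2 := (h.measureReal_lt_norm_pos (a⁻¹ * t)).ne'
  have h3 := (h.measureReal_lt_norm_pos t).ne'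
  simp only [Function.comp_apply, id]
  rw [div_mul_div_cancel₀ h2, mul_inv_cancel_left₀ ha.ne', div_self h3]

omit [IsProbabilityMeasure Q] in
lemma tendsto_tail_nhds (h : IsRegularlyVarying Q μ) {p : ℝ} (hp : 0 < p)
    (h0 : μ {x | ‖x‖ = p} = 0) :
    Tendsto (fun s => μ.real {x | s < ‖x‖}) (𝓝 p) (𝓝 (μ.real {x | p < ‖x‖})) := by
  refine tendsto_measure_lt_norm (c := p / 2) (h.finite_away _ (by positivity)).ne
    (eventually_ge_nhds (by linarith)) (measurableSet_lt_norm p) ?_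
  have : ∀ᵐ x ∂μ, ‖x‖ ≠ p := by rw [ae_iff]; simpa using h0
  filter_upwards [this] with x hx
  rcases lt_or_gt_of_ne hx with hlt | hlt
  · filter_upwards [lt_mem_nhds hlt] with s hs
    exact ⟨fun h' => absurd h' (by linarith), fun h' => absurd h' (not_lt.2 hlt.le)⟩
  · filter_upwards [gt_mem_nhds hlt] with s hs
    exact ⟨fun _ => hlt, fun _ => hs⟩

/-- The limit measure does not charge spheres. -/
lemma measure_norm_eq (h : IsRegularlyVarying Q μ) {a : ℝ} (ha : 0 < a) :
    μ {x | ‖x‖ = a} = 0 := by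
  by_contra hne
  set C := {s : ℝ | μ {x | ‖x‖ = s} ≠ 0} with hC
  have hcC : C.Countable := h.countable_atoms
  have hmem (s : ℝ) (hs : s ∉ C) : μ {x | ‖x‖ = s} = 0 := by simpa [hC] using hs
  -- Write f for the tail function. A generic `c` has no mass on the spheres of radius c, 1/c and
  -- ac. Then f(c) > 0 and f is continuous at ac, whereas f(sc) = f(s) f(c) for generic s would
  -- carry the jump of f at `a` over to ac.
  obtain ⟨c, hc, hcnot⟩ := exists_notMem_of_countable
    ((hcC.union (hcC.image fun s => s⁻¹)).union (hcC.image fun s => s / a)) one_pos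
  have hc0 : 0 < c := hc.1
  have hc1 : c ∉ C := fun h' => hcnot (Or.inl (Or.inl h'))
  have hc2 : c⁻¹ ∉ C := fun h' => hcnot (Or.inl (Or.inr ⟨c⁻¹, h', by simp⟩))
  have hc3 : a * c ∉ C := fun h' => hcnot (Or.inr ⟨a * c, h', by simp; field_simp⟩)
  have hfc : 0 < μ.real {x | c < ‖x‖} := by
    have := h.tail_mul_tail_inv_of_no_atom hc0 (hmem _ hc1) (hmem _ hc2)
    refine measureReal_nonneg.lt_of_ne' fun h0 => ?_
    rw [h0, zero_mul] at this
    exact zero_ne_one this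
  have hafin : μ {x | ‖x‖ = a} ≠ ⊤ := by
    refine ((measure_mono ?_).trans_lt (h.finite_away a ha)).ne
    intro x hx
    have hx' : ‖x‖ = a := hx
    exact hx'.ge
  have hj : 0 < μ.real {x | ‖x‖ = a} := ENNReal.toReal_pos hne hafin
  have hcont := h.tendsto_tail_nhds (p := a * c) (by positivity) (hmem _ hc3)
  set j := μ.real {x | ‖x‖ = a} * μ.real {x | c < ‖x‖} with hjdef
  have hjpos : 0 < j := by positivity
  have hev : ∀ᶠ s in 𝓝 a, |μ.real {x | s * c < ‖x‖} - μ.real {x | a * c < ‖x‖}| < j / 2 := by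
    have h1 : Tendsto (fun s : ℝ => s * c) (𝓝 a) (𝓝 (a * c)) := tendsto_id.mul_const c
    have h2 := hcont.comp h1
    have := (Metric.tendsto_nhds.1 h2) (j / 2) (by positivity)
    simpa [Real.dist_eq] using this
  obtain ⟨ε, hε, hball⟩ := Metric.eventually_nhds_iff.1 hev
  have hD := hcC.union (hcC.image fun s => s / c)
  -- Generic points p < a < q within ε of `a`: the tails at pc and qc are each within j/2 of the
  -- tail at ac, yet differ by at least j. The bound a/2 keeps `p` positive.
  obtain ⟨p, hp, hpnot⟩ := exists_notMem_of_countable hD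
    (show max (a / 2) (a - ε) < a from max_lt (by linarith) (by linarith))
  obtain ⟨q, hq, hqnot⟩ := exists_notMem_of_countable hD (show a < a + ε by linarith)
  have hpa : a / 2 < p := (le_max_left _ _).trans_lt hp.1
  have hpe : a - ε < p := (le_max_right _ _).trans_lt hp.1
  have hp0 : 0 < p := by linarith
  have hq0 : 0 < q := by linarith [hq.1]
  have hmul (s : ℝ) (hs : 0 < s) (hsn : s ∉ C ∪ (fun s => s / c) '' C) :
      μ.real {x | s * c < ‖x‖} = μ.real {x | s < ‖x‖} * μ.real {x | c < ‖x‖} := by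
    refine h.tail_mul_of_no_atom hs hc0 (hmem _ fun h' => hsn (Or.inl h')) (hmem _ hc1)
      (hmem _ fun h' => hsn (Or.inr ⟨s * c, h', by simp; field_simp⟩))
  have hp1 := hball (y := p) (by rw [Real.dist_eq, abs_lt]; constructor <;> linarith [hp.2])
  have hq1 := hball (y := q) (by rw [Real.dist_eq, abs_lt]; constructor <;> linarith [hq.1, hq.2])
  rw [hmul p hp0 hpnot] at hp1
  rw [hmul q hq0 hqnot] at hq1
  have hjump : μ.real {x | ‖x‖ = a} + μ.real {x | q < ‖x‖} ≤ μ.real {x | p < ‖x‖} := by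
    rw [← measureReal_union ?_ (measurableSet_lt_norm q) hafin (h.measure_lt_top hq0).ne]
    · refine measureReal_mono ?_ (h.measure_lt_top hp0).ne
      rintro x (hx | hx)
      · have : ‖x‖ = a := hx
        rw [Set.mem_ofPred_eq, this]; exact hp.2
      · exact (hp.2.trans hq.1).trans hx
    · rw [Set.disjoint_left]
      intro x hx hx'
      have h1 : ‖x‖ = a := hx
      have h2 : q < ‖x‖ := hx'
      linarith [hq.1]
  have h3 : j + μ.real {x | q < ‖x‖} * μ.real {x | c < ‖x‖} ≤
      μ.real {x | p < ‖x‖} * μ.real {x | c < ‖x‖} := by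
    rw [hjdef, ← add_mul]
    exact mul_le_mul_of_nonneg_right hjump hfc.le
  rw [abs_lt] at hp1 hq1
  linarith

lemma tendsto_tail (h : IsRegularlyVarying Q μ) {s : ℝ} (hs : 0 < s) :
    Tendsto (fun t : ℝ => Q.real {x | s * t < ‖x‖} / Q.real {x | t < ‖x‖}) atTop
      (𝓝 (μ.real {x | s < ‖x‖})) :=
  h.tendsto_tail_of_no_atom hs (h.measure_norm_eq hs)

lemma tail_mul (h : IsRegularlyVarying Q μ) {a b : ℝ} (ha : 0 < a) (hb : 0 < b) :
    μ.real {x | a * b < ‖x‖} = μ.real {x | a < ‖x‖} * μ.real {x | b < ‖x‖} :=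
  h.tail_mul_of_no_atom ha hb (h.measure_norm_eq ha) (h.measure_norm_eq hb)
    (h.measure_norm_eq (by positivity))

lemma tail_mul_tail_inv (h : IsRegularlyVarying Q μ) {a : ℝ} (ha : 0 < a) :
    μ.real {x | a < ‖x‖} * μ.real {x | a⁻¹ < ‖x‖} = 1 :=
  h.tail_mul_tail_inv_of_no_atom ha (h.measure_norm_eq ha) (h.measure_norm_eq (inv_pos.2 ha))

lemma tail_one (h : IsRegularlyVarying Q μ) : μ.real {x | 1 < ‖x‖} = 1 := by
  have h1 := h.tail_mul_tail_inv one_pos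
  rw [inv_one] at h1
  nlinarith [measureReal_nonneg (μ := μ) (s := {x | 1 < ‖x‖})]

lemma continuousAt_tail (h : IsRegularlyVarying Q μ) {s : ℝ} (hs : 0 < s) :
    ContinuousAt (fun s => μ.real {x | s < ‖x‖}) s :=
  h.tendsto_tail_nhds hs (h.measure_norm_eq hs)

/-- A value 1 at s > 1 would persist along all powers of s by multiplicativity, against the decay to
0. Strictness on both sides of 1 is what later localizes the order statistic. -/
lemma tail_lt_one (h : IsRegularlyVarying Q μ) {s : ℝ} (hs : 1 < s) :
    μ.real {x | s < ‖x‖} < 1 := by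
  have hs0 : 0 < s := one_pos.trans hs
  refine lt_of_le_of_ne ?_ fun heq => ?_
  · rw [← h.tail_one]
    exact measureReal_mono (fun x hx => hs.trans hx) (h.measure_lt_top one_pos).ne
  have hpow (m : ℕ) : μ.real {x | s ^ m < ‖x‖} = 1 := by
    induction m with
    | zero => simpa using h.tail_one
    | succ m ih => rw [pow_succ, h.tail_mul (by positivity) hs0, ih, heq, one_mul]
  have hlim : Tendsto (fun s => μ.real {x : EuclideanSpace ℝ (Fin d) | s < ‖x‖}) atTop
      (𝓝 (μ.real ∅)) := by
    refine tendsto_measure_lt_norm (c := 1) (h.finite_away 1 one_pos).ne (eventually_ge_atTop 1)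
      MeasurableSet.empty (Eventually.of_forall fun x => ?_)
    filter_upwards [eventually_ge_atTop ‖x‖] with s hs
    simpa using hs
  have h2 := hlim.comp (tendsto_pow_atTop_atTop_of_one_lt hs)
  simp only [Function.comp_def, hpow, measureReal_empty] at h2
  exact one_ne_zero (tendsto_nhds_unique tendsto_const_nhds h2)

lemma one_lt_tail (h : IsRegularlyVarying Q μ) {s : ℝ} (hs0 : 0 < s) (hs : s < 1) :
    1 < μ.real {x | s < ‖x‖} := by
  have h1 := h.tail_mul_tail_inv hs0
  have h2 := h.tail_lt_one ((one_lt_inv₀ hs0).2 hs)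
  have h3 := measureReal_nonneg (μ := μ) (s := {x : EuclideanSpace ℝ (Fin d) | s < ‖x‖})
  have h4 := measureReal_nonneg (μ := μ) (s := {x : EuclideanSpace ℝ (Fin d) | s⁻¹ < ‖x‖})
  nlinarith

lemma isProbabilityMeasure_limitModel (h : IsRegularlyVarying Q μ) :
    IsProbabilityMeasure (limitModel μ) := by
  refine ⟨?_⟩
  have := h.tail_one
  rw [limitModel, Measure.restrict_apply_univ]
  rw [measureReal_def, ENNReal.toReal_eq_one_iff] at this
  exact this

/-! ### Limits of conditional expectations of functions of the direction. -/

section WeakConvergence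

variable {g : EuclideanSpace ℝ (Fin d) → ℝ}

/-- As `g` is homogeneous of degree 0, the conditional probability is the regular variation ratio of
B = {‖x‖ > 1, g ≥ a}. A frontier point of B lies on the unit sphere, on the part of the level set g
= a with norm > 1, or at a discontinuity of `g`, and all three sets are `μ`-null. -/
lemma tendsto_cond_superlevel (h : IsRegularlyVarying Q μ) (hgm : Measurable g)
    (hhom : ∀ c : ℝ, 0 < c → ∀ x, x ≠ 0 → g (c • x) = g x)
    (hcont : ∀ᵐ x ∂μ, ContinuousAt g x) {a : ℝ} (ha : limitModel μ {x | g x = a} = 0) :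
    Tendsto (fun t => (ProbabilityTheory.cond Q {x | t < ‖x‖}).real {x | a ≤ g x}) atTop
      (𝓝 ((limitModel μ).real {x | a ≤ g x})) := by
  set B := {x : EuclideanSpace ℝ (Fin d) | 1 < ‖x‖} ∩ {x | a ≤ g x} with hB
  have hBm : MeasurableSet B :=
    (measurableSet_lt_norm 1).inter (measurableSet_le measurable_const hgm)
  have hfr : μ (frontier B) = 0 := by
    rw [← compl_mem_ae_iff]
    have h1 : ∀ᵐ x ∂μ, ‖x‖ ≠ 1 := by
      rw [ae_iff]; simpa using h.measure_norm_eq one_pos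
    have h2 : ∀ᵐ x ∂μ, 1 < ‖x‖ → g x ≠ a := by
      rw [limitModel, Measure.restrict_apply (measurableSet_eq_fun hgm measurable_const)] at ha
      rw [ae_iff]
      refine measure_mono_null (fun x hx => ?_) ha
      simp only [Set.mem_ofPred_eq, Classical.not_imp, not_not] at hx
      exact ⟨hx.2, hx.1⟩
    filter_upwards [h1, h2, hcont] with x hx1 hx2 hx3
    rw [Set.mem_compl_iff, frontier, Set.mem_sdiff, not_and, not_not]
    intro hcl
    rcases lt_or_gt_of_ne hx1 with hlt | hlt
    · obtain ⟨y, hy1, hy2⟩ := mem_closure_iff_nhds.1 hcl _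
        (continuous_norm.continuousAt.eventually_lt continuousAt_const hlt)
      have h3 : ‖y‖ < 1 := hy1
      exact absurd hy2.1 (not_lt.2 h3.le)
    · rcases lt_or_gt_of_ne (hx2 hlt) with hg | hg
      · obtain ⟨y, hy1, hy2⟩ := mem_closure_iff_nhds.1 hcl _
          (hx3.eventually_lt continuousAt_const hg)
        have h3 : g y < a := hy1
        exact absurd hy2.2 (not_le.2 h3)
      · rw [mem_interior_iff_mem_nhds]
        filter_upwards [continuousAt_const.eventually_lt continuous_norm.continuousAt hlt,
          continuousAt_const.eventually_lt hx3 hg] with y hy1 hy2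
        exact ⟨hy1, hy2.le⟩
  have hlim := h.tendsto B hBm ⟨1, one_pos, fun x hx => le_of_lt hx.1⟩ hfr
  have hBfin : μ B ≠ ⊤ :=
    ((measure_mono Set.inter_subset_left).trans_lt (h.measure_lt_top one_pos)).ne
  have hlim' := (ENNReal.tendsto_toReal hBfin).comp hlim
  have hR : (limitModel μ).real {x | a ≤ g x} = (μ B).toReal := by
    rw [measureReal_def, limitModel, Measure.restrict_apply
      (measurableSet_le measurable_const hgm), hB, Set.inter_comm]
  rw [hR]
  refine hlim'.congr' ?_
  filter_upwards [eventually_gt_atTop 0] with t ht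
  have hset : {x | t⁻¹ • x ∈ B} = {x | t < ‖x‖} ∩ {x | a ≤ g x} := by
    ext x
    simp only [hB, Set.mem_ofPred_eq, Set.mem_inter_iff, norm_smul, norm_inv, Real.norm_eq_abs,
      abs_of_pos ht]
    rw [inv_mul_eq_div, lt_div_iff₀ ht, one_mul]
    refine and_congr_right fun hx => ?_
    rw [hhom _ (inv_pos.2 ht) x (norm_pos_iff.1 (ht.trans hx))]
  rw [Function.comp_apply, hset, ENNReal.toReal_div, measureReal_def,
    ProbabilityTheory.cond_apply (measurableSet_lt_norm t), ENNReal.toReal_mul,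
    ENNReal.toReal_inv, inv_mul_eq_div]

/-- Layer-cake formula and dominated convergence over the levels: all but countably many level sets
of `g` are null in the limit model. -/
lemma tendsto_integral_cond_of_nonneg (h : IsRegularlyVarying Q μ) (hgm : Measurable g)
    (hhom : ∀ c : ℝ, 0 < c → ∀ x, x ≠ 0 → g (c • x) = g x)
    (hcont : ∀ᵐ x ∂μ, ContinuousAt g x) {M : ℝ} (h0 : ∀ x, 0 ≤ g x) (hM : ∀ x, g x ≤ M) :
    Tendsto (fun t => ∫ x, g x ∂(ProbabilityTheory.cond Q {x | t < ‖x‖})) atTop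
      (𝓝 (∫ x, g x ∂(limitModel μ))) := by
  have hlP := h.isProbabilityMeasure_limitModel
  have hcP (t : ℝ) : IsProbabilityMeasure (ProbabilityTheory.cond Q {x | t < ‖x‖}) :=
    cond_isProbabilityMeasure (h.measure_lt_norm_ne_zero t)
  have hint (ρ : Measure (EuclideanSpace ℝ (Fin d))) [IsProbabilityMeasure ρ] :
      ∫ x, g x ∂ρ = ∫ a in Set.Ioc 0 M, ρ.real {x | a ≤ g x} := by
    refine Integrable.integral_eq_integral_Ioc_meas_le ?_ (Eventually.of_forall h0)
      (Eventually.of_forall hM)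
    refine Integrable.of_bound hgm.aestronglyMeasurable M (Eventually.of_forall fun x => ?_)
    rw [Real.norm_eq_abs, abs_of_nonneg (h0 x)]
    exact hM x
  simp_rw [hint]
  refine tendsto_integral_filter_of_dominated_convergence (fun _ => 1) ?_ ?_ ?_ ?_
  · refine Eventually.of_forall fun t => Measurable.aestronglyMeasurable ?_
    refine Antitone.measurable fun a b hab => ?_
    exact measureReal_mono fun x hx => hab.trans hx
  · refine Eventually.of_forall fun t => Eventually.of_forall fun a => ?_
    rw [Real.norm_eq_abs, abs_of_nonneg measureReal_nonneg]
    exact measureReal_le_one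
  · exact integrable_const _
  · refine ae_restrict_of_ae ?_
    have hc : {a : ℝ | limitModel μ {x | g x = a} ≠ 0}.Countable := by
      simpa [pos_iff_ne_zero] using
        Measure.countable_meas_level_set_pos (μ := limitModel μ) hgm
    filter_upwards [hc.ae_notMem volume] with a ha
    exact h.tendsto_cond_superlevel hgm hhom hcont (by simpa using ha)

/-- Integrals of bounded, almost everywhere continuous functions of the direction converge. -/
theorem tendsto_integral_cond (h : IsRegularlyVarying Q μ) (hgm : Measurable g)
    (hhom : ∀ c : ℝ, 0 < c → ∀ x, x ≠ 0 → g (c • x) = g x)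
    (hcont : ∀ᵐ x ∂μ, ContinuousAt g x) {M : ℝ} (hQ : ∀ᵐ x ∂Q, |g x| ≤ M)
    (hμ : ∀ᵐ x ∂μ, |g x| ≤ M) :
    Tendsto (fun t => ∫ x, g x ∂(ProbabilityTheory.cond Q {x | t < ‖x‖})) atTop
      (𝓝 (∫ x, g x ∂(limitModel μ))) := by
  have hlP := h.isProbabilityMeasure_limitModel
  have hcP (t : ℝ) : IsProbabilityMeasure (ProbabilityTheory.cond Q {x | t < ‖x‖}) :=
    cond_isProbabilityMeasure (h.measure_lt_norm_ne_zero t)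
  have hM : 0 ≤ M := by
    obtain ⟨x, hx⟩ := hQ.exists
    exact (abs_nonneg _).trans hx
  -- Truncating changes `g` only on null sets, and adding `M` makes it nonnegative; the layer-cake
  -- version needs bounds valid everywhere.
  set f : EuclideanSpace ℝ (Fin d) → ℝ := fun x => max (-M) (min M (g x)) + M with hf
  have hfm : Measurable f := (measurable_const.max (measurable_const.min hgm)).add_const M
  have h1 : Tendsto (fun t => ∫ x, f x ∂(ProbabilityTheory.cond Q {x | t < ‖x‖})) atTop
      (𝓝 (∫ x, f x ∂(limitModel μ))) := by
    refine h.tendsto_integral_cond_of_nonneg (M := 2 * M) hfm ?_ ?_ ?_ ?_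
    · intro c hc x hx
      simp only [hf, hhom c hc x hx]
    · filter_upwards [hcont] with x hx
      exact ((continuousAt_const.max (continuousAt_const.min hx)).add continuousAt_const)
    · intro x
      have := le_max_left (-M) (min M (g x))
      simp only [hf]; linarith
    · intro x
      have : max (-M) (min M (g x)) ≤ M := max_le (by linarith) (min_le_left _ _)
      simp only [hf]; linarith
  have hint (ρ : Measure (EuclideanSpace ℝ (Fin d))) [IsProbabilityMeasure ρ]
      (hρ : ∀ᵐ x ∂ρ, |g x| ≤ M) : ∫ x, f x ∂ρ - M = ∫ x, g x ∂ρ := by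
    have hgi : Integrable g ρ := Integrable.of_bound hgm.aestronglyMeasurable M hρ
    have : ∫ x, f x ∂ρ = ∫ x, (g x + M) ∂ρ := by
      refine integral_congr_ae ?_
      filter_upwards [hρ] with x hx
      rw [abs_le] at hx
      simp only [hf]
      rw [min_eq_right hx.2, max_eq_right hx.1]
    rw [this, integral_add hgi (integrable_const _)]
    simp
  rw [← hint (limitModel μ) (ae_restrict_of_ae hμ)]
  refine (h1.sub_const M).congr fun t => hint _ ?_
  exact ProbabilityTheory.cond_absolutelyContinuous.ae_le hQ

end WeakConvergence

/-! ### Boundedness of the directions in the limit model. -/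

section Scaling

variable {ω : EuclideanSpace ℝ (Fin d) → ℝ}

omit [IsProbabilityMeasure Q] in
lemma _root_.ExtremePCA.IsScaling.angle_smul (hω : IsScaling Q μ ω) {c : ℝ} (hc : 0 < c)
    {x : EuclideanSpace ℝ (Fin d)} (hx : x ≠ 0) : angle ω (c • x) = angle ω x := by
  rw [angle, angle, hω.homogeneous c hc x hx, smul_smul]
  congr 1
  field_simp

omit [IsProbabilityMeasure Q] in
/-- The bound on the directions carries over to the limit model. -/
lemma norm_angle_le (h : IsRegularlyVarying Q μ) (hω : IsScaling Q μ ω) {C : ℝ}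
    (hC : ∀ᵐ x ∂Q, ‖angle ω x‖ ≤ C) : ∀ᵐ x ∂μ, ‖angle ω x‖ ≤ C := by
  have hsf := h.sigmaFinite
  have h0 : ∀ᵐ x ∂μ, x ≠ 0 := by rw [ae_iff]; simpa using h.zero_singleton
  -- Local nullity: around a violating point of continuity the bound fails on a whole ball away from
  -- 0. By homogeneity it fails on all dilations of that ball, which are `Q`-null, so regular
  -- variation gives the ball `μ`-measure 0.
  suffices hs : μ {x | x ≠ 0 ∧ ContinuousAt ω x ∧ C < ‖angle ω x‖} = 0 by
    have hs' : ∀ᵐ x ∂μ, ¬ (x ≠ 0 ∧ ContinuousAt ω x ∧ C < ‖angle ω x‖) := by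
      rw [ae_iff]; simpa using hs
    filter_upwards [h0, hω.ae_continuousAt, hs'] with x hx1 hx2 hx3
    by_contra hcon
    exact hx3 ⟨hx1, hx2, not_le.1 hcon⟩
  refine measure_null_of_locally_null _ fun x hx => ?_
  obtain ⟨hx0, hxc, hxC⟩ := hx
  have hcont : ContinuousAt (fun y => ‖angle ω y‖) x := (hxc.smul continuousAt_id).norm
  have hev : ∀ᶠ y in 𝓝 x, C < ‖angle ω y‖ ∧ ‖x‖ / 2 < ‖y‖ :=
    (continuousAt_const.eventually_lt hcont hxC).and
      (continuousAt_const.eventually_lt continuous_norm.continuousAt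
        (half_lt_self (norm_pos_iff.2 hx0)))
  obtain ⟨ε, hε, hball⟩ := Metric.eventually_nhds_iff.1 hev
  -- The radius is chosen to make the ball a continuity set.
  obtain ⟨ρ, hρ, hfr⟩ := exists_null_frontier_thickening μ {x} hε
  rw [Metric.thickening_singleton] at hfr
  refine ⟨Metric.ball x ρ, mem_nhdsWithin_of_mem_nhds (Metric.ball_mem_nhds x hρ.1), ?_⟩
  have hsub (y) (hy : y ∈ Metric.ball x ρ) : C < ‖angle ω y‖ ∧ ‖x‖ / 2 < ‖y‖ :=
    hball ((Metric.mem_ball.1 hy).trans hρ.2)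
  have hx2 : 0 < ‖x‖ / 2 := half_pos (norm_pos_iff.2 hx0)
  have hlim := h.tendsto (Metric.ball x ρ) measurableSet_ball
    ⟨‖x‖ / 2, hx2, fun y hy => (hsub y hy).2.le⟩ hfr
  refine tendsto_nhds_unique hlim (tendsto_const_nhds.congr' ?_)
  filter_upwards [eventually_gt_atTop 0] with t ht
  have hnull : Q {y | t⁻¹ • y ∈ Metric.ball x ρ} = 0 := by
    refine measure_mono_null (fun y hy => ?_) (ae_iff.1 hC)
    have h1 := hsub _ hy
    have hy0 : y ≠ 0 := by
      rintro rfl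
      rw [smul_zero, norm_zero] at h1
      linarith [h1.2]
    rw [hω.angle_smul (inv_pos.2 ht) hy0] at h1
    exact not_le.2 h1.1
  rw [hnull, ENNReal.zero_div]

end Scaling

/-! ### Asymptotics of the quantile of the norm. -/

section Quantile

variable {n k : ℕ}

lemma _root_.ExtremePCA.measureReal_lt_radiusQuantile_le (hk : 0 < k) (hkn : k < n) :
    Q.real {x | radiusQuantile Q n k < ‖x‖} ≤ k / n := by
  have hcompl (r : ℝ) : Q.real {x | ‖x‖ ≤ r} = 1 - Q.real {x | r < ‖x‖} := by
    rw [← probReal_compl_eq_one_sub (measurableSet_lt_norm r)]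
    congr 1; ext x; simp
  set t := radiusQuantile Q n k with ht
  have hn : (0 : ℝ) < n := by exact_mod_cast hk.trans hkn
  have hpos : (0 : ℝ) < k / n := div_pos (by exact_mod_cast hk) hn
  have hne : {r : ℝ | 1 - (k : ℝ) / n ≤ Q.real {x | ‖x‖ ≤ r}}.Nonempty := by
    have hlim : Tendsto (fun s => Q.real {x : EuclideanSpace ℝ (Fin d) | s < ‖x‖}) atTop
        (𝓝 (Q.real ∅)) := by
      refine tendsto_measure_lt_norm (c := 1) (measure_ne_top _ _) (eventually_ge_atTop 1)
        MeasurableSet.empty (Eventually.of_forall fun x => ?_)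
      filter_upwards [eventually_ge_atTop ‖x‖] with s hs
      simpa using hs
    rw [measureReal_empty] at hlim
    obtain ⟨r, hr⟩ := (hlim.eventually_lt_const hpos).exists
    exact ⟨r, by rw [Set.mem_ofPred_eq, hcompl]; linarith⟩
  have hgt (r : ℝ) (hr : t < r) : Q.real {x | r < ‖x‖} ≤ k / n := by
    obtain ⟨u, hu, hur⟩ := exists_lt_of_csInf_lt hne hr
    rw [Set.mem_ofPred_eq, hcompl] at hu
    have : Q.real {x | r < ‖x‖} ≤ Q.real {x | u < ‖x‖} :=
      measureReal_mono fun x hx => lt_trans hur hx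
    linarith
  have hlim : Tendsto (fun s => Q.real {x : EuclideanSpace ℝ (Fin d) | s < ‖x‖}) (𝓝[>] t)
      (𝓝 (Q.real {x | t < ‖x‖})) := by
    refine tendsto_measure_lt_norm (c := t) (measure_ne_top _ _) ?_ (measurableSet_lt_norm t)
      (Eventually.of_forall fun x => ?_)
    · filter_upwards [self_mem_nhdsWithin] with s hs using le_of_lt hs
    · rcases lt_or_ge t ‖x‖ with hx | hx
      · filter_upwards [mem_nhdsWithin_of_mem_nhds (gt_mem_nhds hx)] with s hs
        exact ⟨fun _ => hx, fun _ => hs⟩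
      · filter_upwards [self_mem_nhdsWithin] with s hs
        have hs' : t < s := hs
        exact ⟨fun h' => by linarith, fun h' => absurd h' (not_lt.2 hx)⟩
  refine le_of_tendsto hlim ?_
  filter_upwards [self_mem_nhdsWithin] with s hs using hgt s hs

lemma _root_.ExtremePCA.lt_measureReal_of_lt_radiusQuantile (hkn : k < n) {r : ℝ} (hr : r < radiusQuantile Q n k) :
    (k : ℝ) / n < Q.real {x | r < ‖x‖} := by
  have hcompl (r : ℝ) : Q.real {x | ‖x‖ ≤ r} = 1 - Q.real {x | r < ‖x‖} := by
    rw [← probReal_compl_eq_one_sub (measurableSet_lt_norm r)]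
    congr 1; ext x; simp
  by_contra hcon
  -- The set is bounded below by 0: at a negative level the distribution function is 0, whereas 1 -
  -- k/n > 0.
  refine absurd hr (not_lt.2 (csInf_le ⟨0, fun u hu => ?_⟩ ?_))
  · by_contra hu0
    have : {x : EuclideanSpace ℝ (Fin d) | ‖x‖ ≤ u} = ∅ := by
      ext x
      simp only [Set.mem_ofPred_eq, Set.mem_empty_iff_false, iff_false, not_le]
      linarith [norm_nonneg x]
    rw [Set.mem_ofPred_eq, this, measureReal_empty] at hu
    have hn : (0 : ℝ) < n := by exact_mod_cast (Nat.zero_le k).trans_lt hkn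
    have : (k : ℝ) / n < 1 := (div_lt_one hn).2 (by exact_mod_cast hkn)
    linarith
  · rw [Set.mem_ofPred_eq, hcompl]
    linarith

variable {k : ℕ → ℕ}

lemma _root_.ExtremePCA.eventually_lt_of_tendsto_div (hkn : Tendsto (fun n => (k n : ℝ) / n) atTop (𝓝 0)) :
    ∀ᶠ n in atTop, k n < n := by
  filter_upwards [hkn.eventually_lt_const one_pos, eventually_gt_atTop 0] with n hn hn0
  have hn' : (0 : ℝ) < n := by exact_mod_cast hn0
  rw [div_lt_one hn'] at hn
  exact_mod_cast hn

lemma tendsto_radiusQuantile (h : IsRegularlyVarying Q μ) (hk : Tendsto k atTop atTop)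
    (hkn : Tendsto (fun n => (k n : ℝ) / n) atTop (𝓝 0)) :
    Tendsto (fun n => radiusQuantile Q n (k n)) atTop atTop := by
  refine tendsto_atTop.2 fun T => ?_
  filter_upwards [hkn.eventually_lt_const (h.measureReal_lt_norm_pos T),
    eventually_lt_of_tendsto_div hkn, hk.eventually_gt_atTop 0] with n hn1 hn2 hn3
  by_contra hcon
  have h1 := measureReal_lt_radiusQuantile_le (Q := Q) hn3 hn2
  have h2 : Q.real {x | T < ‖x‖} ≤ Q.real {x | radiusQuantile Q n (k n) < ‖x‖} :=
    measureReal_mono fun x hx => lt_trans (not_le.1 hcon) hx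
  linarith

/-- With atoms in the law of the norm the tail at the quantile t can be smaller than k/n. But the
tail at t/s exceeds k/n for every s > 1, and the ratio of the two tails tends to a value that is
close to 1 for s near 1. -/
lemma tendsto_tail_radiusQuantile_one (h : IsRegularlyVarying Q μ) (hk : Tendsto k atTop atTop)
    (hkn : Tendsto (fun n => (k n : ℝ) / n) atTop (𝓝 0)) :
    Tendsto (fun n : ℕ => n * Q.real {x | radiusQuantile Q n (k n) < ‖x‖} / k n) atTop
      (𝓝 1) := by
  have ht := h.tendsto_radiusQuantile hk hkn
  rw [tendsto_order]
  constructor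
  · intro a ha
    have hcont := h.continuousAt_tail one_pos
    have h1 : ∀ᶠ s in 𝓝 (1 : ℝ), a < μ.real {x | s < ‖x‖} := by
      refine hcont.eventually (lt_mem_nhds ?_)
      simpa only [h.tail_one] using ha
    obtain ⟨ε, hε, hball⟩ := Metric.eventually_nhds_iff.1 h1
    set s : ℝ := 1 + ε / 2 with hs
    have hs1 : 1 < s := by linarith
    have hs0 : 0 < s := by linarith
    have has : a < μ.real {x | s < ‖x‖} := hball (by
      rw [Real.dist_eq, hs, add_sub_cancel_left, abs_of_pos (by positivity)]; linarith)
    have hlim := (h.tendsto_tail hs0).comp (ht.const_mul_atTop (inv_pos.2 hs0))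
    filter_upwards [hlim.eventually (lt_mem_nhds has), eventually_lt_of_tendsto_div hkn,
      hk.eventually_gt_atTop 0, ht.eventually_gt_atTop 0] with n hn1 hn2 hn3 hn4
    simp only [Function.comp_apply, mul_inv_cancel_left₀ hs0.ne'] at hn1
    have hlt : s⁻¹ * radiusQuantile Q n (k n) < radiusQuantile Q n (k n) := by
      have := inv_lt_one_of_one_lt₀ hs1
      nlinarith
    have h2 := lt_measureReal_of_lt_radiusQuantile hn2 hlt
    have hn0 : (0 : ℝ) < n := by exact_mod_cast hn3.trans hn2
    have hk0 : (0 : ℝ) < k n := by exact_mod_cast hn3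
    refine hn1.trans_le ?_
    have hG := (h.measureReal_lt_norm_pos (s⁻¹ * radiusQuantile Q n (k n)))
    rw [div_lt_iff₀ hn0] at h2
    rw [div_le_div_iff₀ hG hk0]
    nlinarith [measureReal_nonneg (μ := Q) (s := {x | radiusQuantile Q n (k n) < ‖x‖})]
  · intro a ha
    filter_upwards [eventually_lt_of_tendsto_div hkn, hk.eventually_gt_atTop 0] with n hn2 hn3
    have h2 := measureReal_lt_radiusQuantile_le (Q := Q) hn3 hn2
    have hn0 : (0 : ℝ) < n := by exact_mod_cast hn3.trans hn2
    have hk0 : (0 : ℝ) < k n := by exact_mod_cast hn3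
    refine lt_of_le_of_lt ?_ ha
    rw [div_le_one hk0]
    rw [le_div_iff₀ hn0] at h2
    linarith

/-- The expected number of exceedances over `s t_{n,k}`, relative to `k`, converges. -/
lemma tendsto_tail_radiusQuantile (h : IsRegularlyVarying Q μ) (hk : Tendsto k atTop atTop)
    (hkn : Tendsto (fun n => (k n : ℝ) / n) atTop (𝓝 0)) {s : ℝ} (hs : 0 < s) :
    Tendsto (fun n : ℕ => n * Q.real {x | s * radiusQuantile Q n (k n) < ‖x‖} / k n) atTop
      (𝓝 (μ.real {x | s < ‖x‖})) := by
  have h1 := (h.tendsto_tail hs).comp (h.tendsto_radiusQuantile hk hkn)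
  have h2 := h1.mul (h.tendsto_tail_radiusQuantile_one hk hkn)
  rw [mul_one] at h2
  refine h2.congr fun n => ?_
  have := (h.measureReal_lt_norm_pos (radiusQuantile Q n (k n))).ne'
  simp only [Function.comp_apply]
  field_simp

end Quantile

end IsRegularlyVarying

end RegularVariation

end ExtremePCA

namespace ExtremePCA

/-! ### Upper order statistics and exceedance sets, with ties allowed. -/

section OrderStatistic

variable {n : ℕ}

lemma card_filter_comp_perm (σ : Equiv.Perm (Fin n)) (p : Fin n → Prop) [DecidablePred p] :
    (Finset.univ.filter fun j => p (σ j)).card = (Finset.univ.filter p).card :=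
  Finset.card_bij (fun j _ => σ j) (by simp) (by simp) fun b hb => ⟨σ.symm b, by simpa using hb⟩

/-- Counting lemma behind the characterisation of order statistics: `p` is an upper set property
of the sorted values. -/
lemma sorted_prop_iff_lt_card {k : ℕ} (hk : k < n) (r : Fin n → ℝ) (p : ℝ → Prop)
    [DecidablePred p] (hp : ∀ a b, a ≤ b → p a → p b) :
    p (upperOrderStat k r) ↔ k < (Finset.univ.filter fun i => p (r i)).card := by
  rw [upperOrderStat, dif_pos hk]
  have hmono := Tuple.monotone_sort r
  rw [← card_filter_comp_perm (Tuple.sort r) (fun i => p (r i))]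
  constructor
  · intro h
    have hsub : Finset.Ici (⟨n - 1 - k, by omega⟩ : Fin n) ⊆
        Finset.univ.filter fun j => p (r (Tuple.sort r j)) := by
      intro j hj
      simp only [Finset.mem_Ici] at hj
      simpa using hp _ _ (hmono hj) h
    have := Finset.card_le_card hsub
    rw [Fin.card_Ici] at this
    simp only at this
    omega
  · intro h
    by_contra hcon
    have hsub : (Finset.univ.filter fun j => p (r (Tuple.sort r j))) ⊆
        Finset.Ioi (⟨n - 1 - k, by omega⟩ : Fin n) := by
      intro j hj
      simp only [Finset.mem_filter, Finset.mem_univ, true_and] at hj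
      rw [Finset.mem_Ioi]
      by_contra hle
      exact hcon (hp _ _ (hmono (not_lt.1 hle)) hj)
    have := Finset.card_le_card hsub
    rw [Fin.card_Ioi] at this
    simp only at this
    omega

lemma lt_upperOrderStat_iff {k : ℕ} (hk : k < n) (r : Fin n → ℝ) (a : ℝ) :
    a < upperOrderStat k r ↔ k < (Finset.univ.filter fun i => a < r i).card :=
  sorted_prop_iff_lt_card hk r (fun b => a < b) fun _ _ h h' => h'.trans_le h

lemma le_upperOrderStat_iff {k : ℕ} (hk : k < n) (r : Fin n → ℝ) (a : ℝ) :
    a ≤ upperOrderStat k r ↔ k < (Finset.univ.filter fun i => a ≤ r i).card :=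
  sorted_prop_iff_lt_card hk r (fun b => a ≤ b) fun _ _ h h' => h'.trans h

lemma upperOrderStat_eq {k : ℕ} (hk : k < n) (r : Fin n → ℝ) (a : ℝ)
    (h₁ : (Finset.univ.filter fun i => a < r i).card ≤ k)
    (h₂ : k < (Finset.univ.filter fun i => a ≤ r i).card) : upperOrderStat k r = a :=
  le_antisymm (not_lt.1 fun h => absurd ((lt_upperOrderStat_iff hk r a).1 h) (not_lt.2 h₁))
    ((le_upperOrderStat_iff hk r a).2 h₂)

/-- The indices of the exceedances over the upper order statistic. -/
noncomputable def exceedances (k : ℕ) (r : Fin n → ℝ) : Finset (Fin n) :=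
  Finset.univ.filter fun i => upperOrderStat k r < r i

lemma mem_exceedances {k : ℕ} {r : Fin n → ℝ} {i : Fin n} :
    i ∈ exceedances k r ↔ upperOrderStat k r < r i := by simp [exceedances]

lemma card_exceedances_le {k : ℕ} (hk : k < n) (r : Fin n → ℝ) :
    (exceedances k r).card ≤ k :=
  not_lt.1 fun h => lt_irrefl _ ((lt_upperOrderStat_iff hk r _).2 h)

/-- More than `k` values reach the threshold but at most `k` exceed it, so it is attained by a
non-exceedance. Given the exceedance set, the threshold thus depends only on the values outside that
set. -/
lemma upperOrderStat_eq_sup'_compl {k : ℕ} (hk : k < n) (r : Fin n → ℝ) {I : Finset (Fin n)}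
    (hI : Iᶜ.Nonempty) (h : exceedances k r = I) : upperOrderStat k r = Iᶜ.sup' hI r := by
  have h₁ := (le_upperOrderStat_iff hk r _).1 le_rfl
  have h₂ := card_exceedances_le hk r
  apply le_antisymm
  · obtain ⟨j, hj, hj'⟩ : ∃ j ∈ Finset.univ.filter (fun i => upperOrderStat k r ≤ r i),
        j ∉ exceedances k r := by
      by_contra! hcon
      exact absurd (Finset.card_le_card hcon) (by omega)
    refine (Finset.mem_filter.1 hj).2.trans (Finset.le_sup' r ?_)
    rw [h] at hj'
    simpa using hj'
  · refine Finset.sup'_le _ _ fun j hj => ?_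
    rw [Finset.mem_compl, ← h, mem_exceedances, not_lt] at hj
    exact hj

/-- The exceedance set is `I` iff the values on `I` exceed the maximum over the complement,
together with a condition involving the values on the complement only. -/
lemma exceedances_eq_iff {k : ℕ} (hk : k < n) (r : Fin n → ℝ) {I : Finset (Fin n)}
    (hI : Iᶜ.Nonempty) :
    exceedances k r = I ↔ (I.card ≤ k ∧
      k < I.card + (Iᶜ.filter fun j => Iᶜ.sup' hI r ≤ r j).card) ∧
      ∀ i ∈ I, Iᶜ.sup' hI r < r i := by
  have hunion : (∀ i ∈ I, Iᶜ.sup' hI r < r i) →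
      Finset.univ.filter (fun i => Iᶜ.sup' hI r ≤ r i) =
        I ∪ Iᶜ.filter fun j => Iᶜ.sup' hI r ≤ r j := by
    intro h
    ext i
    simp only [Finset.mem_filter, Finset.mem_univ, true_and, Finset.mem_union, Finset.mem_compl]
    by_cases hi : i ∈ I
    · simp [hi, (h i hi).le]
    · simp [hi]
  have hdisj : Disjoint I (Iᶜ.filter fun j => Iᶜ.sup' hI r ≤ r j) :=
    disjoint_compl_right.mono_right (Finset.filter_subset _ _)
  constructor
  · intro h
    have ht := upperOrderStat_eq_sup'_compl hk r hI h
    have hall : ∀ i ∈ I, Iᶜ.sup' hI r < r i := by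
      intro i hi
      rw [← h, mem_exceedances] at hi
      rwa [← ht]
    refine ⟨⟨h ▸ card_exceedances_le hk r, ?_⟩, hall⟩
    rw [← Finset.card_union_of_disjoint hdisj, ← hunion hall, ← ht]
    exact (le_upperOrderStat_iff hk r _).1 le_rfl
  · rintro ⟨⟨h₁, h₂⟩, hall⟩
    have hlt : Finset.univ.filter (fun i => Iᶜ.sup' hI r < r i) = I := by
      ext i
      simp only [Finset.mem_filter, Finset.mem_univ, true_and]
      refine ⟨fun hi => ?_, hall i⟩
      by_contra hcon
      exact absurd (Finset.le_sup' r (Finset.mem_compl.2 hcon)) (not_le.2 hi)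
    have ht : upperOrderStat k r = Iᶜ.sup' hI r := by
      refine upperOrderStat_eq hk r _ (by rw [hlt]; exact h₁) ?_
      rwa [hunion hall, Finset.card_union_of_disjoint hdisj]
    rw [exceedances, ht, hlt]

end OrderStatistic

/-! ### Measurability of order statistics and exceedance sets. -/

section Measurability

variable {S : Type*} [MeasurableSpace S] {n : ℕ} {r : S → ℝ}

lemma measurable_card_filter {α ι : Type*} [MeasurableSpace α] (s : Finset ι) (p : α → ι → Prop)
    [∀ x, DecidablePred (p x)] (hp : ∀ i, MeasurableSet {x | p x i}) :
    Measurable fun x => (s.filter (p x)).card := by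
  simp_rw [Finset.card_filter]
  exact Finset.measurable_sum _ fun i _ => Measurable.ite (hp i) measurable_const measurable_const

lemma measurable_upperOrderStat (hr : Measurable r) (k : ℕ) :
    Measurable fun x : Fin n → S => upperOrderStat k fun i => r (x i) := by
  by_cases hk : k < n
  · refine measurable_of_Ioi fun a => ?_
    have : (fun x : Fin n → S => upperOrderStat k fun i => r (x i)) ⁻¹' Set.Ioi a =
        (fun x : Fin n → S => (Finset.univ.filter fun i => a < r (x i)).card) ⁻¹' Set.Ioi k := by
      ext x
      simp [lt_upperOrderStat_iff hk]
    rw [this]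
    refine measurable_card_filter _ _ (fun i => ?_) measurableSet_Ioi
    exact measurableSet_lt measurable_const (by fun_prop)
  · simp [upperOrderStat, hk]

lemma measurableSet_mem_exceedances (hr : Measurable r) (k : ℕ) (i : Fin n) :
    MeasurableSet {x : Fin n → S | i ∈ exceedances k fun i => r (x i)} := by
  simp_rw [mem_exceedances]
  exact measurableSet_lt (measurable_upperOrderStat hr k) (by fun_prop)

lemma measurable_exceedances (hr : Measurable r) (k : ℕ) (I : Finset (Fin n)) :
    MeasurableSet {x : Fin n → S | (exceedances k fun i => r (x i)) = I} := by
  have : {x : Fin n → S | (exceedances k fun i => r (x i)) = I} =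
      ⋂ i, {x : Fin n → S | (i ∈ exceedances k fun i => r (x i)) ↔ i ∈ I} := by
    ext x; simp [Finset.ext_iff]
  rw [this]
  refine MeasurableSet.iInter fun i => ?_
  by_cases hi : i ∈ I
  · simpa [hi] using measurableSet_mem_exceedances hr k i
  · simp only [hi, iff_false]
    exact (measurableSet_mem_exceedances hr k i).compl

lemma measurable_prod_exceedances (hr : Measurable r) (k : ℕ) {g : ℝ → S → ℂ}
    (hg : Measurable (Function.uncurry g)) :
    Measurable fun x : Fin n → S => ∏ i ∈ exceedances k fun i => r (x i),
      g (upperOrderStat k fun i => r (x i)) (x i) := by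
  have : (fun x : Fin n → S => ∏ i ∈ exceedances k fun i => r (x i),
      g (upperOrderStat k fun i => r (x i)) (x i)) =
      fun x => ∏ i, if i ∈ exceedances k fun i => r (x i) then
        g (upperOrderStat k fun i => r (x i)) (x i) else 1 := by
    ext x
    rw [Finset.prod_ite_mem, Finset.univ_inter]
  rw [this]
  refine Finset.measurable_prod _ fun i _ => Measurable.ite (measurableSet_mem_exceedances hr k i)
    ?_ measurable_const
  exact hg.comp ((measurable_upperOrderStat hr k).prodMk (measurable_pi_apply i))

end Measurability

/-! ### The exceedances given the threshold are conditionally iid. -/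

section Conditioning

variable {S : Type*} [MeasurableSpace S] {n : ℕ} {r : S → ℝ} (Q : Measure S)
  [IsProbabilityMeasure Q]

/-- The part of the left-hand side of `integral_prod_exceedances` on the event that the exceedance
set is `I`. -/
lemma integral_prod_exceedances_eq (hr : Measurable r) {k : ℕ} (hk : k < n) (I : Finset (Fin n))
    {g : ℝ → S → ℂ} (hg : Measurable (Function.uncurry g)) (hb : ∀ t s, ‖g t s‖ ≤ 1)
    (hI : Iᶜ.Nonempty) (hI' : (Finset.univ : Finset {i // ¬ i ∈ I}).Nonempty) :
    ∫ x : Fin n → S, (if (exceedances k fun i => r (x i)) = I then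
      ∏ i ∈ exceedances k fun i => r (x i), g (upperOrderStat k fun i => r (x i)) (x i) else 0)
      ∂(Measure.pi fun _ => Q) =
    ∫ z : {i // ¬ i ∈ I} → S, (if I.card ≤ k ∧ k < I.card + (Finset.univ.filter fun j =>
        Finset.univ.sup' hI' (fun j => r (z j)) ≤ r (z j)).card then 1 else 0) *
      (∫ s, (if Finset.univ.sup' hI' (fun j => r (z j)) < r s then
        g (Finset.univ.sup' hI' (fun j => r (z j))) s else 0) ∂Q) ^ I.card
      ∂(Measure.pi fun _ => Q) := by
  classical
  let H : (Fin n → S) → ℂ := fun x => if (exceedances k fun i => r (x i)) = I then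
    ∏ i ∈ exceedances k fun i => r (x i), g (upperOrderStat k fun i => r (x i)) (x i) else 0
  -- Split the sample into the coordinates y in `I` and z outside, in order to integrate over y
  -- first.
  have mp := (measurePreserving_piEquivPiSubtypeProd (fun _ : Fin n => Q) (fun i => i ∈ I)).symm
  rw [← mp.integral_comp']
  have hsup (y : {i // i ∈ I} → S) (z : {i // ¬ i ∈ I} → S) : Iᶜ.sup' hI (fun i => r
      ((MeasurableEquiv.piEquivPiSubtypeProd (fun _ : Fin n => S) fun i => i ∈ I).symm (y, z) i)) =
      Finset.univ.sup' hI' (fun j => r (z j)) := by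
    apply le_antisymm
    · refine Finset.sup'_le _ _ fun j hj => ?_
      have hj' : ¬ j ∈ I := by simpa using hj
      have : (MeasurableEquiv.piEquivPiSubtypeProd (fun _ : Fin n => S)
        fun i => i ∈ I).symm (y, z) j = z ⟨j, hj'⟩ := by
        simp [MeasurableEquiv.piEquivPiSubtypeProd, Equiv.piEquivPiSubtypeProd, hj']
      rw [this]
      exact Finset.le_sup' (fun j => r (z j)) (Finset.mem_univ _)
    · refine Finset.sup'_le _ _ fun j hj => ?_
      have : z j = (MeasurableEquiv.piEquivPiSubtypeProd (fun _ : Fin n => S)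
        fun i => i ∈ I).symm (y, z) j := by
        simp [MeasurableEquiv.piEquivPiSubtypeProd, Equiv.piEquivPiSubtypeProd, j.2]
      rw [this]
      exact Finset.le_sup' (fun i => r ((MeasurableEquiv.piEquivPiSubtypeProd (fun _ : Fin n => S)
        fun i => i ∈ I).symm (y, z) i)) (by simpa using j.2)
  -- The threshold and the counting condition are functions of z alone; what remains is a product
  -- over the coordinates of y, so the inner integral is a power.
  have hmain (y : {i // i ∈ I} → S) (z : {i // ¬ i ∈ I} → S) :
      H ((MeasurableEquiv.piEquivPiSubtypeProd (fun _ : Fin n => S) fun i => i ∈ I).symm (y, z)) =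
      (if I.card ≤ k ∧ k < I.card + (Finset.univ.filter fun j =>
        Finset.univ.sup' hI' (fun j => r (z j)) ≤ r (z j)).card then 1 else 0) *
      ∏ i, (if Finset.univ.sup' hI' (fun j => r (z j)) < r (y i) then
        g (Finset.univ.sup' hI' (fun j => r (z j))) (y i) else 0) := by
    set x := (MeasurableEquiv.piEquivPiSubtypeProd (fun _ : Fin n => S)
      fun i => i ∈ I).symm (y, z) with hxdef
    have hx (i : {i // i ∈ I}) : x i = y i := by
      simp [x, i.2]
    have hcard : (Iᶜ.filter fun j => Finset.univ.sup' hI' (fun j => r (z j)) ≤ r (x j)).card =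
        (Finset.univ.filter fun j : {i // ¬ i ∈ I} =>
          Finset.univ.sup' hI' (fun j => r (z j)) ≤ r (z j)).card := by
      symm
      refine Finset.card_bij (fun j _ => j.1) ?_ (fun a _ b _ h => Subtype.ext h) ?_
      · intro j hj
        simp only [Finset.mem_filter, Finset.mem_univ, true_and] at hj
        simp only [Finset.mem_filter, Finset.mem_compl, j.2, not_false_eq_true, true_and]
        simpa [x, MeasurableEquiv.piEquivPiSubtypeProd, Equiv.piEquivPiSubtypeProd, j.2] using hj
      · intro j hj
        simp only [Finset.mem_filter, Finset.mem_compl] at hj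
        refine ⟨⟨j, hj.1⟩, ?_, rfl⟩
        simpa [x, MeasurableEquiv.piEquivPiSubtypeProd, Equiv.piEquivPiSubtypeProd, hj.1] using hj.2
    have key := exceedances_eq_iff hk (fun i => r (x i)) hI
    rw [hsup y z, hcard] at key
    simp only [H]
    by_cases hc : I.card ≤ k ∧ k < I.card + (Finset.univ.filter fun j =>
        Finset.univ.sup' hI' (fun j => r (z j)) ≤ r (z j)).card
    · by_cases hall : ∀ i ∈ I, Finset.univ.sup' hI' (fun j => r (z j)) < r (x i)
      · have hexc := key.2 ⟨hc, hall⟩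
        have ht := upperOrderStat_eq_sup'_compl hk _ hI hexc
        rw [hsup y z] at ht
        rw [if_pos hexc, if_pos hc, hexc, ht, one_mul, ← Finset.prod_coe_sort]
        refine Finset.prod_congr rfl fun i _ => ?_
        rw [← hx, if_pos (hall i i.2)]
      · rw [if_neg (fun h => hall (key.1 h).2)]
        push Not at hall
        obtain ⟨i, hi, hle⟩ := hall
        rw [Finset.prod_eq_zero (Finset.mem_univ (⟨i, hi⟩ : {i // i ∈ I})), mul_zero]
        rw [← hx ⟨i, hi⟩, if_neg (not_lt.2 hle)]
    · rw [if_neg (fun h => hc (key.1 h).1), if_neg hc, zero_mul]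
  have hint (ρ : Measure (({i // i ∈ I} → S) × ({i // ¬ i ∈ I} → S))) [IsFiniteMeasure ρ] :
      Integrable (fun p : ({i // i ∈ I} → S) × ({i // ¬ i ∈ I} → S) =>
      H ((MeasurableEquiv.piEquivPiSubtypeProd (fun _ : Fin n => S) fun i => i ∈ I).symm p)) ρ := by
    refine Integrable.of_bound (C := 1) ?_ (Eventually.of_forall fun p => ?_)
    · refine Measurable.aestronglyMeasurable ?_
      exact (Measurable.ite (measurable_exceedances hr k I) (measurable_prod_exceedances hr k hg)
        measurable_const).comp (MeasurableEquiv.measurable _)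
    · simp only [H]
      split_ifs
      · rw [norm_prod]
        exact Finset.prod_le_one (fun _ _ => norm_nonneg _) fun _ _ => hb _ _
      · simp
  refine (integral_prod_symm _ (hint _)).trans ?_
  refine integral_congr_ae (Eventually.of_forall fun z => ?_)
  simp only [hmain]
  rw [integral_const_mul]
  congr 1
  refine Eq.trans ?_ ((integral_fintype_prod_eq_prod (μ := fun _ => Q)
    (f := fun (_ : {i // i ∈ I}) s =>
      (if Finset.univ.sup' hI' (fun j => r (z j)) < r s then
        g (Finset.univ.sup' hI' (fun j => r (z j))) s else 0))).trans (by simp))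
  congr!

/-- Substituting the conditional mean for `g` above level `t` preserves the integral. If the level
is never exceeded, both sides are 0. -/
lemma integral_ite_cond (hr : Measurable r) (t : ℝ) (g : S → ℂ) :
    ∫ s, (if t < r s then ∫ u, g u ∂(cond Q {s | t < r s}) else 0) ∂Q =
      ∫ s, (if t < r s then g s else 0) ∂Q := by
  have hm : MeasurableSet {s | t < r s} := measurableSet_lt measurable_const hr
  have h1 (f : S → ℂ) : ∫ s, (if t < r s then f s else 0) ∂Q = ∫ s in {s | t < r s}, f s ∂Q := by
    rw [← integral_indicator hm]; rfl
  rw [h1, h1, setIntegral_const]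
  by_cases h0 : Q {s | t < r s} = 0
  · rw [Measure.restrict_eq_zero.2 h0]
    simp [Measure.real, h0]
  · rw [ProbabilityTheory.cond, integral_smul_measure, smul_smul, Measure.real, ENNReal.toReal_inv,
      mul_inv_cancel₀, one_smul]
    exact ENNReal.toReal_ne_zero.2 ⟨h0, measure_ne_top _ _⟩

lemma measurable_integral_cond {F : Type*} [NormedAddCommGroup F] [NormedSpace ℝ F]
    [MeasurableSpace F] [BorelSpace F] [SecondCountableTopology F] (hr : Measurable r)
    {g : ℝ → S → F}
    (hg : Measurable (Function.uncurry g)) :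
    Measurable fun t => ∫ s, g t s ∂(cond Q {s | t < r s}) := by
  have hm (t : ℝ) : MeasurableSet {s | t < r s} := measurableSet_lt measurable_const hr
  have h1 (t : ℝ) : ∫ s, g t s ∂(cond Q {s | t < r s}) =
      (Q {s | t < r s})⁻¹.toReal • ∫ s, (if t < r s then g t s else 0) ∂Q := by
    rw [ProbabilityTheory.cond, integral_smul_measure, ← integral_indicator (hm t)]; rfl
  simp_rw [h1]
  have hset : MeasurableSet {p : ℝ × S | p.1 < r p.2} :=
    measurableSet_lt measurable_fst (hr.comp measurable_snd)
  refine Measurable.fun_smul ?_ ?_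
  · refine (Measurable.inv ?_).ennreal_toReal
    exact measurable_measure_prodMk_left hset
  · refine StronglyMeasurable.measurable ?_
    refine StronglyMeasurable.integral_prod_right (f := fun t s => if t < r s then g t s else 0) ?_
    refine Measurable.stronglyMeasurable ?_
    exact Measurable.ite hset hg measurable_const

/-- Conditionally on the upper order statistic and on the exceedance set, the exceedances are iid
with the law of an observation conditioned to exceed the order statistic. -/
theorem integral_prod_exceedances (hr : Measurable r) {k : ℕ} (hk : k < n)
    {g : ℝ → S → ℂ} (hg : Measurable (Function.uncurry g)) (hb : ∀ t s, ‖g t s‖ ≤ 1) :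
    ∫ x : Fin n → S, ∏ i ∈ exceedances k fun i => r (x i),
        g (upperOrderStat k fun i => r (x i)) (x i) ∂(Measure.pi fun _ => Q) =
      ∫ x : Fin n → S, (∫ s, g (upperOrderStat k fun i => r (x i)) s
          ∂(cond Q {s | (upperOrderStat k fun i => r (x i)) < r s})) ^
        (exceedances k fun i => r (x i)).card ∂(Measure.pi fun _ => Q) := by
  classical
  have hsplit (g : ℝ → S → ℂ) (hg : Measurable (Function.uncurry g))
      (hb : ∀ t s, ‖g t s‖ ≤ 1) :
      ∫ x : Fin n → S, ∏ i ∈ exceedances k fun i => r (x i),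
        g (upperOrderStat k fun i => r (x i)) (x i) ∂(Measure.pi fun _ => Q) =
      ∑ I : Finset (Fin n), ∫ x : Fin n → S, (if (exceedances k fun i => r (x i)) = I then
        ∏ i ∈ exceedances k fun i => r (x i), g (upperOrderStat k fun i => r (x i)) (x i) else 0)
        ∂(Measure.pi fun _ => Q) := by
    rw [← integral_finsetSum]
    · refine integral_congr_ae (Eventually.of_forall fun x => ?_)
      simp
    · intro I _
      refine Integrable.of_bound (C := 1) ?_ (Eventually.of_forall fun p => ?_)
      · exact (Measurable.ite (measurable_exceedances hr k I) (measurable_prod_exceedances hr k hg)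
          measurable_const).aestronglyMeasurable
      · split_ifs
        · rw [norm_prod]
          exact Finset.prod_le_one (fun _ _ => norm_nonneg _) fun _ _ => hb _ _
        · simp
  -- The right-hand side is the left-hand side with `g` replaced by its conditional mean, as a
  -- function constant in the observation. So it suffices that this replacement leaves the
  -- contribution of each exceedance set unchanged.
  set φ : ℝ → S → ℂ := fun t _ => ∫ u, g t u ∂(cond Q {s | t < r s}) with hφ
  have hφm : Measurable (Function.uncurry φ) :=
    (measurable_integral_cond Q hr hg).comp measurable_fst
  have hφb : ∀ t s, ‖φ t s‖ ≤ 1 := by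
    intro t s
    by_cases h0 : Q {s | t < r s} = 0
    · simp [hφ, ProbabilityTheory.cond, Measure.restrict_eq_zero.2 h0]
    · have := cond_isProbabilityMeasure h0
      simpa using norm_integral_le_of_norm_le_const (μ := cond Q {s | t < r s}) (C := 1)
        (Eventually.of_forall fun s => hb t s)
  have hpow (x : Fin n → S) : (∫ s, g (upperOrderStat k fun i => r (x i)) s
          ∂(cond Q {s | (upperOrderStat k fun i => r (x i)) < r s})) ^
        (exceedances k fun i => r (x i)).card =
      ∏ i ∈ exceedances k fun i => r (x i), φ (upperOrderStat k fun i => r (x i)) (x i) := by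
    simp [hφ]
  simp_rw [hpow]
  rw [hsplit g hg hb, hsplit φ hφm hφb]
  refine Finset.sum_congr rfl fun I _ => ?_
  by_cases hI : Iᶜ.Nonempty
  · have hI' : (Finset.univ : Finset {i // ¬ i ∈ I}).Nonempty := by
      obtain ⟨j, hj⟩ := hI
      exact ⟨⟨j, by simpa using hj⟩, Finset.mem_univ _⟩
    rw [integral_prod_exceedances_eq Q hr hk I hg hb hI hI',
      integral_prod_exceedances_eq Q hr hk I hφm hφb hI hI']
    refine integral_congr_ae (Eventually.of_forall fun z => ?_)
    simp only [hφ]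
    rw [integral_ite_cond Q hr]
  -- Not all observations can be exceedances, as there are at most k < n of them.
  · have hne (x : Fin n → S) : (exceedances k fun i => r (x i)) ≠ I := by
      intro h
      rw [Finset.not_nonempty_iff_eq_empty, Finset.compl_eq_empty_iff] at hI
      have := card_exceedances_le hk fun i => r (x i)
      rw [h, hI, Finset.card_univ, Fintype.card_fin] at this
      omega
    simp [hne]

end Conditioning

end ExtremePCA

namespace ExtremePCA

/-! ### Perturbation of resolutions of the identity. -/

section SpectralFamily

variable {𝒜 : Type*} [NormedRing 𝒜] [NormedAlgebra ℝ 𝒜]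

/-- A resolution of the identity by contractive idempotents that commute with `T`, such that `T` is
`η`-close to the scalar `x` on the range of `p x`. -/
structure SpectralFamily (s : Finset ℝ) (T : 𝒜) (p : ℝ → 𝒜) (η : ℝ) : Prop where
  idem : ∀ x ∈ s, p x * p x = p x
  comm : ∀ x ∈ s, p x * T = T * p x
  sum_eq_one : ∑ x ∈ s, p x = 1
  norm_le_one : ∀ x ∈ s, ‖p x‖ ≤ 1
  norm_sub_le : ∀ x ∈ s, ‖T * p x - x • p x‖ ≤ η

namespace SpectralFamily

variable {s : Finset ℝ} {S T : 𝒜} {p q : ℝ → 𝒜} {η g : ℝ}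

/-- A Sylvester identity: `S` acts nearly as x on the range of `q x` and `T` nearly as y on that of
`p y`, so sandwiching S - T between the two gives nearly (x - y) times their product. -/
lemma norm_mul_sub_smul_le (hp : SpectralFamily s T p η) (hq : SpectralFamily s S q η) {x y : ℝ}
    (hx : x ∈ s) (hy : y ∈ s) :
    ‖p y * (S - T) * q x - (x - y) • (p y * q x)‖ ≤ 2 * η * ‖p y * q x‖ := by
  have h : p y * (S - T) * q x - (x - y) • (p y * q x) =
      p y * q x * (S * q x - x • q x) - (T * p y - y • p y) * (p y * q x) := by
    have h1 : p y * q x * (S * q x) = p y * S * q x := by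
      rw [← hq.comm x hx, mul_assoc, ← mul_assoc (q x) (q x), hq.idem x hx, hq.comm x hx, mul_assoc]
    have h2 : p y * q x * q x = p y * q x := by rw [mul_assoc, hq.idem x hx]
    have h3 : T * p y * (p y * q x) = p y * T * q x := by
      rw [hp.comm y hy, mul_assoc, ← mul_assoc (p y) (p y), hp.idem y hy, mul_assoc]
    have h4 : p y * (p y * q x) = p y * q x := by rw [← mul_assoc, hp.idem y hy]
    rw [mul_sub, sub_mul, mul_sub (p y * q x), sub_mul (T * p y), mul_smul_comm, smul_mul_assoc,
      h1, h2, h3, h4, sub_smul]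
    abel
  rw [h]
  calc _ ≤ ‖p y * q x * (S * q x - x • q x)‖ + ‖(T * p y - y • p y) * (p y * q x)‖ :=
        _root_.norm_sub_le _ _
    _ ≤ ‖p y * q x‖ * η + η * ‖p y * q x‖ := by
        gcongr
        · exact (_root_.norm_mul_le _ _).trans (by gcongr; exact hq.norm_sub_le x hx)
        · exact (_root_.norm_mul_le _ _).trans (by gcongr; exact hp.norm_sub_le y hy)
    _ = 2 * η * ‖p y * q x‖ := by ring

/-- Off-diagonal blocks have the size of the perturbation: since 4η ≤ g, the error 2η in the
Sylvester identity takes up at most half of the gap. -/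
lemma norm_mul_le (hp : SpectralFamily s T p η) (hq : SpectralFamily s S q η) (hg : 0 < g)
    (hgap : ∀ x ∈ s, ∀ y ∈ s, x ≠ y → g ≤ |x - y|) (hη : 4 * η ≤ g) {x y : ℝ}
    (hx : x ∈ s) (hy : y ∈ s) (hxy : x ≠ y) : ‖p y * q x‖ ≤ 2 / g * ‖S - T‖ := by
  have h1 := hp.norm_mul_sub_smul_le hq hx hy
  have h2 : ‖(x - y) • (p y * q x)‖ ≤ ‖p y * (S - T) * q x‖ + 2 * η * ‖p y * q x‖ := by
    have := norm_sub_norm_le ((x - y) • (p y * q x)) (p y * (S - T) * q x)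
    rw [norm_sub_rev] at this
    linarith
  have h3 : ‖p y * (S - T) * q x‖ ≤ ‖S - T‖ := by
    calc _ ≤ ‖p y‖ * ‖S - T‖ * ‖q x‖ :=
          (_root_.norm_mul_le _ _).trans (by gcongr; exact _root_.norm_mul_le _ _)
      _ ≤ 1 * ‖S - T‖ * 1 := by
          gcongr
          · exact hp.norm_le_one y hy
          · exact hq.norm_le_one x hx
      _ = _ := by ring
  rw [norm_smul, Real.norm_eq_abs] at h2
  have h4 := hgap x hx y hy hxy
  have h5 : 0 ≤ ‖p y * q x‖ := norm_nonneg _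
  have h6 : g / 2 * ‖p y * q x‖ ≤ ‖S - T‖ := by nlinarith
  rw [div_mul_eq_mul_div, le_div_iff₀ hg]
  linarith

/-- Expand each projection by the other family's resolution of the identity; the common diagonal
block cancels and only off-diagonal blocks are left. -/
lemma sub_eq_sum (hp : SpectralFamily s T p η) (hq : SpectralFamily s S q η) {x : ℝ}
    (hx : x ∈ s) : q x - p x = ∑ y ∈ s.erase x, (p y * q x - p x * q y) := by
  have h1 : q x = ∑ y ∈ s, p y * q x := by rw [← Finset.sum_mul, hp.sum_eq_one, one_mul]
  have h2 : p x = ∑ y ∈ s, p x * q y := by rw [← Finset.mul_sum, hq.sum_eq_one, mul_one]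
  conv_lhs => rw [h1, h2]
  rw [← Finset.sum_sub_distrib, ← Finset.add_sum_erase _ _ hx, sub_self, zero_add]

lemma norm_sub_le_mul (hp : SpectralFamily s T p η) (hq : SpectralFamily s S q η) (hg : 0 < g)
    (hgap : ∀ x ∈ s, ∀ y ∈ s, x ≠ y → g ≤ |x - y|) (hη : 4 * η ≤ g) {x : ℝ} (hx : x ∈ s) :
    ‖q x - p x‖ ≤ s.card * (4 / g) * ‖S - T‖ := by
  rw [hp.sub_eq_sum hq hx]
  calc _ ≤ ∑ y ∈ s.erase x, 4 / g * ‖S - T‖ := by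
        refine norm_sum_le_of_le _ fun y hy => ?_
        obtain ⟨hne, hy⟩ := Finset.mem_erase.1 hy
        have h1 := hp.norm_mul_le hq hg hgap hη hx hy hne.symm
        have h2 := hp.norm_mul_le hq hg hgap hη hy hx hne
        refine (_root_.norm_sub_le _ _).trans ((add_le_add h1 h2).trans_eq ?_)
        ring
    _ = (s.erase x).card * (4 / g * ‖S - T‖) := by simp
    _ ≤ s.card * (4 / g * ‖S - T‖) := by
        gcongr
        exact Finset.erase_subset _ _
    _ = _ := by ring

/-- First order expansion of spectral projections. -/
lemma norm_sub_add_sum_le {U : 𝒜} {u : ℝ → 𝒜} (hu : SpectralFamily s U u η)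
    (hp : SpectralFamily s T p η) (hq : SpectralFamily s S q η) (hg : 0 < g)
    (hgap : ∀ x ∈ s, ∀ y ∈ s, x ≠ y → g ≤ |x - y|) (hη : 4 * η ≤ g) (hT : ‖T - U‖ ≤ η)
    (hS : ‖S - U‖ ≤ η) {x : ℝ} (hx : x ∈ s) :
    ‖q x - p x + ∑ y ∈ s.erase x, (y - x)⁻¹ •
      (u y * (S - T) * u x + u x * (S - T) * u y)‖ ≤
      2 * s.card * (4 / g ^ 2 + 8 * s.card / g ^ 2) * η * ‖S - T‖ := by
  have hη0 : 0 ≤ η := (norm_nonneg _).trans hT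
  -- Each off-diagonal block is first order in S - T by the Sylvester identity. Replacing p, q by
  -- the reference projections u costs a further factor η, because all three families are Lipschitz
  -- close.
  have key (x y : ℝ) (hx : x ∈ s) (hy : y ∈ s) (hxy : x ≠ y) :
      ‖p y * q x - (x - y)⁻¹ • (u y * (S - T) * u x)‖ ≤
        (4 / g ^ 2 + 8 * s.card / g ^ 2) * η * ‖S - T‖ := by
    have hne : x - y ≠ 0 := sub_ne_zero.2 hxy
    have h0 := hgap x hx y hy hxy
    have hinv : |(x - y)⁻¹| ≤ g⁻¹ := by
      rw [abs_inv]
      exact inv_anti₀ hg h0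
    have h1 := hp.norm_mul_sub_smul_le hq hx hy
    have h2 := hp.norm_mul_le hq hg hgap hη hx hy hxy
    have h3 : ‖p y - u y‖ ≤ s.card * (4 / g) * η :=
      (hu.norm_sub_le_mul hp hg hgap hη hy).trans (by gcongr)
    have h4 : ‖q x - u x‖ ≤ s.card * (4 / g) * η :=
      (hu.norm_sub_le_mul hq hg hgap hη hx).trans (by gcongr)
    have hsplit : p y * q x - (x - y)⁻¹ • (u y * (S - T) * u x) =
        (x - y)⁻¹ • ((p y - u y) * (S - T) * q x + u y * (S - T) * (q x - u x) -
          (p y * (S - T) * q x - (x - y) • (p y * q x))) := by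
      rw [smul_sub, smul_sub, smul_smul, inv_mul_cancel₀ hne, one_smul]
      have : (p y - u y) * (S - T) * q x + u y * (S - T) * (q x - u x) =
          p y * (S - T) * q x - u y * (S - T) * u x := by noncomm_ring
      rw [this, smul_sub]
      abel
    have h5 : ‖(p y - u y) * (S - T) * q x‖ ≤ s.card * (4 / g) * η * ‖S - T‖ * 1 :=
      (_root_.norm_mul_le _ _).trans (mul_le_mul ((_root_.norm_mul_le _ _).trans
        (by gcongr)) (hq.norm_le_one x hx) (norm_nonneg _) (by positivity))
    have h6 : ‖u y * (S - T) * (q x - u x)‖ ≤ 1 * ‖S - T‖ * (s.card * (4 / g) * η) :=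
      (_root_.norm_mul_le _ _).trans (mul_le_mul ((_root_.norm_mul_le _ _).trans
        (by gcongr; exact hu.norm_le_one y hy)) h4 (norm_nonneg _) (by positivity))
    rw [hsplit, norm_smul, Real.norm_eq_abs]
    calc _ ≤ g⁻¹ * (s.card * (4 / g) * η * ‖S - T‖ * 1 +
          1 * ‖S - T‖ * (s.card * (4 / g) * η) + 2 * η * (2 / g * ‖S - T‖)) := by
          refine mul_le_mul hinv ?_ (norm_nonneg _) (by positivity)
          refine (_root_.norm_sub_le _ _).trans (add_le_add ((norm_add_le _ _).trans
            (add_le_add h5 h6)) (h1.trans ?_))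
          gcongr
      _ = _ := by field_simp; ring
  have hrew : q x - p x + ∑ y ∈ s.erase x, (y - x)⁻¹ •
      (u y * (S - T) * u x + u x * (S - T) * u y) =
      ∑ y ∈ s.erase x, ((p y * q x - (x - y)⁻¹ • (u y * (S - T) * u x)) -
        (p x * q y - (y - x)⁻¹ • (u x * (S - T) * u y))) := by
    rw [hp.sub_eq_sum hq hx, ← Finset.sum_add_distrib]
    refine Finset.sum_congr rfl fun y _ => ?_
    rw [← neg_sub y x, inv_neg, neg_smul, smul_add]
    abel
  rw [hrew]
  calc _ ≤ ∑ y ∈ s.erase x, 2 * ((4 / g ^ 2 + 8 * s.card / g ^ 2) * η * ‖S - T‖) := by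
        refine norm_sum_le_of_le _ fun y hy => ?_
        obtain ⟨hne, hy⟩ := Finset.mem_erase.1 hy
        refine (_root_.norm_sub_le _ _).trans ((add_le_add (key x y hx hy hne.symm)
          (key y x hy hx hne)).trans_eq ?_)
        ring
    _ = (s.erase x).card * (2 * ((4 / g ^ 2 + 8 * s.card / g ^ 2) * η * ‖S - T‖)) := by simp
    _ ≤ s.card * (2 * ((4 / g ^ 2 + 8 * s.card / g ^ 2) * η * ‖S - T‖)) := by
        gcongr
        exact Finset.erase_subset _ _
    _ = _ := by ring

end SpectralFamily

end SpectralFamily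

/-! ### Eigensystems, Weyl's inequality and strict differentiability of spectral projections. -/

section Eigensystems

variable {d : ℕ}

/-- The orthonormal basis formed by an eigensystem. -/
noncomputable def IsOrderedEigensystem.basis {A : Matrix (Fin d) (Fin d) ℝ} {lam : Fin d → ℝ}
    {v : Fin d → EuclideanSpace ℝ (Fin d)} (h : IsOrderedEigensystem A lam v) :
    OrthonormalBasis (Fin d) ℝ (EuclideanSpace ℝ (Fin d)) :=
  OrthonormalBasis.mk h.orthonormal
    (h.orthonormal.linearIndependent.span_eq_top_of_card_eq_finrank' (by simp)).ge

variable {A B : Matrix (Fin d) (Fin d) ℝ} {lam lam' : Fin d → ℝ}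
  {v v' : Fin d → EuclideanSpace ℝ (Fin d)}

namespace IsOrderedEigensystem

@[simp]
lemma basis_apply (h : IsOrderedEigensystem A lam v) (m : Fin d) : h.basis m = v m := by
  simp [basis]

lemma toEuclideanCLM_apply (h : IsOrderedEigensystem A lam v) (m : Fin d) :
    Matrix.toEuclideanCLM (𝕜 := ℝ) A (v m) = lam m • v m := by
  rw [← h.eigen m, ← Matrix.coe_toEuclideanCLM_eq_toEuclideanLin]
  rfl

lemma toEuclideanCLM_apply_eq_sum (h : IsOrderedEigensystem A lam v)
    (z : EuclideanSpace ℝ (Fin d)) :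
    Matrix.toEuclideanCLM (𝕜 := ℝ) A z = ∑ m, (lam m * inner ℝ (v m) z) • v m := by
  conv_lhs => rw [← h.basis.sum_repr' z]
  rw [map_sum]
  refine Finset.sum_congr rfl fun m _ => ?_
  rw [map_smul, h.basis_apply, h.toEuclideanCLM_apply, smul_smul, mul_comm]

lemma inner_toEuclideanCLM_apply (h : IsOrderedEigensystem A lam v)
    (z : EuclideanSpace ℝ (Fin d)) :
    inner ℝ (Matrix.toEuclideanCLM (𝕜 := ℝ) A z) z = ∑ m, lam m * (inner ℝ (v m) z) ^ 2 := by
  rw [h.toEuclideanCLM_apply_eq_sum, sum_inner]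
  refine Finset.sum_congr rfl fun m _ => ?_
  rw [real_inner_smul_left]
  ring

lemma norm_sq_eq_sum (h : IsOrderedEigensystem A lam v) (z : EuclideanSpace ℝ (Fin d)) :
    ‖z‖ ^ 2 = ∑ m, (inner ℝ (v m) z) ^ 2 := by
  rw [← h.basis.sum_sq_inner_right z]
  simp

lemma smul (h : IsOrderedEigensystem A lam v) {c : ℝ} (hc : 0 ≤ c) :
    IsOrderedEigensystem (c • A) (fun m => c * lam m) v where
  antitone _ _ hij := mul_le_mul_of_nonneg_left (h.antitone hij) hc
  orthonormal := h.orthonormal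
  eigen m := by simp [h.eigen m, smul_smul]

/-- One half of Weyl's inequality, by the Courant-Fischer argument. -/
lemma le_add_opNorm (hA : IsOrderedEigensystem A lam v) (hB : IsOrderedEigensystem B lam' v')
    (m : Fin d) : lam m ≤ lam' m + opNorm (A - B) := by
  -- Indices start at 0: m + 1 coefficients against m orthogonality conditions. A kernel element
  -- gives a nonzero vector in the span of v 0, …, v m that is orthogonal to v' 0, …, v' (m-1).
  let f : ({i : Fin d // i ≤ m} → ℝ) →ₗ[ℝ] ({i : Fin d // i < m} → ℝ) :=
    LinearMap.pi fun j => ((innerₛₗ ℝ (v' j)).comp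
      (Fintype.linearCombination ℝ fun i : {i : Fin d // i ≤ m} => v i))
  have hker : LinearMap.ker f ≠ ⊥ := by
    refine LinearMap.ker_ne_bot_of_finrank_lt ?_
    simp only [Module.finrank_fintype_fun_eq_card, Fintype.card_subtype]
    rw [Finset.filter_gt_eq_Iio, Finset.filter_ge_eq_Iic, Fin.card_Iio, Fin.card_Iic]
    omega
  obtain ⟨c, hc, hc0⟩ := Submodule.exists_mem_ne_zero_of_ne_bot hker
  set u := ∑ i : {i : Fin d // i ≤ m}, c i • v i with hu
  have hu' : ∀ i, i < m → inner ℝ (v' i) u = 0 := by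
    intro i hi
    have := congrFun (LinearMap.mem_ker.1 hc) ⟨i, hi⟩
    simpa [f, Fintype.linearCombination_apply] using this
  have hli := (hA.orthonormal.linearIndependent.comp (Subtype.val : {i : Fin d // i ≤ m} → Fin d)
    Subtype.val_injective)
  have hu0 : u ≠ 0 := by
    intro h0
    rw [Fintype.linearIndependent_iff] at hli
    exact hc0 (funext fun i => hli c h0 i)
  have hv : ∀ i, m < i → inner ℝ (v i) u = 0 := by
    intro i hi
    rw [hu, inner_sum]
    refine Finset.sum_eq_zero fun j _ => ?_
    rw [inner_smul_right, hA.orthonormal.2 (j.2.trans_lt hi).ne', mul_zero]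
  have h1 : lam m * ‖u‖ ^ 2 ≤ inner ℝ (Matrix.toEuclideanCLM (𝕜 := ℝ) A u) u := by
    rw [hA.inner_toEuclideanCLM_apply, hA.norm_sq_eq_sum, Finset.mul_sum]
    refine Finset.sum_le_sum fun i _ => ?_
    rcases le_or_gt i m with hi | hi
    · exact mul_le_mul_of_nonneg_right (hA.antitone hi) (sq_nonneg _)
    · simp [hv i hi]
  have h2 : inner ℝ (Matrix.toEuclideanCLM (𝕜 := ℝ) B u) u ≤ lam' m * ‖u‖ ^ 2 := by
    rw [hB.inner_toEuclideanCLM_apply, hB.norm_sq_eq_sum, Finset.mul_sum]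
    refine Finset.sum_le_sum fun i _ => ?_
    rcases lt_or_ge i m with hi | hi
    · simp [hu' i hi]
    · exact mul_le_mul_of_nonneg_right (hB.antitone hi) (sq_nonneg _)
  have h3 : inner ℝ (Matrix.toEuclideanCLM (𝕜 := ℝ) (A - B) u) u ≤ opNorm (A - B) * ‖u‖ ^ 2 := by
    refine (real_inner_le_norm _ _).trans ?_
    rw [sq, ← mul_assoc]
    exact mul_le_mul_of_nonneg_right (ContinuousLinearMap.le_opNorm _ _) (norm_nonneg _)
  rw [map_sub, sub_apply, inner_sub_left] at h3
  have hpos : 0 < ‖u‖ ^ 2 := by positivity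
  nlinarith

/-- **Weyl's inequality.** -/
lemma abs_sub_le_opNorm (hA : IsOrderedEigensystem A lam v) (hB : IsOrderedEigensystem B lam' v')
    (m : Fin d) : |lam m - lam' m| ≤ opNorm (A - B) := by
  have h1 := hA.le_add_opNorm hB m
  have h2 := hB.le_add_opNorm hA m
  have h3 : opNorm (B - A) = opNorm (A - B) := by
    simp only [opNorm, map_sub]
    exact norm_sub_rev _ _
  rw [abs_le]
  constructor <;> linarith

lemma norm_le_of_diagonal (h : IsOrderedEigensystem A lam v) {c : Fin d → ℝ} {η : ℝ}
    (hη : 0 ≤ η) (hc : ∀ m, |c m| ≤ η)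
    {D : EuclideanSpace ℝ (Fin d) →L[ℝ] EuclideanSpace ℝ (Fin d)}
    (hD : ∀ m, D (v m) = c m • v m) : ‖D‖ ≤ η := by
  refine D.opNorm_le_bound hη fun z => ?_
  have hz : D z = ∑ m, (c m * inner ℝ (v m) z) • v m := by
    conv_lhs => rw [← h.basis.sum_repr' z]
    rw [map_sum]
    refine Finset.sum_congr rfl fun m _ => ?_
    rw [map_smul, h.basis_apply, hD, smul_smul, mul_comm]
  have hcoef (m : Fin d) : inner ℝ (v m) (D z) = c m * inner ℝ (v m) z := by
    rw [hz, h.orthonormal.inner_right_fintype]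
  refine abs_le_of_sq_le_sq' ?_ (by positivity) |>.2
  rw [mul_pow, h.norm_sq_eq_sum, h.norm_sq_eq_sum z, Finset.mul_sum]
  refine Finset.sum_le_sum fun m _ => ?_
  rw [hcoef, mul_pow]
  exact mul_le_mul_of_nonneg_right (sq_le_sq' (neg_le_of_abs_le (hc m)) (le_of_abs_le (hc m)))
    (sq_nonneg _)

end IsOrderedEigensystem

open scoped Classical in
lemma starProjection_matchedSpan_apply (hv : Orthonormal ℝ v) (lam : Fin d → ℝ) (x : ℝ)
    (m : Fin d) :
    (matchedSpan lam v x).starProjection (v m) = if lam m = x then v m else 0 := by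
  split_ifs with h
  · exact Submodule.starProjection_eq_self_iff.2 (Submodule.subset_span ⟨m, h, rfl⟩)
  · rw [Submodule.starProjection_apply_eq_zero_iff, Submodule.mem_orthogonal]
    intro u hu
    refine Submodule.span_induction (p := fun u _ => inner ℝ u (v m) = 0) ?_ (by simp) ?_ ?_ hu
    · rintro _ ⟨j, hj, rfl⟩
      exact hv.2 fun hjm => h (hjm ▸ hj)
    · intro a b _ _ ha hb
      rw [inner_add_left, ha, hb, add_zero]
    · intro c a _ ha
      rw [inner_smul_left, ha, mul_zero]

namespace IsOrderedEigensystem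

lemma clm_ext (h : IsOrderedEigensystem A lam v)
    {D D' : EuclideanSpace ℝ (Fin d) →L[ℝ] EuclideanSpace ℝ (Fin d)}
    (hD : ∀ m, D (v m) = D' (v m)) : D = D' := by
  refine ContinuousLinearMap.coe_injective (h.basis.toBasis.ext fun m => ?_)
  simpa using hD m

lemma matchedSpan_self (h : IsOrderedEigensystem A lam v) (x : ℝ) :
    matchedSpan lam v x = eigenspaceOf A x := by
  apply le_antisymm
  · refine Submodule.span_le.2 ?_
    rintro _ ⟨m, hm, rfl⟩
    rw [SetLike.mem_coe, eigenspaceOf, Module.End.mem_eigenspace_iff, h.eigen, hm]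
  · intro z hz
    rw [eigenspaceOf, Module.End.mem_eigenspace_iff] at hz
    have hz' : Matrix.toEuclideanCLM (𝕜 := ℝ) A z = x • z := by
      rw [← hz, ← Matrix.coe_toEuclideanCLM_eq_toEuclideanLin]; rfl
    rw [← h.basis.sum_repr' z]
    refine Submodule.sum_mem _ fun m _ => ?_
    rw [h.basis_apply]
    by_cases hm : lam m = x
    · exact Submodule.smul_mem _ _ (Submodule.subset_span ⟨m, hm, rfl⟩)
    · have h1 : inner ℝ (v m) (Matrix.toEuclideanCLM (𝕜 := ℝ) A z) = lam m * inner ℝ (v m) z := by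
        rw [h.toEuclideanCLM_apply_eq_sum, h.orthonormal.inner_right_fintype]
      rw [hz', inner_smul_right] at h1
      have : inner ℝ (v m) z = 0 := by
        have h2 : (lam m - x) * inner ℝ (v m) z = 0 := by linarith
        exact (mul_eq_zero.1 h2).resolve_left (sub_ne_zero.2 hm)
      rw [this, zero_smul]
      exact Submodule.zero_mem _

/-- The spectral family of `A` obtained by grouping its eigenvectors like those of `B`. -/
lemma spectralFamily (h : IsOrderedEigensystem A lam v) (h' : IsOrderedEigensystem B lam' v')
    {η : ℝ} (hη : opNorm (A - B) ≤ η) :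
    SpectralFamily (distinctValues lam') (Matrix.toEuclideanCLM (𝕜 := ℝ) A)
      (fun x => (matchedSpan lam' v x).starProjection) η where
  idem x _ := h.clm_ext fun m => by
    simp only [mul_apply_eq_comp, starProjection_matchedSpan_apply h.orthonormal]
    split_ifs with hm <;> simp [starProjection_matchedSpan_apply h.orthonormal, hm]
  comm x _ := h.clm_ext fun m => by
    simp only [mul_apply_eq_comp, starProjection_matchedSpan_apply h.orthonormal,
      h.toEuclideanCLM_apply, map_smul]
    split_ifs with hm <;> simp [h.toEuclideanCLM_apply]
  sum_eq_one := h.clm_ext fun m => by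
    simp [starProjection_matchedSpan_apply h.orthonormal,
      distinctValues]
  norm_le_one x _ := Submodule.starProjection_norm_le _
  norm_sub_le x _ := by
    classical
    have h0 : 0 ≤ η := (norm_nonneg _).trans hη
    -- In the eigenbasis of `A` the operator is diagonal, and on the group of x its entries are
    -- differences of paired eigenvalues, controlled by Weyl's inequality.
    refine h.norm_le_of_diagonal (c := fun m => if lam' m = x then lam m - lam' m else 0) h0
      (fun m => ?_) fun m => ?_
    · split_ifs
      · exact (h.abs_sub_le_opNorm h' m).trans hη
      · simpa using h0
    · simp only [sub_apply, mul_apply_eq_comp,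
        smul_apply, starProjection_matchedSpan_apply h.orthonormal]
      split_ifs with hm
      · rw [h.toEuclideanCLM_apply, hm, sub_smul]
      · simp

end IsOrderedEigensystem

lemma exists_gap (s : Finset ℝ) : ∃ g : ℝ, 0 < g ∧ ∀ x ∈ s, ∀ y ∈ s, x ≠ y → g ≤ |x - y| := by
  classical
  by_cases h : s.offDiag.Nonempty
  · refine ⟨s.offDiag.inf' h fun p => |p.1 - p.2|, ?_, fun x hx y hy hxy => ?_⟩
    · rw [Finset.lt_inf'_iff]
      intro p hp
      exact abs_pos.2 (sub_ne_zero.2 (Finset.mem_offDiag.1 hp).2.2)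
    · exact Finset.inf'_le (fun p : ℝ × ℝ => |p.1 - p.2|)
        (b := (x, y)) (Finset.mem_offDiag.2 ⟨hx, hy, hxy⟩)
  · refine ⟨1, one_pos, fun x hx y hy hxy => ?_⟩
    exact absurd ⟨(x, y), Finset.mem_offDiag.2 ⟨hx, hy, hxy⟩⟩ h

@[simp]
lemma toEuclideanCLM_projMatrix (W : Submodule ℝ (EuclideanSpace ℝ (Fin d))) :
    Matrix.toEuclideanCLM (𝕜 := ℝ) (projMatrix W) = W.starProjection := by
  simp [projMatrix]

/-- Strict differentiability of the spectral projections at `M`. -/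
theorem exists_opNorm_projMatrix_sub_le {M : Matrix (Fin d) (Fin d) ℝ} {lamM : Fin d → ℝ}
    {vM : Fin d → EuclideanSpace ℝ (Fin d)} (hM : IsOrderedEigensystem M lamM vM) {δ : ℝ}
    (hδ : 0 < δ) : ∃ ρ : ℝ, 0 < ρ ∧ ∀ (A B : Matrix (Fin d) (Fin d) ℝ) (lam lam' : Fin d → ℝ)
      (v v' : Fin d → EuclideanSpace ℝ (Fin d)), IsOrderedEigensystem A lam v →
      IsOrderedEigensystem B lam' v' → opNorm (A - M) ≤ ρ → opNorm (B - M) ≤ ρ →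
      ∀ x ∈ distinctValues lamM,
        opNorm (projMatrix (matchedSpan lamM v' x) - projMatrix (matchedSpan lamM v x) +
          limitMap M (distinctValues lamM) (B - A) x) ≤ δ * opNorm (B - A) := by
  obtain ⟨g, hg, hgap⟩ := exists_gap (distinctValues lamM)
  set K : ℝ := 2 * (distinctValues lamM).card *
    (4 / g ^ 2 + 8 * (distinctValues lamM).card / g ^ 2) with hK
  have hK0 : 0 ≤ K := by positivity
  -- The first bound supplies 4η ≤ g; the second reduces the constant K η of the expansion to δ. The
  -- reference family is the one of `M`.
  refine ⟨min (g / 4) (δ / (K + 1)), by positivity, ?_⟩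
  intro A B lam lam' v v' hA hB hAM hBM x hx
  set η := min (g / 4) (δ / (K + 1)) with hη
  have h4 : 4 * η ≤ g := by linarith [min_le_left (g / 4) (δ / (K + 1))]
  have hη0 : 0 ≤ η := (norm_nonneg _).trans hAM
  have hKη : K * η ≤ δ := by
    have h1 : η ≤ δ / (K + 1) := min_le_right _ _
    have h2 : (K + 1) * η ≤ δ := by
      rw [le_div_iff₀ (by positivity)] at h1
      linarith
    linarith
  have hMM : opNorm (M - M) ≤ η := by simpa [opNorm] using hη0
  have key := (hM.spectralFamily hM hMM).norm_sub_add_sum_le (hA.spectralFamily hM hAM)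
    (hB.spectralFamily hM hBM) hg hgap h4 (by simpa [opNorm] using hAM)
    (by simpa [opNorm] using hBM) hx
  rw [← hK] at key
  have hrew : Matrix.toEuclideanCLM (𝕜 := ℝ) (projMatrix (matchedSpan lamM v' x) -
      projMatrix (matchedSpan lamM v x) + limitMap M (distinctValues lamM) (B - A) x) =
      (matchedSpan lamM v' x).starProjection - (matchedSpan lamM v x).starProjection +
      ∑ y ∈ (distinctValues lamM).erase x, (y - x)⁻¹ •
        ((matchedSpan lamM vM y).starProjection * (Matrix.toEuclideanCLM (𝕜 := ℝ) B -
          Matrix.toEuclideanCLM (𝕜 := ℝ) A) * (matchedSpan lamM vM x).starProjection +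
        (matchedSpan lamM vM x).starProjection * (Matrix.toEuclideanCLM (𝕜 := ℝ) B -
          Matrix.toEuclideanCLM (𝕜 := ℝ) A) * (matchedSpan lamM vM y).starProjection) := by
    simp only [limitMap, map_add, map_sub, map_sum, map_smul, map_mul, toEuclideanCLM_projMatrix,
      hM.matchedSpan_self]
  have hBA : opNorm (B - A) = ‖Matrix.toEuclideanCLM (𝕜 := ℝ) B -
      Matrix.toEuclideanCLM (𝕜 := ℝ) A‖ := by simp [opNorm]
  rw [hBA, opNorm, hrew]
  refine key.trans ?_
  exact mul_le_mul_of_nonneg_right hKη (norm_nonneg _)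

end Eigensystems

end ExtremePCA

namespace ExtremePCA

/-! ### Estimates for characteristic functions. -/

section CharFunBounds

open Complex in
/-- Second order expansion of the characteristic function of a small centered variable. -/
lemma norm_integral_cexp_sub_le {S : Type*} [MeasurableSpace S] (ρ : Measure S)
    [IsProbabilityMeasure ρ] {z : S → ℝ} (hz : AEMeasurable z ρ) {c : ℝ} (hc : c ≤ 1)
    (hb : ∀ᵐ x ∂ρ, |z x| ≤ c) (h0 : ∫ x, z x ∂ρ = 0) :
    ‖∫ x, cexp (z x * I) ∂ρ - (1 - (∫ x, z x ^ 2 ∂ρ : ℝ) / 2)‖ ≤ c ^ 3 := by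
  have hc0 : 0 ≤ c := by
    obtain ⟨x, hx⟩ := hb.exists
    exact (abs_nonneg _).trans hx
  have hi1 : Integrable (fun x => cexp (z x * I)) ρ := by
    refine Integrable.of_bound (C := 1) (by fun_prop) (Eventually.of_forall fun x => ?_)
    rw [norm_exp_ofReal_mul_I]
  have hi2 : Integrable z ρ := Integrable.of_bound hz.aestronglyMeasurable c hb
  have hi3 : Integrable (fun x => z x ^ 2) ρ := by
    refine Integrable.of_bound (hz.pow_const 2).aestronglyMeasurable (c ^ 2) ?_
    filter_upwards [hb] with x hx
    rw [norm_pow, Real.norm_eq_abs]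
    gcongr
  have hi4 : Integrable (fun x => ((z x : ℝ) : ℂ) * I) ρ := hi2.ofReal.mul_const I
  have hi5 : Integrable (fun x => ((z x ^ 2 : ℝ) : ℂ) / 2) ρ := hi3.ofReal.div_const 2
  have heq : ∫ x, cexp (z x * I) ∂ρ - (1 - (∫ x, z x ^ 2 ∂ρ : ℝ) / 2) =
      ∫ x, (cexp (z x * I) - (1 + z x * I - ((z x ^ 2 : ℝ) : ℂ) / 2)) ∂ρ := by
    have hi6 : Integrable (fun x => (1 : ℂ) + z x * I) ρ := (integrable_const _).add hi4
    have hi7 : Integrable (fun x => (1 : ℂ) + z x * I - ((z x ^ 2 : ℝ) : ℂ) / 2) ρ := hi6.sub hi5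
    rw [integral_sub hi1 hi7, integral_sub hi6 hi5, integral_add (integrable_const _) hi4,
      integral_mul_const, integral_div, integral_complex_ofReal, integral_complex_ofReal, h0]
    simp
  rw [heq]
  have hpt : ∀ᵐ x ∂ρ, ‖cexp (z x * I) - (1 + z x * I - ((z x ^ 2 : ℝ) : ℂ) / 2)‖ ≤ c ^ 3 := by
    filter_upwards [hb] with x hx
    have hn : ‖(z x : ℂ) * I‖ = |z x| := by simp
    have h1 := Complex.exp_bound (x := (z x : ℂ) * I) (by rw [hn]; exact hx.trans hc)
      (n := 3) (by norm_num)
    have h2 : ∑ m ∈ Finset.range 3, ((z x : ℂ) * I) ^ m / (m.factorial : ℂ) =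
        1 + z x * I - ((z x ^ 2 : ℝ) : ℂ) / 2 := by
      simp [Finset.sum_range_succ, mul_pow, Nat.factorial]
      ring
    rw [h2, hn] at h1
    refine h1.trans ?_
    have h3 : |z x| ^ 3 ≤ c ^ 3 := by gcongr
    have h4 : (((3 : ℕ).succ : ℝ) * (((3 : ℕ).factorial : ℝ) * (3 : ℕ))⁻¹) ≤ 1 := by
      norm_num [Nat.factorial]
    calc _ ≤ |z x| ^ 3 * 1 := by gcongr
      _ ≤ c ^ 3 := by linarith
  simpa using norm_integral_le_of_norm_le_const hpt

lemma norm_pow_sub_pow_le {a b : ℂ} (ha : ‖a‖ ≤ 1) (hb : ‖b‖ ≤ 1) (N : ℕ) :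
    ‖a ^ N - b ^ N‖ ≤ N * ‖a - b‖ := by
  induction N with
  | zero => simp
  | succ N ih =>
    have : a ^ (N + 1) - b ^ (N + 1) = a ^ N * (a - b) + (a ^ N - b ^ N) * b := by ring
    rw [this]
    have h1 : ‖a ^ N‖ ≤ 1 := by rw [norm_pow]; exact pow_le_one₀ (norm_nonneg _) ha
    calc _ ≤ ‖a ^ N‖ * ‖a - b‖ + ‖a ^ N - b ^ N‖ * ‖b‖ := by
          refine (norm_add_le _ _).trans ?_
          rw [norm_mul, norm_mul]
      _ ≤ 1 * ‖a - b‖ + N * ‖a - b‖ * 1 := by gcongr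
      _ = _ := by push_cast; ring

/-- Compare `φ` with exp(-v/(2k)) and telescope the `N`-th powers. The four terms come from the
expansion of `φ`, the wrong variance, the second order of the exponential, and the k - N missing
factors. -/
lemma norm_pow_sub_cexp_le {φ : ℂ} (hφ : ‖φ‖ ≤ 1) {N k : ℕ} (hk : 0 < k) (hN : N ≤ k) {σ v : ℝ}
    (hv : 0 ≤ v) (hvk : v / 2 ≤ k) :
    ‖φ ^ N - Complex.exp (-v / 2)‖ ≤ k * ‖φ - (1 - ((σ / k : ℝ) : ℂ) / 2)‖ + |σ - v| / 2 +
      v ^ 2 / (4 * k) + v / 2 * (1 - N / k) := by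
  have hk0 : (0 : ℝ) < k := by exact_mod_cast hk
  set b : ℝ := v / 2 / k with hb
  have hb0 : 0 ≤ b := by positivity
  have hb1 : b ≤ 1 := (div_le_one hk0).2 hvk
  set e : ℂ := ((Real.exp (-b) : ℝ) : ℂ) with he
  have hen : ‖e‖ ≤ 1 := by
    rw [he, Complex.norm_real, Real.norm_eq_abs, abs_of_pos (Real.exp_pos _)]
    exact Real.exp_le_one_iff.2 (by linarith)
  have h1 : ‖φ ^ N - e ^ N‖ ≤ k * ‖φ - e‖ :=
    (norm_pow_sub_pow_le hφ hen N).trans (by gcongr)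
  have h2 : ‖φ - e‖ ≤ ‖φ - (1 - ((σ / k : ℝ) : ℂ) / 2)‖ + |σ - v| / (2 * k) + b ^ 2 := by
    have hsplit : φ - e = (φ - (1 - ((σ / k : ℝ) : ℂ) / 2)) +
        (((v - σ) / (2 * k) : ℝ) : ℂ) + ((-(Real.exp (-b) - 1 - (-b)) : ℝ) : ℂ) := by
      rw [he, hb]
      push_cast
      field_simp
      ring
    rw [hsplit]
    refine (norm_add₃_le).trans ?_
    gcongr
    · rw [Complex.norm_real, Real.norm_eq_abs, abs_div, abs_sub_comm, abs_of_pos (by positivity :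
        (0 : ℝ) < 2 * k)]
    · rw [Complex.norm_real, Real.norm_eq_abs, abs_neg]
      have := Real.abs_exp_sub_one_sub_id_le (x := -b) (by rw [abs_neg, abs_of_nonneg hb0]; exact hb1)
      simpa using this
  have h3 : ‖e ^ N - Complex.exp (-v / 2)‖ ≤ v / 2 * (1 - N / k) := by
    have hE : Complex.exp (-v / 2) = ((Real.exp (-(v / 2)) : ℝ) : ℂ) := by
      push_cast; congr 1; ring
    have hE2 : e ^ N = ((Real.exp (-(N * b)) : ℝ) : ℂ) := by
      rw [he, ← Complex.ofReal_pow, ← Real.exp_nat_mul]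
      congr 2; ring
    rw [hE, hE2, ← Complex.ofReal_sub, Complex.norm_real, Real.norm_eq_abs]
    have hNk : N * b ≤ v / 2 := by
      rw [hb, mul_div_assoc', div_le_iff₀ hk0, mul_comm]
      have : (N : ℝ) ≤ k := by exact_mod_cast hN
      gcongr
    have hmono : Real.exp (-(v / 2)) ≤ Real.exp (-(N * b)) := Real.exp_le_exp.2 (by linarith)
    rw [abs_of_nonneg (by linarith)]
    have hfac : Real.exp (-(v / 2)) = Real.exp (-(N * b)) * Real.exp (-(v / 2 - N * b)) := by
      rw [← Real.exp_add]; congr 1; ring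
    have hle1 : Real.exp (-(N * b)) ≤ 1 := Real.exp_le_one_iff.2 (by
      have : 0 ≤ N * b := by positivity
      linarith)
    have hge := Real.add_one_le_exp (-(v / 2 - N * b))
    have hpos := Real.exp_pos (-(N * b))
    have hval : v / 2 * (1 - N / k) = v / 2 - N * b := by rw [hb]; field_simp
    rw [hval, hfac]
    nlinarith
  calc _ ≤ ‖φ ^ N - e ^ N‖ + ‖e ^ N - Complex.exp (-v / 2)‖ := norm_sub_le_norm_sub_add_norm_sub _ _ _
    _ ≤ k * (‖φ - (1 - ((σ / k : ℝ) : ℂ) / 2)‖ + |σ - v| / (2 * k) + b ^ 2) +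
        v / 2 * (1 - N / k) := by
        gcongr
        exact h1.trans (by gcongr)
    _ = _ := by rw [hb]; field_simp; ring

end CharFunBounds

/-! ### Iid samples and convergence in probability. -/

section Sample

variable {Ω : Type*} [MeasurableSpace Ω] {P : Measure Ω}

lemma tendsto_measure_zero_of_subset {ι : Type*} {l : Filter ι} {A B C : ι → Set Ω}
    (hB : Tendsto (fun n => P (B n)) l (𝓝 0)) (hC : Tendsto (fun n => P (C n)) l (𝓝 0))
    (h : ∀ᶠ n in l, ∀ w ∈ A n, w ∈ B n ∨ w ∈ C n) :
    Tendsto (fun n => P (A n)) l (𝓝 0) := by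
  have hBC := hB.add hC
  rw [add_zero] at hBC
  refine tendsto_of_tendsto_of_tendsto_of_le_of_le' tendsto_const_nhds hBC
    (Eventually.of_forall fun _ => zero_le) ?_
  filter_upwards [h] with n hn
  exact (measure_mono (fun w hw => hn w hw)).trans (measure_union_le _ _)

/-- Bounded functions that converge in probability to a constant converge in mean. -/
lemma tendsto_integral_of_tendstoInMeasure_const [IsProbabilityMeasure P] {f : ℕ → Ω → ℂ} {c : ℂ}
    (hf : ∀ n, AEStronglyMeasurable (f n) P) (hb : ∀ n w, ‖f n w‖ ≤ 1) (hc : ‖c‖ ≤ 1)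
    (h : ∀ ε : ℝ, 0 < ε → Tendsto (fun n => P {w | ε < ‖f n w - c‖}) atTop (𝓝 0)) :
    Tendsto (fun n => ∫ w, f n w ∂P) atTop (𝓝 c) := by
  rw [Metric.tendsto_atTop']
  intro ε hε
  have h1 := (ENNReal.tendsto_toReal ENNReal.zero_ne_top).comp (h (ε / 4) (by positivity))
  have h2 : ∀ᶠ n in atTop, P.real {w | ε / 4 < ‖f n w - c‖} < ε / 4 :=
    h1.eventually_lt_const (by simp; positivity)
  obtain ⟨N, hN⟩ := eventually_atTop.1 h2
  refine ⟨N, fun n hn => ?_⟩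
  have hbad := hN n hn.le
  have hint : Integrable (f n) P := Integrable.of_bound (hf n) 1 (Eventually.of_forall (hb n))
  have hmeas : NullMeasurableSet {w | ε / 4 < ‖f n w - c‖} P :=
    nullMeasurableSet_lt aemeasurable_const ((hf n).sub aestronglyMeasurable_const).norm.aemeasurable
  have heq : ∫ w, f n w ∂P - c = ∫ w, (f n w - c) ∂P := by
    rw [integral_sub hint (integrable_const _)]; simp
  rw [dist_eq_norm, heq]
  have hind : Integrable (Set.indicator {w | ε / 4 < ‖f n w - c‖} fun _ => (2 : ℝ)) P :=
    (integrable_const _).indicator₀ hmeas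
  calc _ ≤ ∫ w, (ε / 4 + Set.indicator {w | ε / 4 < ‖f n w - c‖} (fun _ => (2 : ℝ)) w) ∂P := by
        refine norm_integral_le_of_norm_le ((integrable_const _).add hind)
          (Eventually.of_forall fun w => ?_)
        by_cases hw : ε / 4 < ‖f n w - c‖
        · rw [Set.indicator_of_mem (show w ∈ {w | ε / 4 < ‖f n w - c‖} from hw)]
          have := norm_sub_le (f n w) c
          linarith [hb n w]
        · rw [Set.indicator_of_notMem (show w ∉ {w | ε / 4 < ‖f n w - c‖} from hw)]
          linarith [not_lt.1 hw]
    _ = ε / 4 + P.real {w | ε / 4 < ‖f n w - c‖} * 2 := by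
        rw [integral_add (integrable_const _) hind, integral_indicator₀ hmeas]
        simp
    _ < ε := by linarith

variable {S : Type*} [MeasurableSpace S]

/-- An iid sequence with law `Q`. -/
structure IsIID (X : ℕ → Ω → S) (P : Measure Ω) (Q : Measure S) : Prop where
  measurable : ∀ i, Measurable (X i)
  indep : iIndepFun X P
  map_eq : ∀ i, P.map (X i) = Q

namespace IsIID

variable {X : ℕ → Ω → S} {Q : Measure S} [IsProbabilityMeasure P]

lemma isProbabilityMeasure (h : IsIID X P Q) : IsProbabilityMeasure Q := by
  rw [← h.map_eq 0]
  exact Measure.isProbabilityMeasure_map (h.measurable 0).aemeasurable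

lemma map_sample (h : IsIID X P Q) (n : ℕ) :
    P.map (fun w (i : Fin n) => X i w) = Measure.pi fun _ => Q := by
  have h1 := h.indep.precomp (g := fun i : Fin n => (i : ℕ)) Fin.val_injective
  have h2 := (iIndepFun_iff_map_fun_eq_pi_map
    (fun i : Fin n => (h.measurable i).aemeasurable)).1 h1
  simpa only [h.map_eq] using h2

omit [IsProbabilityMeasure P] in
lemma measurable_sample (h : IsIID X P Q) (n : ℕ) : Measurable fun w (i : Fin n) => X i w :=
  measurable_pi_lambda _ fun i => h.measurable i

open scoped Classical in
/-- Chebyshev's inequality for the number of visits to a set. -/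
lemma measure_card_sub_le (h : IsIID X P Q) (n : ℕ) {A : Set S} (hA : MeasurableSet A) {c : ℝ}
    (hc : 0 < c) :
    P {w | c ≤ |((Finset.univ.filter fun i : Fin n => X i w ∈ A).card : ℝ) - n * Q.real A|} ≤
      ENNReal.ofReal (n * Q.real A / c ^ 2) := by
  have hQ := h.isProbabilityMeasure
  set Y : ℕ → Ω → ℝ := fun i => (A.indicator fun _ => (1 : ℝ)) ∘ X i with hY
  have hYm : Measurable (A.indicator fun _ => (1 : ℝ)) := measurable_const.indicator hA
  have hYb (i : ℕ) : MemLp (Y i) 2 P := by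
    refine MemLp.of_bound (hYm.comp (h.measurable i)).aestronglyMeasurable 1
      (Eventually.of_forall fun w => ?_)
    simp only [hY, Function.comp_apply]
    by_cases hw : X i w ∈ A <;> simp [hw]
  have hmean (i : ℕ) : ∫ w, Y i w ∂P = Q.real A := by
    rw [← h.map_eq i, map_measureReal_apply (h.measurable i) hA]
    have : Y i = (X i ⁻¹' A).indicator fun _ => (1 : ℝ) := by
      ext w; simp [hY, Set.indicator_apply]
    rw [this, integral_indicator (h.measurable i hA)]
    simp
  have hvar (i : ℕ) : variance (Y i) P ≤ Q.real A := by
    refine (variance_le_expectation_sq (hYm.comp (h.measurable i)).aestronglyMeasurable).trans_eq ?_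
    rw [← hmean i]
    refine integral_congr_ae (Eventually.of_forall fun w => ?_)
    simp only [hY, Function.comp_apply, Pi.pow_apply]
    by_cases hw : X i w ∈ A <;> simp [hw]
  have hcard (w : Ω) : ((Finset.univ.filter fun i : Fin n => X i w ∈ A).card : ℝ) =
      (∑ i ∈ Finset.range n, Y i) w := by
    rw [Finset.card_filter, Finset.sum_apply, Finset.sum_range]
    push_cast
    refine Finset.sum_congr rfl fun i _ => ?_
    simp [hY, Set.indicator_apply]
  have hsum : ∫ w, (∑ i ∈ Finset.range n, Y i) w ∂P = n * Q.real A := by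
    simp_rw [Finset.sum_apply]
    rw [integral_finsetSum _ fun i _ => (hYb i).integrable (by norm_num)]
    simp [hmean]
  have hvs : variance (∑ i ∈ Finset.range n, Y i) P ≤ n * Q.real A := by
    rw [IndepFun.variance_sum (fun i _ => hYb i)]
    · calc _ ≤ ∑ i ∈ Finset.range n, Q.real A := Finset.sum_le_sum fun i _ => hvar i
        _ = _ := by simp
    · intro i _ j _ hij
      exact (h.indep.indepFun hij).comp hYm hYm
  have hcheb := meas_ge_le_variance_div_sq
    (memLp_finsetSum' (Finset.range n) fun i _ => hYb i) (μ := P) hc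
  rw [hsum] at hcheb
  simp_rw [hcard]
  refine hcheb.trans (ENNReal.ofReal_le_ofReal ?_)
  gcongr

lemma integral_sample_prod (h : IsIID X P Q) {r : S → ℝ} (hr : Measurable r) {n k : ℕ}
    (hk : k < n) {g : ℝ → S → ℂ} (hg : Measurable (Function.uncurry g)) (hb : ∀ t s, ‖g t s‖ ≤ 1) :
    ∫ w, ∏ i ∈ exceedances k fun i : Fin n => r (X i w),
        g (upperOrderStat k fun i : Fin n => r (X i w)) (X i w) ∂P =
      ∫ w, (∫ s, g (upperOrderStat k fun i : Fin n => r (X i w)) s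
          ∂(ProbabilityTheory.cond Q {s | (upperOrderStat k fun i : Fin n => r (X i w)) < r s})) ^
        (exceedances k fun i : Fin n => r (X i w)).card ∂P := by
  have hQ := h.isProbabilityMeasure
  have key := integral_prod_exceedances Q hr hk hg hb
  rw [← h.map_sample n, integral_map (h.measurable_sample n).aemeasurable
    (measurable_prod_exceedances hr k hg).aestronglyMeasurable,
    integral_map (h.measurable_sample n).aemeasurable] at key
  · exact key
  · refine Measurable.aestronglyMeasurable ?_
    have h1 : Measurable fun x : Fin n → S =>
        ∏ i ∈ exceedances k fun i => r (x i), (fun t _ => ∫ s, g t s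
          ∂(ProbabilityTheory.cond Q {s | t < r s})) (upperOrderStat k fun i => r (x i)) (x i) :=
      measurable_prod_exceedances hr k (g := fun t _ => ∫ s, g t s
        ∂(ProbabilityTheory.cond Q {s | t < r s}))
        ((measurable_integral_cond Q hr hg).comp measurable_fst)
    simpa using h1

end IsIID

end Sample

end ExtremePCA

namespace ExtremePCA

/-! ### The random threshold, the number of exceedances and the scalar central limit theorem. -/

section RegularlyVaryingSample

variable {d : ℕ} {Q μ : Measure (EuclideanSpace ℝ (Fin d))}
  {Ω : Type*} [MeasurableSpace Ω] {P : Measure Ω} [IsProbabilityMeasure P]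
  {X : ℕ → Ω → EuclideanSpace ℝ (Fin d)} {k : ℕ → ℕ}

/-- The random threshold: the `(k+1)`-th largest norm in the sample of size `n`. -/
noncomputable def threshold (X : ℕ → Ω → EuclideanSpace ℝ (Fin d)) (n k : ℕ) (w : Ω) : ℝ :=
  upperOrderStat k fun i : Fin n => ‖X i w‖

/-- The indices of the observations that exceed the random threshold. -/
noncomputable def extremes (X : ℕ → Ω → EuclideanSpace ℝ (Fin d)) (n k : ℕ) (w : Ω) :
    Finset (Fin n) :=
  exceedances k fun i : Fin n => ‖X i w‖

omit [IsProbabilityMeasure P] in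
lemma IsIID.measurable_threshold (hX : IsIID X P Q) (n k : ℕ) : Measurable (threshold X n k) :=
  (measurable_upperOrderStat measurable_norm k).comp (hX.measurable_sample n)

omit [IsProbabilityMeasure P] in
lemma IsIID.measurable_card_extremes (hX : IsIID X P Q) (n k : ℕ) :
    Measurable fun w => (extremes X n k w).card := by
  classical
  have h := measurable_card_filter (Finset.univ : Finset (Fin n))
    (fun (x : Fin n → EuclideanSpace ℝ (Fin d)) i => i ∈ exceedances k fun i => ‖x i‖)
    (fun i => measurableSet_mem_exceedances measurable_norm k i)
  simp only [Finset.filter_univ_mem] at h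
  exact h.comp (hX.measurable_sample n)

open scoped Classical in
-- Chebyshev's inequality: the variance is at most the expected count, which is of order k, so the
-- probability is of order 1/k.
lemma IsRegularlyVarying.tendsto_measure_card_sub (h : IsRegularlyVarying Q μ) (hX : IsIID X P Q)
    (hk : Tendsto k atTop atTop) (hkn : Tendsto (fun n => (k n : ℝ) / n) atTop (𝓝 0))
    {s η : ℝ} (hs : 0 < s) (hη : 0 < η) :
    Tendsto (fun n : ℕ => P {w | η * k n ≤ |((Finset.univ.filter fun i : Fin n =>
        s * radiusQuantile Q n (k n) < ‖X i w‖).card : ℝ) -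
      n * Q.real {x | s * radiusQuantile Q n (k n) < ‖x‖}|}) atTop (𝓝 0) := by
  have hQ := hX.isProbabilityMeasure
  have h1 := h.tendsto_tail_radiusQuantile hk hkn hs
  have h2 : Tendsto (fun n => (η ^ 2 * (k n : ℝ))⁻¹) atTop (𝓝 0) :=
    tendsto_inv_atTop_zero.comp ((tendsto_natCast_atTop_atTop.comp hk).const_mul_atTop
      (by positivity))
  have h3 := ENNReal.tendsto_ofReal (h1.mul h2)
  rw [mul_zero, ENNReal.ofReal_zero] at h3
  refine tendsto_of_tendsto_of_tendsto_of_le_of_le' tendsto_const_nhds h3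
    (Eventually.of_forall fun _ => zero_le) ?_
  filter_upwards [hk.eventually_gt_atTop 0] with n hn
  have hk0 : (0 : ℝ) < k n := by exact_mod_cast hn
  refine (hX.measure_card_sub_le n
    (measurableSet_lt_norm (s * radiusQuantile Q n (k n))) (c := η * k n) (by positivity)).trans ?_
  refine ENNReal.ofReal_le_ofReal (le_of_eq ?_)
  field_simp

variable [IsProbabilityMeasure Q]

/-- The event says that at most k observations exceed s t_{n,k}, while their expected number is
about k times the tail of `μ` at s, which is greater than 1. The opposite bound for s > 1 is dual.
-/
lemma IsRegularlyVarying.tendsto_measure_threshold_le (h : IsRegularlyVarying Q μ)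
    (hX : IsIID X P Q) (hk : Tendsto k atTop atTop)
    (hkn : Tendsto (fun n => (k n : ℝ) / n) atTop (𝓝 0)) {s : ℝ} (hs : 0 < s) (hs1 : s < 1) :
    Tendsto (fun n => P {w | threshold X n (k n) w ≤ s * radiusQuantile Q n (k n)}) atTop
      (𝓝 0) := by
  classical
  have hf := h.one_lt_tail hs hs1
  set η := (μ.real {x | s < ‖x‖} - 1) / 2 with hη
  have hη0 : 0 < η := by rw [hη]; linarith
  have h0 := h.tendsto_measure_card_sub hX hk hkn hs hη0
  refine tendsto_measure_zero_of_subset h0 h0 ?_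
  filter_upwards [(h.tendsto_tail_radiusQuantile hk hkn hs).eventually_const_lt
    (show 1 + η < μ.real {x | s < ‖x‖} by rw [hη]; linarith), eventually_lt_of_tendsto_div hkn,
    hk.eventually_gt_atTop 0] with n hn1 hn2 hn3 w hw
  left
  have hk0 : (0 : ℝ) < k n := by exact_mod_cast hn3
  rw [lt_div_iff₀ hk0] at hn1
  have hw' : ¬ s * radiusQuantile Q n (k n) < threshold X n (k n) w := not_lt.2 hw
  rw [threshold, lt_upperOrderStat_iff hn2, not_lt] at hw'
  have hw2 : ((Finset.univ.filter fun i : Fin n =>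
    s * radiusQuantile Q n (k n) < ‖X i w‖).card : ℝ) ≤ k n := by exact_mod_cast hw'
  rw [abs_sub_comm]
  refine le_trans ?_ (le_abs_self _)
  linarith

lemma IsRegularlyVarying.tendsto_measure_lt_threshold (h : IsRegularlyVarying Q μ)
    (hX : IsIID X P Q) (hk : Tendsto k atTop atTop)
    (hkn : Tendsto (fun n => (k n : ℝ) / n) atTop (𝓝 0)) {s : ℝ} (hs1 : 1 < s) :
    Tendsto (fun n => P {w | s * radiusQuantile Q n (k n) < threshold X n (k n) w}) atTop
      (𝓝 0) := by
  classical
  have hs : 0 < s := by linarith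
  have hf := h.tail_lt_one hs1
  set η := (1 - μ.real {x | s < ‖x‖}) / 2 with hη
  have hη0 : 0 < η := by rw [hη]; linarith
  have h0 := h.tendsto_measure_card_sub hX hk hkn hs hη0
  refine tendsto_measure_zero_of_subset h0 h0 ?_
  filter_upwards [(h.tendsto_tail_radiusQuantile hk hkn hs).eventually_lt_const
    (show μ.real {x | s < ‖x‖} < 1 - η by rw [hη]; linarith), eventually_lt_of_tendsto_div hkn,
    hk.eventually_gt_atTop 0] with n hn1 hn2 hn3 w hw
  left
  have hk0 : (0 : ℝ) < k n := by exact_mod_cast hn3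
  rw [div_lt_iff₀ hk0] at hn1
  rw [threshold, lt_upperOrderStat_iff hn2] at hw
  have hw2 : (k n : ℝ) ≤ ((Finset.univ.filter fun i : Fin n =>
    s * radiusQuantile Q n (k n) < ‖X i w‖).card : ℝ) := by exact_mod_cast hw.le
  refine le_trans ?_ (le_abs_self _)
  linarith

/-- Ties at the threshold may leave fewer than k exceedances. With high probability, however, the
threshold is at most s t_{n,k} for s slightly above 1, and nearly k observations exceed that level.
-/
lemma IsRegularlyVarying.tendsto_measure_card_extremes_lt (h : IsRegularlyVarying Q μ)
    (hX : IsIID X P Q) (hk : Tendsto k atTop atTop)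
    (hkn : Tendsto (fun n => (k n : ℝ) / n) atTop (𝓝 0)) {δ : ℝ} (hδ : 0 < δ) :
    Tendsto (fun n => P {w | ((extremes X n (k n) w).card : ℝ) < (1 - δ) * k n}) atTop
      (𝓝 0) := by
  classical
  have hev : ∀ᶠ s in 𝓝[>] (1 : ℝ), 1 - δ / 2 < μ.real {x | s < ‖x‖} := by
    refine ((h.continuousAt_tail one_pos).mono_left nhdsWithin_le_nhds).eventually_const_lt ?_
    simp only [h.tail_one]
    linarith
  obtain ⟨s, hs2, hs1⟩ := (hev.and self_mem_nhdsWithin).exists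
  have hs1' : 1 < s := hs1
  have hs : 0 < s := by linarith
  refine tendsto_measure_zero_of_subset (h.tendsto_measure_card_sub hX hk hkn hs (half_pos hδ))
    (h.tendsto_measure_lt_threshold hX hk hkn hs1') ?_
  filter_upwards [(h.tendsto_tail_radiusQuantile hk hkn hs).eventually_const_lt hs2,
    hk.eventually_gt_atTop 0] with n hn1 hn3 w hw
  by_cases ht : s * radiusQuantile Q n (k n) < threshold X n (k n) w
  · exact Or.inr ht
  left
  have hk0 : (0 : ℝ) < k n := by exact_mod_cast hn3
  rw [lt_div_iff₀ hk0] at hn1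
  have hsub : (Finset.univ.filter fun i : Fin n => s * radiusQuantile Q n (k n) < ‖X i w‖) ⊆
      extremes X n (k n) w := by
    intro i hi
    rw [extremes, mem_exceedances]
    exact (not_lt.1 ht).trans_lt (Finset.mem_filter.1 hi).2
  have hcard : ((Finset.univ.filter fun i : Fin n =>
      s * radiusQuantile Q n (k n) < ‖X i w‖).card : ℝ) ≤ (extremes X n (k n) w).card := by
    exact_mod_cast Finset.card_le_card hsub
  have hw' : ((extremes X n (k n) w).card : ℝ) < (1 - δ) * k n := hw
  rw [abs_sub_comm]
  refine le_trans ?_ (le_abs_self _)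
  linarith

variable {y : EuclideanSpace ℝ (Fin d) → ℝ}

lemma IsRegularlyVarying.tendsto_integral_cond_sq (h : IsRegularlyVarying Q μ)
    (hym : Measurable y) (hhom : ∀ c : ℝ, 0 < c → ∀ x, x ≠ 0 → y (c • x) = y x)
    (hcont : ∀ᵐ x ∂μ, ContinuousAt y x) {C : ℝ} (hQ : ∀ᵐ x ∂Q, |y x| ≤ C)
    (hμ : ∀ᵐ x ∂μ, |y x| ≤ C) :
    Tendsto (fun t => variance y (ProbabilityTheory.cond Q {x | t < ‖x‖})) atTop
      (𝓝 (variance y (limitModel μ))) := by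
  have hlP := h.isProbabilityMeasure_limitModel
  have hcP (t : ℝ) : IsProbabilityMeasure (ProbabilityTheory.cond Q {x | t < ‖x‖}) :=
    cond_isProbabilityMeasure (h.measure_lt_norm_ne_zero t)
  have hvar (ρ : Measure (EuclideanSpace ℝ (Fin d))) [IsProbabilityMeasure ρ]
      (hρ : ∀ᵐ x ∂ρ, |y x| ≤ C) :
      variance y ρ = ∫ x, y x ^ 2 ∂ρ - (∫ x, y x ∂ρ) ^ 2 :=
    variance_eq_sub (MemLp.of_bound hym.aestronglyMeasurable C hρ)
  rw [hvar (limitModel μ) (ae_restrict_of_ae hμ)]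
  have h1 := h.tendsto_integral_cond hym hhom hcont hQ hμ
  have h2 : Tendsto (fun t => ∫ x, y x ^ 2 ∂(ProbabilityTheory.cond Q {x | t < ‖x‖})) atTop
      (𝓝 (∫ x, y x ^ 2 ∂(limitModel μ))) := by
    refine h.tendsto_integral_cond (M := C ^ 2) (hym.pow_const 2) ?_ ?_ ?_ ?_
    · intro c hc x hx
      rw [hhom c hc x hx]
    · filter_upwards [hcont] with x hx using hx.pow 2
    · filter_upwards [hQ] with x hx
      rw [abs_pow]; gcongr
    · filter_upwards [hμ] with x hx
      rw [abs_pow]; gcongr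
  refine (h2.sub (h1.pow 2)).congr fun t => (hvar _ ?_).symm
  exact ProbabilityTheory.cond_absolutelyContinuous.ae_le hQ

open Complex in
/-- Convergence of the characteristic function of the sum of the exceedances, centered at the
conditional mean given the random threshold. -/
theorem IsRegularlyVarying.tendsto_integral_cexp_sum (h : IsRegularlyVarying Q μ)
    (hX : IsIID X P Q) (hk : Tendsto k atTop atTop)
    (hkn : Tendsto (fun n => (k n : ℝ) / n) atTop (𝓝 0))
    (hym : Measurable y) (hhom : ∀ c : ℝ, 0 < c → ∀ x, x ≠ 0 → y (c • x) = y x)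
    (hcont : ∀ᵐ x ∂μ, ContinuousAt y x) {C : ℝ} (hQ : ∀ᵐ x ∂Q, |y x| ≤ C)
    (hμ : ∀ᵐ x ∂μ, |y x| ≤ C) :
    Tendsto (fun n => ∫ w, cexp ((((√(k n : ℝ))⁻¹ * ∑ i ∈ extremes X n (k n) w,
        (∫ x, y x ∂(ProbabilityTheory.cond Q {x | threshold X n (k n) w < ‖x‖}) - y (X i w)) : ℝ) :
          ℂ) * I) ∂P) atTop (𝓝 (cexp (-(variance y (limitModel μ) : ℝ) / 2))) := by
  have hcP (t : ℝ) : IsProbabilityMeasure (ProbabilityTheory.cond Q {x | t < ‖x‖}) :=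
    cond_isProbabilityMeasure (h.measure_lt_norm_ne_zero t)
  have hQc (t : ℝ) : ∀ᵐ x ∂(ProbabilityTheory.cond Q {x | t < ‖x‖}), |y x| ≤ C :=
    ProbabilityTheory.cond_absolutelyContinuous.ae_le hQ
  have hC0 : 0 ≤ C := by
    obtain ⟨x, hx⟩ := hQ.exists
    exact (abs_nonneg _).trans hx
  set v := variance y (limitModel μ) with hv
  have hv0 : 0 ≤ v := variance_nonneg _ _
  set m : ℝ → ℝ := fun t => ∫ x, y x ∂(ProbabilityTheory.cond Q {x | t < ‖x‖}) with hm
  have hmm : Measurable m :=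
    measurable_integral_cond Q measurable_norm (g := fun _ x => y x) (hym.comp measurable_snd)
  have hmb (t : ℝ) : |m t| ≤ C := by
    have := norm_integral_le_of_norm_le_const (f := y) (C := C) (by simpa using hQc t)
    simpa [hm] using this
  set g : ℕ → ℝ → EuclideanSpace ℝ (Fin d) → ℂ := fun n t x =>
    cexp ((((√(k n : ℝ))⁻¹ * (m t - y x) : ℝ) : ℂ) * I) with hg
  have hgm (n : ℕ) : Measurable (Function.uncurry (g n)) := by
    have h1 : Measurable fun p : ℝ × EuclideanSpace ℝ (Fin d) =>
        (√(k n : ℝ))⁻¹ * (m p.1 - y p.2) :=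
      ((hmm.comp measurable_fst).sub (hym.comp measurable_snd)).const_mul _
    exact ((measurable_ofReal.comp h1).mul_const I).cexp
  have hgb (n : ℕ) (t : ℝ) (x) : ‖g n t x‖ ≤ 1 := by
    rw [hg, norm_exp_ofReal_mul_I]
  set φ : ℕ → ℝ → ℂ := fun n t => ∫ x, g n t x ∂(ProbabilityTheory.cond Q {x | t < ‖x‖}) with hφ
  have hφb (n : ℕ) (t : ℝ) : ‖φ n t‖ ≤ 1 := by
    simpa [hφ] using norm_integral_le_of_norm_le_const
      (μ := ProbabilityTheory.cond Q {x | t < ‖x‖}) (Eventually.of_forall (hgb n t))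
  have hφm (n : ℕ) : Measurable (φ n) := measurable_integral_cond Q measurable_norm (hgm n)
  -- Conditioning turns the characteristic function into the mean of this bounded power, so
  -- convergence in probability of the power suffices.
  have hlim : Tendsto (fun n => ∫ w, φ n (threshold X n (k n) w) ^
      (extremes X n (k n) w).card ∂P) atTop (𝓝 (cexp (-(v : ℝ) / 2))) := by
    refine tendsto_integral_of_tendstoInMeasure_const ?_ ?_ ?_ ?_
    · intro n
      refine Measurable.aestronglyMeasurable ?_
      exact ((hφm n).comp (hX.measurable_threshold n (k n))).pow
        (hX.measurable_card_extremes n (k n))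
    · intro n w
      rw [norm_pow]
      exact pow_le_one₀ (norm_nonneg _) (hφb _ _)
    · have : -(v : ℂ) / 2 = ((-v / 2 : ℝ) : ℂ) := by push_cast; ring
      rw [this, norm_exp_ofReal]
      exact Real.exp_le_one_iff.2 (by linarith)
    · intro ε hε
      -- Makes the contribution v δ / 2 of the missing exceedances at most ε/8.
      set δ := ε / (4 * (v + 1)) with hδ
      have hδ0 : 0 < δ := by positivity
      refine tendsto_measure_zero_of_subset
        (h.tendsto_measure_threshold_le hX hk hkn one_half_pos one_half_lt_one)
        (h.tendsto_measure_card_extremes_lt hX hk hkn hδ0) ?_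
      have hσ := h.tendsto_integral_cond_sq hym hhom hcont hQ hμ
      have hσ' : ∀ᶠ t in atTop,
          |variance y (ProbabilityTheory.cond Q {x | t < ‖x‖}) - v| < ε / 4 := by
        have := (Metric.tendsto_nhds.1 hσ) (ε / 4) (by positivity)
        simpa [Real.dist_eq] using this
      obtain ⟨T, hT⟩ := eventually_atTop.1 hσ'
      have hkr : Tendsto (fun n => (k n : ℝ)) atTop atTop := tendsto_natCast_atTop_atTop.comp hk
      have hsq : Tendsto (fun n => √(k n : ℝ)) atTop atTop := Real.tendsto_sqrt_atTop.comp hkr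
      have hl1 : Tendsto (fun n => 8 * C ^ 3 / √(k n : ℝ)) atTop (𝓝 0) :=
        hsq.const_div_atTop _
      have hl2 : Tendsto (fun n => v ^ 2 / (4 * (k n : ℝ))) atTop (𝓝 0) :=
        (hkr.const_mul_atTop (by norm_num)).const_div_atTop _
      -- Error budget: ε/4 for the cubic remainder (summands are bounded by 2C/√k), ε/8 for the
      -- variance, ε/4 for the exponential and ε/8 for the missing exceedances. On the good event
      -- the threshold exceeds t_{n,k}/2 ≥ T.
      filter_upwards [hl1.eventually_lt_const (show (0 : ℝ) < ε / 4 by positivity),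
        hl2.eventually_lt_const (show (0 : ℝ) < ε / 4 by positivity), hk.eventually_gt_atTop 0,
        eventually_lt_of_tendsto_div hkn, hkr.eventually_ge_atTop (v / 2),
        hsq.eventually_ge_atTop (2 * C),
        (h.tendsto_radiusQuantile hk hkn).eventually_ge_atTop (2 * T)]
        with n hn1 hn2 hn3 hn4 hn5 hn6 hn7 w hw
      by_contra hcon
      push Not at hcon
      obtain ⟨hg1, hg2⟩ := hcon
      set t := threshold X n (k n) w with ht
      set N := (extremes X n (k n) w).card with hN
      have hNk : N ≤ k n := card_exceedances_le hn4 _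
      have hTt : T ≤ t := by linarith
      have hk0 : (0 : ℝ) < k n := by exact_mod_cast hn3
      have hsk : 0 < √(k n : ℝ) := Real.sqrt_pos.2 hk0
      have hσt := hT t hTt
      set σ := variance y (ProbabilityTheory.cond Q {x | t < ‖x‖}) with hσdef
      have hyi : Integrable y (ProbabilityTheory.cond Q {x | t < ‖x‖}) :=
        Integrable.of_bound hym.aestronglyMeasurable C (hQc t)
      have hz0 : ∫ x, (√(k n : ℝ))⁻¹ * (m t - y x)
          ∂(ProbabilityTheory.cond Q {x | t < ‖x‖}) = 0 := by
        rw [integral_const_mul, integral_sub (integrable_const _) hyi]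
        simp [hm]
      have hz2 : ∫ x, ((√(k n : ℝ))⁻¹ * (m t - y x)) ^ 2
          ∂(ProbabilityTheory.cond Q {x | t < ‖x‖}) = σ / k n := by
        simp_rw [mul_pow]
        rw [integral_const_mul, inv_pow, Real.sq_sqrt hk0.le, hσdef,
          variance_eq_integral hym.aemeasurable, inv_mul_eq_div]
        congr 1
        refine integral_congr_ae (Eventually.of_forall fun x => ?_)
        simp only [hm]
        ring
      have hzb : ∀ᵐ x ∂(ProbabilityTheory.cond Q {x | t < ‖x‖}),
          |(√(k n : ℝ))⁻¹ * (m t - y x)| ≤ 2 * C / √(k n : ℝ) := by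
        filter_upwards [hQc t] with x hx
        rw [abs_mul, abs_inv, abs_of_pos hsk, inv_mul_eq_div]
        gcongr
        refine (abs_sub _ _).trans ?_
        linarith [hmb t]
      have hcf := norm_integral_cexp_sub_le (ProbabilityTheory.cond Q {x | t < ‖x‖})
        (z := fun x => (√(k n : ℝ))⁻¹ * (m t - y x))
        ((measurable_const.sub hym).const_mul _).aemeasurable
        ((div_le_one hsk).2 hn6) hzb hz0
      rw [hz2] at hcf
      have hfin := norm_pow_sub_cexp_le (hφb n t) hn3 hNk (σ := σ) hv0 hn5
      have hA : (k n : ℝ) * ‖φ n t - (1 - ((σ / k n : ℝ) : ℂ) / 2)‖ ≤ 8 * C ^ 3 / √(k n : ℝ) := by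
        calc _ ≤ (k n : ℝ) * (2 * C / √(k n : ℝ)) ^ 3 := by gcongr
          _ = 8 * C ^ 3 / √(k n : ℝ) := by
            rw [div_pow, pow_succ (√(k n : ℝ)), Real.sq_sqrt hk0.le]
            field_simp
            ring
      have hB : v / 2 * (1 - N / k n) ≤ ε / 8 := by
        have h1 : 1 - (N : ℝ) / k n ≤ δ := by
          rw [sub_le_comm, le_div_iff₀ hk0]
          exact hg2
        calc _ ≤ v / 2 * δ := by gcongr
          _ ≤ ε / 8 := by
            rw [hδ, mul_div_assoc', div_le_iff₀ (by positivity)]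
            nlinarith
      have hw' : ε < ‖φ n t ^ N - cexp (-(v : ℝ) / 2)‖ := hw
      linarith
  refine hlim.congr' ?_
  filter_upwards [eventually_lt_of_tendsto_div hkn] with n hn
  have key := hX.integral_sample_prod measurable_norm hn (hgm n) (hgb n)
  refine key.symm.trans ?_
  refine integral_congr_ae (Eventually.of_forall fun w => ?_)
  simp only [hg]
  rw [← Complex.exp_sum, ← Finset.sum_mul]
  congr 2
  rw [Finset.mul_sum]
  push_cast
  rfl

end RegularlyVaryingSample

end ExtremePCA

namespace ExtremePCA

/-! ### Covariance matrices as quadratic forms. -/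

section CovarianceMatrix

variable {S ι : Type*} [MeasurableSpace S] [Fintype ι]
  {ρ : Measure S} [IsProbabilityMeasure ρ] {V : S → EuclideanSpace ℝ ι}

/-- The covariance matrix of the random vector `V`. -/
noncomputable def covarianceMatrix (V : S → EuclideanSpace ℝ ι) (ρ : Measure S) : Matrix ι ι ℝ :=
  Matrix.of fun i j => covariance (fun x => V x i) (fun x => V x j) ρ

lemma dotProduct_covarianceMatrix_mulVec (hV : ∀ i, MemLp (fun x => V x i) 2 ρ)
    (ξ : EuclideanSpace ℝ ι) :
    ξ.ofLp ⬝ᵥ (covarianceMatrix V ρ).mulVec ξ.ofLp = variance (fun x => inner ℝ (V x) ξ) ρ := by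
  have hf : (fun x => inner ℝ (V x) ξ) = fun x => ∑ i, ξ i * V x i := by
    funext x
    simp [PiLp.inner_apply]
  rw [hf, ← covariance_self
    (Finset.aemeasurable_fun_sum _ fun i _ => (hV i).aestronglyMeasurable.aemeasurable.const_mul _),
    covariance_fun_sum_fun_sum (fun i => (hV i).const_mul _) (fun i => (hV i).const_mul _)]
  simp only [covariance_const_mul_left, covariance_const_mul_right, dotProduct, Matrix.mulVec,
    covarianceMatrix, Matrix.of_apply, Finset.mul_sum]
  exact Finset.sum_congr rfl fun i _ => Finset.sum_congr rfl fun j _ => by ring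

lemma posSemidef_covarianceMatrix (hV : ∀ i, MemLp (fun x => V x i) 2 ρ) :
    (covarianceMatrix V ρ).PosSemidef := by
  refine Matrix.PosSemidef.of_dotProduct_mulVec_nonneg ?_ fun x => ?_
  · ext i j
    simp [covarianceMatrix, covariance_comm]
  · have h := dotProduct_covarianceMatrix_mulVec hV (WithLp.toLp 2 x)
    simp only [star_trivial]
    simp only at h
    rw [h]
    exact variance_nonneg _ _

end CovarianceMatrix

/-! ### Vectorized second moments and the Gaussian limit. -/

section MomentVector

variable {d : ℕ} {Q μ : Measure (EuclideanSpace ℝ (Fin d))}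
  {ω : EuclideanSpace ℝ (Fin d) → ℝ}

/-- The products of the coordinates of `θ = ω(x) x`, as a Euclidean vector. -/
noncomputable def momentVec (ω : EuclideanSpace ℝ (Fin d) → ℝ) (x : EuclideanSpace ℝ (Fin d)) :
    EuclideanSpace ℝ (Fin d × Fin d) :=
  WithLp.toLp 2 fun p => angle ω x p.1 * angle ω x p.2

lemma momentVec_apply (ω : EuclideanSpace ℝ (Fin d) → ℝ) (x : EuclideanSpace ℝ (Fin d))
    (p : Fin d × Fin d) : momentVec ω x p = angle ω x p.1 * angle ω x p.2 := rfl

lemma norm_momentVec (ω : EuclideanSpace ℝ (Fin d) → ℝ) (x : EuclideanSpace ℝ (Fin d)) :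
    ‖momentVec ω x‖ = ‖angle ω x‖ ^ 2 := by
  refine (sq_eq_sq₀ (norm_nonneg _) (by positivity)).1 ?_
  rw [EuclideanSpace.real_norm_sq_eq, EuclideanSpace.real_norm_sq_eq, sq (∑ i, _),
    Finset.sum_mul_sum, Fintype.sum_prod_type]
  exact Finset.sum_congr rfl fun i _ => Finset.sum_congr rfl fun j _ => by
    rw [momentVec_apply]; ring

lemma continuous_momentVec_of_angle :
    Continuous fun y : EuclideanSpace ℝ (Fin d) =>
      (WithLp.toLp 2 fun p : Fin d × Fin d => y p.1 * y p.2 : EuclideanSpace ℝ (Fin d × Fin d)) := by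
  fun_prop

lemma IsScaling.measurable_angle (hω : IsScaling Q μ ω) : Measurable (angle ω) :=
  hω.measurable.smul measurable_id

lemma IsScaling.measurable_momentVec (hω : IsScaling Q μ ω) : Measurable (momentVec ω) :=
  continuous_momentVec_of_angle.measurable.comp hω.measurable_angle

lemma IsScaling.momentVec_smul (hω : IsScaling Q μ ω) {c : ℝ} (hc : 0 < c)
    {x : EuclideanSpace ℝ (Fin d)} (hx : x ≠ 0) : momentVec ω (c • x) = momentVec ω x := by
  simp only [momentVec, hω.angle_smul hc hx]

lemma IsScaling.ae_continuousAt_momentVec (hω : IsScaling Q μ ω) :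
    ∀ᵐ x ∂μ, ContinuousAt (momentVec ω) x := by
  filter_upwards [hω.ae_continuousAt] with x hx
  exact continuous_momentVec_of_angle.continuousAt.comp (hx.smul continuousAt_id)

lemma IsRegularlyVarying.exists_norm_momentVec_le [IsProbabilityMeasure Q]
    (h : IsRegularlyVarying Q μ) (hω : IsScaling Q μ ω) :
    ∃ C : ℝ, 0 ≤ C ∧ (∀ᵐ x ∂Q, ‖momentVec ω x‖ ≤ C) ∧ ∀ᵐ x ∂μ, ‖momentVec ω x‖ ≤ C := by
  obtain ⟨C, hC⟩ := hω.bounded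
  refine ⟨C ^ 2, sq_nonneg C, ?_, ?_⟩
  · filter_upwards [hC] with x hx
    rw [norm_momentVec]
    exact pow_le_pow_left₀ (norm_nonneg _) hx 2
  · filter_upwards [h.norm_angle_le hω hC] with x hx
    rw [norm_momentVec]
    exact pow_le_pow_left₀ (norm_nonneg _) hx 2

lemma IsRegularlyVarying.memLp_momentVec_apply [IsProbabilityMeasure Q]
    (h : IsRegularlyVarying Q μ) (hω : IsScaling Q μ ω) (p : Fin d × Fin d) :
    MemLp (fun x => momentVec ω x p) 2 (limitModel μ) := by
  have hP := h.isProbabilityMeasure_limitModel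
  obtain ⟨C, -, -, hμ⟩ := h.exists_norm_momentVec_le hω
  have hm : Measurable fun x => momentVec ω x p :=
    (EuclideanSpace.proj (𝕜 := ℝ) p).measurable.comp hω.measurable_momentVec
  have hb : ∀ᵐ x ∂(limitModel μ), ‖momentVec ω x p‖ ≤ C :=
    ae_restrict_of_ae (hμ.mono fun x hx => (PiLp.norm_apply_le (momentVec ω x) p).trans hx)
  exact MemLp.of_bound hm.aestronglyMeasurable C hb

/-- The centered Gaussian law with the covariances of `θ_i θ_j` in the limit model. -/
noncomputable def limitGaussian (ω : EuclideanSpace ℝ (Fin d) → ℝ)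
    (μ : Measure (EuclideanSpace ℝ (Fin d))) : Measure (EuclideanSpace ℝ (Fin d × Fin d)) :=
  multivariateGaussian 0 (covarianceMatrix (momentVec ω) (limitModel μ))

instance (ω : EuclideanSpace ℝ (Fin d) → ℝ) (μ : Measure (EuclideanSpace ℝ (Fin d))) :
    IsGaussian (limitGaussian ω μ) := by
  unfold limitGaussian
  infer_instance

/-- A vector of `d ^ 2` coordinates as a matrix. -/
noncomputable def vecToMatrix (d : ℕ) :
    EuclideanSpace ℝ (Fin d × Fin d) →L[ℝ] Matrix (Fin d) (Fin d) ℝ where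
  toFun u := Matrix.of fun i j => u (i, j)
  map_add' _ _ := rfl
  map_smul' _ _ := rfl
  cont := by
    refine continuous_matrix fun i j => ?_
    simp only [Matrix.of_apply]
    fun_prop

@[simp]
lemma vecToMatrix_apply (u : EuclideanSpace ℝ (Fin d × Fin d)) (i j : Fin d) :
    vecToMatrix d u i j = u (i, j) := rfl

lemma momentMatrix_eq_vecToMatrix {ρ : Measure (EuclideanSpace ℝ (Fin d))}
    (hρ : Integrable (momentVec ω) ρ) :
    momentMatrix ω ρ = vecToMatrix d (∫ x, momentVec ω x ∂ρ) := by
  ext i j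
  have := (EuclideanSpace.proj (𝕜 := ℝ) (i, j)).integral_comp_comm hρ
  rw [vecToMatrix_apply]
  exact this

lemma measurable_vecToMatrix : Measurable (vecToMatrix d) := (vecToMatrix d).continuous.measurable

lemma IsRegularlyVarying.covariance_limitGaussian [IsProbabilityMeasure Q]
    (h : IsRegularlyVarying Q μ) (hω : IsScaling Q μ ω) (p q : Fin d × Fin d) :
    covariance (fun u => u p) (fun u => u q) (limitGaussian ω μ) =
      covariance (fun x => angle ω x p.1 * angle ω x p.2)
        (fun x => angle ω x q.1 * angle ω x q.2) (limitModel μ) := by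
  have hP := h.isProbabilityMeasure_limitModel
  exact covariance_eval_multivariateGaussian
    (posSemidef_covarianceMatrix (h.memLp_momentVec_apply hω)) p q

lemma IsRegularlyVarying.hasLimitMoments [IsProbabilityMeasure Q]
    (h : IsRegularlyVarying Q μ) (hω : IsScaling Q μ ω) :
    HasLimitMoments ω μ ((limitGaussian ω μ).map (vecToMatrix d)) := by
  have hL (p : Fin d × Fin d) : MemLp (fun u : EuclideanSpace ℝ (Fin d × Fin d) => u p) 2
      (limitGaussian ω μ) :=
    IsGaussian.memLp_dual (limitGaussian ω μ) (EuclideanSpace.proj (𝕜 := ℝ) p) 2 (by simp)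
  have hm (i j : Fin d) : Measurable fun U : Matrix (Fin d) (Fin d) ℝ => U i j :=
    (continuous_id.matrix_elem i j).measurable
  have hc (p : Fin d × Fin d) : ∫ u, u p ∂(limitGaussian ω μ) = 0 := by
    have h1 := (EuclideanSpace.proj (𝕜 := ℝ) p).integral_comp_comm
      (IsGaussian.integrable_id (μ := limitGaussian ω μ))
    have h2 : ∫ u, u ∂(limitGaussian ω μ) = 0 := integral_id_multivariateGaussian
    simp only [id, h2, map_zero] at h1
    exact h1
  constructor
  · rw [ae_map_iff measurable_vecToMatrix.aemeasurable]
    -- The Gaussian law on all d² coordinates is degenerate: θ_i θ_j = θ_j θ_i forces this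
    -- difference to have variance 0, and it is centered.
    · have hij : ∀ i j : Fin d, ∀ᵐ u ∂(limitGaussian ω μ), u (i, j) - u (j, i) = 0 := by
        intro i j
        have hv : variance (fun u : EuclideanSpace ℝ (Fin d × Fin d) => u (i, j) - u (j, i))
            (limitGaussian ω μ) = 0 := by
          rw [← covariance_self (X := fun u : EuclideanSpace ℝ (Fin d × Fin d) =>
              u (i, j) - u (j, i)) ((hL _).sub (hL _)).aestronglyMeasurable.aemeasurable,
            covariance_fun_sub_fun_sub (hL _) (hL _) (hL _) (hL _)]
          simp only [h.covariance_limitGaussian hω, mul_comm (angle ω _ j)]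
          ring
        filter_upwards [ae_eq_integral_of_variance_eq_zero ((hL (i, j)).sub (hL (j, i))) hv]
          with u hu
        rw [integral_sub' ((hL _).integrable one_le_two) ((hL _).integrable one_le_two), hc, hc,
          sub_zero] at hu
        exact hu
      have hall : ∀ᵐ u ∂(limitGaussian ω μ), ∀ i j : Fin d, u (i, j) - u (j, i) = 0 :=
        ae_all_iff.2 fun i => ae_all_iff.2 fun j => hij i j
      filter_upwards [hall] with u hu
      ext i j
      simpa [sub_eq_zero] using hu j i
    · have : {U : Matrix (Fin d) (Fin d) ℝ | U.IsSymm} =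
          ⋂ i, ⋂ j, {U : Matrix (Fin d) (Fin d) ℝ | U j i = U i j} := by
        ext U
        simp [Matrix.IsSymm.ext_iff]
      rw [this]
      exact MeasurableSet.iInter fun i => MeasurableSet.iInter fun j =>
        measurableSet_eq_fun (hm j i) (hm i j)
  · intro i j
    rw [integral_map measurable_vecToMatrix.aemeasurable (hm i j).aestronglyMeasurable]
    exact hc (i, j)
  · intro i j l m
    rw [covariance_map_fun (hm i j).aestronglyMeasurable (hm l m).aestronglyMeasurable
      measurable_vecToMatrix.aemeasurable]
    exact h.covariance_limitGaussian hω (i, j) (l, m)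

end MomentVector

/-! ### The multivariate central limit theorem for the exceedances. -/

section CentralLimit

variable {d : ℕ} {Q μ : Measure (EuclideanSpace ℝ (Fin d))}
  {ω : EuclideanSpace ℝ (Fin d) → ℝ}
  {Ω : Type*} [MeasurableSpace Ω] {P : Measure Ω} [IsProbabilityMeasure P]
  {X : ℕ → Ω → EuclideanSpace ℝ (Fin d)} {k : ℕ → ℕ}

/-- The normalized sum of `E_t̂ (θ θᵀ) - θ_i θ_iᵀ` over the exceedances of the random threshold
`t̂`. -/
noncomputable def extremeSum (ω : EuclideanSpace ℝ (Fin d) → ℝ)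
    (Q : Measure (EuclideanSpace ℝ (Fin d))) (X : ℕ → Ω → EuclideanSpace ℝ (Fin d)) (n k : ℕ)
    (w : Ω) : EuclideanSpace ℝ (Fin d × Fin d) :=
  (√(k : ℝ))⁻¹ • ∑ i ∈ extremes X n k w,
    (∫ x, momentVec ω x ∂(ProbabilityTheory.cond Q {x | threshold X n k w < ‖x‖}) -
      momentVec ω (X i w))

omit [IsProbabilityMeasure P] in
lemma IsIID.measurable_extremeSum [IsProbabilityMeasure Q] (hX : IsIID X P Q)
    (hω : IsScaling Q μ ω) (n k : ℕ) : Measurable (extremeSum ω Q X n k) := by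
  classical
  unfold extremeSum
  have h1 : (fun w => ∑ i ∈ extremes X n k w,
      (∫ x, momentVec ω x ∂(ProbabilityTheory.cond Q {x | threshold X n k w < ‖x‖}) -
        momentVec ω (X i w))) = fun w => ∑ i : Fin n, if i ∈ extremes X n k w then
      (∫ x, momentVec ω x ∂(ProbabilityTheory.cond Q {x | threshold X n k w < ‖x‖}) -
        momentVec ω (X i w)) else 0 := by
    funext w
    rw [Finset.sum_ite_mem, Finset.univ_inter]
  refine Measurable.const_smul (c := (√(k : ℝ))⁻¹) ?_
  rw [h1]
  refine Finset.measurable_sum _ fun i _ => Measurable.ite ?_ (Measurable.sub ?_ ?_)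
    measurable_const
  · exact hX.measurable_sample n (measurableSet_mem_exceedances measurable_norm k i)
  · exact (measurable_integral_cond Q measurable_norm
      (g := fun (_ : ℝ) x => momentVec ω x)
      (hω.measurable_momentVec.comp measurable_snd)).comp (hX.measurable_threshold n k)
  · exact hω.measurable_momentVec.comp (hX.measurable i)

/-- Lévy's continuity theorem: the characteristic function at ξ is the scalar result for the inner
product with ξ, and the quadratic form of the covariance matrix at ξ is the variance found there. -/
theorem IsRegularlyVarying.tendstoInDistribution_extremeSum (h : IsRegularlyVarying Q μ)
    (hX : IsIID X P Q) (hω : IsScaling Q μ ω) (hk : Tendsto k atTop atTop)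
    (hkn : Tendsto (fun n => (k n : ℝ) / n) atTop (𝓝 0)) :
    TendstoInDistribution (fun n => extremeSum ω Q X n (k n)) atTop id (fun _ => P)
      (limitGaussian ω μ) := by
  have hQP : IsProbabilityMeasure Q := hX.isProbabilityMeasure
  have hP := h.isProbabilityMeasure_limitModel
  have hmeas (n : ℕ) := hX.measurable_extremeSum hω n (k n)
  obtain ⟨C, hC0, hCQ, hCμ⟩ := h.exists_norm_momentVec_le hω
  refine ⟨fun n => (hmeas n).aemeasurable, aemeasurable_id, ?_⟩
  refine ProbabilityMeasure.tendsto_iff_tendsto_charFun.2 fun ξ => ?_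
  have hvM := hω.measurable_momentVec
  have hb (x : EuclideanSpace ℝ (Fin d)) (hx : ‖momentVec ω x‖ ≤ C) :
      |inner ℝ (momentVec ω x) ξ| ≤ C * ‖ξ‖ :=
    (abs_real_inner_le_norm _ _).trans (mul_le_mul_of_nonneg_right hx (norm_nonneg _))
  have key := h.tendsto_integral_cexp_sum hX hk hkn (y := fun x => inner ℝ (momentVec ω x) ξ)
    (hvM.inner_const) (fun c hc x hx => by rw [hω.momentVec_smul hc hx])
    (hω.ae_continuousAt_momentVec.mono fun x hx => hx.inner continuousAt_const)
    (hCQ.mono hb) (hCμ.mono hb)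
  simp only [ProbabilityMeasure.coe_mk, Measure.map_id]
  have hlim : charFun (limitGaussian ω μ) ξ =
      Complex.exp (-(variance (fun x => inner ℝ (momentVec ω x) ξ) (limitModel μ) : ℝ) / 2) := by
    rw [limitGaussian, charFun_multivariateGaussian
      (posSemidef_covarianceMatrix (h.memLp_momentVec_apply hω)),
      dotProduct_covarianceMatrix_mulVec (h.memLp_momentVec_apply hω)]
    simp
    ring_nf
  rw [hlim]
  refine key.congr fun n => ?_
  rw [charFun_apply, integral_map (hmeas n).aemeasurable (by fun_prop)]
  refine integral_congr_ae (ae_of_all _ fun w => ?_)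
  have hint (t : ℝ) : ∫ x, inner ℝ (momentVec ω x) ξ
      ∂(ProbabilityTheory.cond Q {x | t < ‖x‖}) =
      inner ℝ (∫ x, momentVec ω x ∂(ProbabilityTheory.cond Q {x | t < ‖x‖})) ξ := by
    have hcP : IsProbabilityMeasure (ProbabilityTheory.cond Q {x | t < ‖x‖}) :=
      cond_isProbabilityMeasure (h.measure_lt_norm_ne_zero t)
    have hi : Integrable (momentVec ω) (ProbabilityTheory.cond Q {x | t < ‖x‖}) :=
      Integrable.of_bound hvM.aestronglyMeasurable C
        (ProbabilityTheory.cond_absolutelyContinuous.ae_le hCQ)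
    simp only [real_inner_comm ξ]
    exact integral_inner hi ξ
  simp only [extremeSum, real_inner_smul_left, sum_inner, inner_sub_left, hint]

end CentralLimit

end ExtremePCA

namespace ExtremePCA

/-! ### Operator norm bounds and the linearized spectral projections. -/

section OperatorNorm

variable {d : ℕ} {M : Matrix (Fin d) (Fin d) ℝ}

lemma opNorm_nonneg (A : Matrix (Fin d) (Fin d) ℝ) : 0 ≤ opNorm A := norm_nonneg _

lemma opNorm_add_le (A B : Matrix (Fin d) (Fin d) ℝ) : opNorm (A + B) ≤ opNorm A + opNorm B := by
  simpa only [opNorm, map_add] using norm_add_le _ _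

lemma opNorm_sub_le (A B : Matrix (Fin d) (Fin d) ℝ) : opNorm (A - B) ≤ opNorm A + opNorm B := by
  simpa only [opNorm, map_sub] using norm_sub_le _ _

lemma opNorm_smul (c : ℝ) (A : Matrix (Fin d) (Fin d) ℝ) : opNorm (c • A) = |c| * opNorm A := by
  simp only [opNorm, map_smul, norm_smul, Real.norm_eq_abs]

lemma opNorm_mul_le (A B : Matrix (Fin d) (Fin d) ℝ) : opNorm (A * B) ≤ opNorm A * opNorm B := by
  simpa only [opNorm, map_mul] using norm_mul_le _ _

lemma opNorm_projMatrix_le_one (W : Submodule ℝ (EuclideanSpace ℝ (Fin d))) :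
    opNorm (projMatrix W) ≤ 1 := by
  rw [opNorm, toEuclideanCLM_projMatrix]
  exact W.starProjection_norm_le

lemma apply_eq_inner_toEuclideanCLM (A : Matrix (Fin d) (Fin d) ℝ) (i j : Fin d) :
    A i j = inner ℝ (EuclideanSpace.single i (1 : ℝ))
      (Matrix.toEuclideanCLM (𝕜 := ℝ) A (EuclideanSpace.single j 1)) := by
  rw [EuclideanSpace.inner_single_left, Matrix.ofLp_toEuclideanCLM]
  simp

lemma abs_apply_le_opNorm (A : Matrix (Fin d) (Fin d) ℝ) (i j : Fin d) : |A i j| ≤ opNorm A := by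
  refine (congrArg abs (apply_eq_inner_toEuclideanCLM A i j)).trans_le ?_
  refine (abs_real_inner_le_norm _ _).trans ?_
  have h := (Matrix.toEuclideanCLM (𝕜 := ℝ) A).le_opNorm (EuclideanSpace.single j 1)
  simpa [opNorm] using h

/-- The linear map that sends a matrix to its action on Euclidean space. -/
noncomputable def euclideanAction (d : ℕ) : Matrix (Fin d) (Fin d) ℝ →ₗ[ℝ]
    (EuclideanSpace ℝ (Fin d) →L[ℝ] EuclideanSpace ℝ (Fin d)) where
  toFun A := Matrix.toEuclideanCLM (𝕜 := ℝ) A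
  map_add' A B := map_add _ A B
  map_smul' c A := map_smul _ c A

lemma continuous_opNorm : Continuous (opNorm : Matrix (Fin d) (Fin d) ℝ → ℝ) :=
  continuous_norm.comp (LinearMap.continuous_of_finiteDimensional (euclideanAction d))

lemma exists_opNorm_vecToMatrix_le (d : ℕ) :
    ∃ c : ℝ, 0 ≤ c ∧ ∀ u, opNorm (vecToMatrix d u) ≤ c * ‖u‖ := by
  let f : EuclideanSpace ℝ (Fin d × Fin d) →L[ℝ]
      (EuclideanSpace ℝ (Fin d) →L[ℝ] EuclideanSpace ℝ (Fin d)) :=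
    LinearMap.toContinuousLinearMap
      ((euclideanAction d).comp (vecToMatrix d).toLinearMap)
  exact ⟨‖f‖, norm_nonneg f, fun u => f.le_opNorm u⟩

lemma limitMap_smul (s : Finset ℝ) (c : ℝ) (U : Matrix (Fin d) (Fin d) ℝ) (x : ℝ) :
    limitMap M s (c • U) x = c • limitMap M s U x := by
  rw [limitMap, limitMap, Finset.smul_sum]
  refine Finset.sum_congr rfl fun y _ => ?_
  rw [Matrix.mul_smul, Matrix.mul_smul, Matrix.smul_mul, Matrix.smul_mul, ← smul_add, smul_comm]

lemma limitMap_add (s : Finset ℝ) (U V : Matrix (Fin d) (Fin d) ℝ) (x : ℝ) :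
    limitMap M s (U + V) x = limitMap M s U x + limitMap M s V x := by
  rw [limitMap, limitMap, limitMap, ← Finset.sum_add_distrib]
  refine Finset.sum_congr rfl fun y _ => ?_
  rw [Matrix.mul_add, Matrix.mul_add, Matrix.add_mul, Matrix.add_mul, ← smul_add, add_add_add_comm]

lemma exists_opNorm_limitMap_le (M : Matrix (Fin d) (Fin d) ℝ) (s : Finset ℝ) :
    ∃ c : ℝ, 0 ≤ c ∧ ∀ x ∈ s, ∀ U, opNorm (limitMap M s U x) ≤ c * opNorm U := by
  have h0 (x : ℝ) : 0 ≤ ∑ y ∈ s.erase x, |(y - x)⁻¹| * 2 :=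
    Finset.sum_nonneg fun y _ => by positivity
  refine ⟨∑ x ∈ s, ∑ y ∈ s.erase x, |(y - x)⁻¹| * 2, Finset.sum_nonneg fun x _ => h0 x,
    fun x hx U => ?_⟩
  have hU := opNorm_nonneg U
  have hprod (V W : Submodule ℝ (EuclideanSpace ℝ (Fin d))) :
      opNorm (projMatrix V * U * projMatrix W) ≤ opNorm U := by
    refine (opNorm_mul_le _ _).trans ((mul_le_of_le_one_right (opNorm_nonneg _)
      (opNorm_projMatrix_le_one W)).trans ((opNorm_mul_le _ _).trans
      (mul_le_of_le_one_left hU (opNorm_projMatrix_le_one V))))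
  have h1 : opNorm (limitMap M s U x) ≤ ∑ y ∈ s.erase x, |(y - x)⁻¹| * 2 * opNorm U := by
    rw [limitMap, opNorm, map_sum]
    refine norm_sum_le_of_le _ fun y _ => ?_
    change opNorm _ ≤ _
    rw [opNorm_smul, mul_assoc |(y - x)⁻¹|]
    refine mul_le_mul_of_nonneg_left ((opNorm_add_le _ _).trans ?_) (abs_nonneg _)
    linarith [hprod (eigenspaceOf M y) (eigenspaceOf M x),
      hprod (eigenspaceOf M x) (eigenspaceOf M y)]
  rw [← Finset.sum_mul] at h1
  exact h1.trans (mul_le_mul_of_nonneg_right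
    (Finset.single_le_sum (f := fun x => ∑ y ∈ s.erase x, |(y - x)⁻¹| * 2)
      (fun x _ => h0 x) hx) hU)

lemma continuous_limitMap (M : Matrix (Fin d) (Fin d) ℝ) (s : Finset ℝ) (x : ℝ) :
    Continuous fun U => limitMap M s U x := by
  unfold limitMap
  refine continuous_finsetSum _ fun y _ => ?_
  fun_prop

/-- Exhibits the projection as a polynomial in the eigenvector entries, so that measurable
eigenvectors give measurable projections. -/
lemma projMatrix_matchedSpan_apply {A : Matrix (Fin d) (Fin d) ℝ} {lam' lam : Fin d → ℝ}
    {v : Fin d → EuclideanSpace ℝ (Fin d)} (h : IsOrderedEigensystem A lam' v) (x : ℝ)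
    (i j : Fin d) :
    projMatrix (matchedSpan lam v x) i j = ∑ m, if lam m = x then v m i * v m j else 0 := by
  refine (apply_eq_inner_toEuclideanCLM _ i j).trans ?_
  rw [toEuclideanCLM_projMatrix]
  conv_lhs => rw [← h.basis.sum_repr' (EuclideanSpace.single j (1 : ℝ))]
  rw [map_sum, inner_sum]
  refine Finset.sum_congr rfl fun m _ => ?_
  rw [map_smul, h.basis_apply, starProjection_matchedSpan_apply h.orthonormal]
  split_ifs
  · rw [inner_smul_right, EuclideanSpace.inner_single_left, EuclideanSpace.inner_single_right]
    simp [mul_comm]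
  · simp

/-- The linearization of the spectral projections, for matrices that differ by a small multiple of
a bounded matrix. -/
lemma exists_opNorm_smul_sub_limitMap_le {lamM : Fin d → ℝ}
    {vM : Fin d → EuclideanSpace ℝ (Fin d)} (hM : IsOrderedEigensystem M lamM vM) {δ K : ℝ}
    (hδ : 0 < δ) (hK : 0 ≤ K) : ∃ η : ℝ, 0 < η ∧ ∀ (r : ℝ) (A B T : Matrix (Fin d) (Fin d) ℝ)
      (lam lam' : Fin d → ℝ) (v v' : Fin d → EuclideanSpace ℝ (Fin d)), 0 < r → r⁻¹ ≤ η →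
      IsOrderedEigensystem A lam v → IsOrderedEigensystem B lam' v' → opNorm (A - M) ≤ η →
      opNorm T ≤ K → opNorm (r • (B - A) + T) ≤ η → ∀ x ∈ distinctValues lamM,
        opNorm (r • (projMatrix (matchedSpan lamM v' x) - projMatrix (matchedSpan lamM v x)) -
          limitMap M (distinctValues lamM) T x) ≤ δ := by
  obtain ⟨c, hc0, hc⟩ := exists_opNorm_limitMap_le M (distinctValues lamM)
  obtain ⟨ρ, hρ, hmain⟩ := exists_opNorm_projMatrix_sub_le hM
    (δ := δ / (2 * (K + 1))) (by positivity)
  -- η ≤ 1 gives r ‖B - A‖ ≤ K + 1. With r⁻¹ ≤ η, the second bound places both `A` and `B` within ρ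
  -- of `M`. The third bounds the linear map at the remainder r(B - A) + T by δ/2.
  refine ⟨min 1 (min (ρ / (K + 2)) (δ / (2 * (c + 1)))), by positivity, ?_⟩
  intro r A B T lam lam' v v' hr hrη hA hB hAM hT hR x hx
  set η := min 1 (min (ρ / (K + 2)) (δ / (2 * (c + 1)))) with hη
  have hη0 : 0 < η := by positivity
  have hη1 : η ≤ 1 := min_le_left _ _
  have hη2 : η * (K + 2) ≤ ρ :=
    (le_div_iff₀ (by positivity)).1 ((min_le_right _ _).trans (min_le_left _ _))
  have hη3 : η * (2 * (c + 1)) ≤ δ :=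
    (le_div_iff₀ (by positivity)).1 ((min_le_right _ _).trans (min_le_right _ _))
  have h1 : r * opNorm (B - A) ≤ K + 1 := by
    have h := opNorm_sub_le (r • (B - A) + T) T
    rw [add_sub_cancel_right, opNorm_smul, abs_of_pos hr] at h
    linarith
  have h2 : opNorm (B - A) ≤ η * (K + 1) := by
    calc opNorm (B - A) = r⁻¹ * (r * opNorm (B - A)) := by field_simp
      _ ≤ η * (K + 1) := mul_le_mul hrη h1 (mul_nonneg hr.le (opNorm_nonneg _)) hη0.le
  have h3 : opNorm (B - M) ≤ ρ := by
    have h := opNorm_add_le (B - A) (A - M)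
    rw [sub_add_sub_cancel] at h
    linarith
  have hAM' : opNorm (A - M) ≤ ρ := by nlinarith
  have h4 := hmain A B lam lam' v v' hA hB hAM' h3 x hx
  have h5 := hc x hx (r • (B - A) + T)
  -- `T` approximates minus r(B - A), which accounts for the signs: a differentiability error minus
  -- the linear map at the remainder.
  have hid : r • (projMatrix (matchedSpan lamM v' x) - projMatrix (matchedSpan lamM v x)) -
        limitMap M (distinctValues lamM) T x =
      r • (projMatrix (matchedSpan lamM v' x) - projMatrix (matchedSpan lamM v x) +
        limitMap M (distinctValues lamM) (B - A) x) -
      limitMap M (distinctValues lamM) (r • (B - A) + T) x := by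
    rw [limitMap_add, limitMap_smul, smul_add]
    abel
  rw [hid]
  refine (opNorm_sub_le _ _).trans ?_
  rw [opNorm_smul, abs_of_pos hr]
  have h6 : r * (δ / (2 * (K + 1)) * opNorm (B - A)) ≤ δ / 2 := by
    calc r * (δ / (2 * (K + 1)) * opNorm (B - A))
        = δ / (2 * (K + 1)) * (r * opNorm (B - A)) := by ring
      _ ≤ δ / (2 * (K + 1)) * (K + 1) := mul_le_mul_of_nonneg_left h1 (by positivity)
      _ = δ / 2 := by field_simp
  have h7 : c * opNorm (r • (B - A) + T) ≤ δ / 2 := by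
    have := mul_le_mul_of_nonneg_left hR hc0
    nlinarith
  have h8 := mul_le_mul_of_nonneg_left h4 hr.le
  linarith

end OperatorNorm

/-! ### Tightness and events that vanish in probability. -/

section Tightness

variable {Ω Ω' E : Type*} [MeasurableSpace Ω] {P : Measure Ω} [IsProbabilityMeasure P]
  [MeasurableSpace Ω'] {P' : Measure Ω'} [IsProbabilityMeasure P']
  [NormedAddCommGroup E] [MeasurableSpace E] [BorelSpace E]

/-- A sequence that converges in distribution is asymptotically tight. -/
lemma exists_eventually_measure_lt_of_tendstoInDistribution {S : ℕ → Ω → E} {Z : Ω' → E}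
    (h : TendstoInDistribution S atTop Z (fun _ => P) P') {e : ENNReal} (he : 0 < e) :
    ∃ K : ℝ, 0 ≤ K ∧ ∀ᶠ n in atTop, P {w | K ≤ ‖S n w‖} < e := by
  have hZ := h.aemeasurable_limit
  have hmap : IsProbabilityMeasure (P'.map Z) := Measure.isProbabilityMeasure_map hZ
  have hmeasE (K : ℝ) : MeasurableSet {u : E | K ≤ ‖u‖} :=
    (isClosed_le continuous_const continuous_norm).measurableSet
  have hlim : Tendsto (fun K : ℕ => P'.map Z {u | (K : ℝ) ≤ ‖u‖}) atTop (𝓝 0) := by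
    have hempty : ⋂ K : ℕ, {u : E | (K : ℝ) ≤ ‖u‖} = ∅ := by
      ext u
      simp only [Set.mem_iInter, Set.mem_ofPred_eq, Set.mem_empty_iff_false, iff_false, not_forall,
        not_le]
      exact exists_nat_gt ‖u‖
    have := tendsto_measure_iInter_atTop (μ := P'.map Z)
      (s := fun K : ℕ => {u : E | (K : ℝ) ≤ ‖u‖}) (fun K => (hmeasE K).nullMeasurableSet)
      (fun K K' hK u (hu : (K' : ℝ) ≤ ‖u‖) => (show (K : ℝ) ≤ (K' : ℝ) by exact_mod_cast hK).trans hu)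
      ⟨0, measure_ne_top _ _⟩
    rwa [hempty, measure_empty] at this
  obtain ⟨K, hK⟩ := (hlim.eventually_lt_const he).exists
  refine ⟨K, Nat.cast_nonneg K, ?_⟩
  have hsup := ProbabilityMeasure.limsup_measure_closed_le_of_tendsto h.tendsto
    (isClosed_le continuous_const continuous_norm : IsClosed {u : E | (K : ℝ) ≤ ‖u‖})
  have hev := eventually_lt_of_limsup_lt (hsup.trans_lt hK)
  filter_upwards [hev] with n hn
  simp only [ProbabilityMeasure.coe_mk] at hn
  rwa [Measure.map_apply_of_aemeasurable (h.forall_aemeasurable n) (hmeasE K)] at hn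

/-- Events vanish in probability if they do so on the events where an asymptotically tight sequence
is bounded. -/
lemma tendsto_measure_zero_of_tendstoInDistribution {S : ℕ → Ω → E} {Z : Ω' → E}
    (h : TendstoInDistribution S atTop Z (fun _ => P) P') {A : ℕ → Set Ω}
    (hA : ∀ K : ℝ, 0 ≤ K → Tendsto (fun n => P {w | w ∈ A n ∧ ‖S n w‖ ≤ K}) atTop (𝓝 0)) :
    Tendsto (fun n => P (A n)) atTop (𝓝 0) := by
  refine ENNReal.tendsto_nhds_zero.2 fun e he => ?_
  obtain ⟨K, hK0, hK⟩ := exists_eventually_measure_lt_of_tendstoInDistribution h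
    (ENNReal.half_pos he.ne')
  filter_upwards [hK, ENNReal.tendsto_nhds_zero.1 (hA K hK0) (e / 2) (ENNReal.half_pos he.ne')]
    with n h1 h2
  calc P (A n) ≤ P ({w | w ∈ A n ∧ ‖S n w‖ ≤ K} ∪ {w | K ≤ ‖S n w‖}) := by
        refine measure_mono fun w hw => ?_
        rcases le_total ‖S n w‖ K with h | h
        · exact Or.inl ⟨hw, h⟩
        · exact Or.inr h
    _ ≤ e / 2 + e / 2 := (measure_union_le _ _).trans (add_le_add h2 h1.le)
    _ = e := ENNReal.add_halves e

end Tightness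

end ExtremePCA

namespace ExtremePCA

/-! ### The empirical matrix, rescaled to an average over the exceedances. -/

section EmpiricalMatrix

variable {d : ℕ} {Q μ : Measure (EuclideanSpace ℝ (Fin d))}
  {ω : EuclideanSpace ℝ (Fin d) → ℝ}
  {Ω : Type*} [MeasurableSpace Ω] {P : Measure Ω} [IsProbabilityMeasure P]
  {X : ℕ → Ω → EuclideanSpace ℝ (Fin d)} {k : ℕ → ℕ}

omit [MeasurableSpace Ω] in
lemma sigmaHat_sample (ω : EuclideanSpace ℝ (Fin d) → ℝ) (n k : ℕ) (w : Ω) :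
    sigmaHat ω k (fun i : Fin n => X i w) =
      (k : ℝ)⁻¹ • ∑ i ∈ extremes X n k w, vecToMatrix d (momentVec ω (X i w)) := by
  rw [sigmaHat, extremes, exceedances, Finset.sum_filter]
  congr 1

lemma IsRegularlyVarying.integrable_momentVec_cond [IsProbabilityMeasure Q]
    (h : IsRegularlyVarying Q μ) (hω : IsScaling Q μ ω) (t : ℝ) :
    Integrable (momentVec ω) (ProbabilityTheory.cond Q {x | t < ‖x‖}) := by
  have hcP : IsProbabilityMeasure (ProbabilityTheory.cond Q {x | t < ‖x‖}) :=
    cond_isProbabilityMeasure (h.measure_lt_norm_ne_zero t)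
  obtain ⟨C, -, hQ, -⟩ := h.exists_norm_momentVec_le hω
  exact Integrable.of_bound hω.measurable_momentVec.aestronglyMeasurable C
    (ProbabilityTheory.cond_absolutelyContinuous.ae_le hQ)

omit [MeasurableSpace Ω] in
lemma IsRegularlyVarying.vecToMatrix_extremeSum [IsProbabilityMeasure Q]
    (h : IsRegularlyVarying Q μ) (hω : IsScaling Q μ ω) {n k : ℕ} (hk : 0 < k) (w : Ω) :
    vecToMatrix d (extremeSum ω Q X n k w) = (√(k : ℝ))⁻¹ •
      (((extremes X n k w).card : ℝ) • exceedMatrix ω Q (threshold X n k w) -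
        (k : ℝ) • sigmaHat ω k fun i : Fin n => X i w) := by
  have hk' : (k : ℝ) ≠ 0 := by positivity
  rw [extremeSum, map_smul, map_sum, sigmaHat_sample, smul_inv_smul₀ hk', exceedMatrix,
    momentMatrix_eq_vecToMatrix (h.integrable_momentVec_cond hω _)]
  simp only [map_sub, Finset.sum_sub_distrib, Finset.sum_const]
  rw [← Nat.cast_smul_eq_nsmul ℝ]

omit [MeasurableSpace Ω] in
/-- The deviation of the rescaled empirical matrix, up to the fluctuation `extremeSum`. -/
lemma IsRegularlyVarying.opNorm_sqrt_smul_sub_add_le [IsProbabilityMeasure Q]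
    (h : IsRegularlyVarying Q μ) (hω : IsScaling Q μ ω) {n k : ℕ} (hk : 0 < k) (hkn : k < n)
    {η : ℝ} (hη2 : η ≤ 1 / 2) {w : Ω}
    (hN : (1 - η) * k ≤ (extremes X n k w).card) (A : Matrix (Fin d) (Fin d) ℝ) :
    opNorm (√(k : ℝ) • (((k : ℝ) / (extremes X n k w).card) •
        (sigmaHat ω k fun i : Fin n => X i w) - A) + vecToMatrix d (extremeSum ω Q X n k w)) ≤
      2 * η * opNorm (vecToMatrix d (extremeSum ω Q X n k w)) +
        √(k : ℝ) * opNorm (exceedMatrix ω Q (threshold X n k w) - A) := by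
  have hk0 : (0 : ℝ) < k := by positivity
  have hNk : ((extremes X n k w).card : ℝ) ≤ k := by exact_mod_cast card_exceedances_le hkn _
  have hL := h.vecToMatrix_extremeSum (X := X) (n := n) hω hk w
  set N : ℝ := ((extremes X n k w).card : ℝ)
  set V := vecToMatrix d (extremeSum ω Q X n k w)
  set B := sigmaHat ω k fun i : Fin n => X i w
  set E := exceedMatrix ω Q (threshold X n k w)
  have hN2 : (k : ℝ) / 2 ≤ N := by nlinarith
  have hN0 : 0 < N := by linarith
  have hs : 0 < √(k : ℝ) := Real.sqrt_pos.2 hk0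
  -- Since √k V = N E - k B, the average (k/N) B equals E - (√k/N) V. Hence `V` cancels up to the
  -- factor 1 - k/N, of modulus at most 2η, and the bias E - A is left.
  have hid : √(k : ℝ) • (((k : ℝ) / N) • B - A) + V =
      (1 - (k : ℝ) / N) • V + √(k : ℝ) • (E - A) := by
    ext i j
    have hLij := congrFun (congrFun hL i) j
    simp only [Matrix.smul_apply, Matrix.sub_apply, smul_eq_mul] at hLij
    simp only [Matrix.add_apply, Matrix.smul_apply, Matrix.sub_apply, smul_eq_mul]
    rw [hLij]
    have hkk : (k : ℝ) = √(k : ℝ) * √(k : ℝ) := (Real.mul_self_sqrt hk0.le).symm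
    generalize √(k : ℝ) = s at *
    rw [hkk]
    field_simp
    ring
  rw [hid]
  refine (opNorm_add_le _ _).trans ?_
  rw [opNorm_smul, opNorm_smul, abs_of_pos hs]
  gcongr
  · exact opNorm_nonneg _
  · rw [one_sub_div hN0.ne', abs_div, abs_of_pos hN0, abs_of_nonpos (by linarith),
      div_le_iff₀ hN0]
    nlinarith

lemma IsRegularlyVarying.tendsto_exceedMatrix [IsProbabilityMeasure Q]
    (h : IsRegularlyVarying Q μ) (hω : IsScaling Q μ ω) :
    Tendsto (exceedMatrix ω Q) atTop (𝓝 (sigmaInf ω μ)) := by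
  obtain ⟨C, -, hQ, hμ⟩ := h.exists_norm_momentVec_le hω
  refine tendsto_pi_nhds.2 fun i => tendsto_pi_nhds.2 fun j => ?_
  refine h.tendsto_integral_cond (g := fun x => angle ω x i * angle ω x j) (M := C) ?_ ?_ ?_ ?_ ?_
  · exact (EuclideanSpace.proj (𝕜 := ℝ) (i, j)).measurable.comp hω.measurable_momentVec
  · intro c hc x hx
    simp only [hω.angle_smul hc hx]
  · filter_upwards [hω.ae_continuousAt_momentVec] with x hx
    exact (EuclideanSpace.proj (𝕜 := ℝ) (i, j)).continuous.continuousAt.comp hx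
  · filter_upwards [hQ] with x hx
    exact (PiLp.norm_apply_le (momentVec ω x) (i, j)).trans hx
  · filter_upwards [hμ] with x hx
    exact (PiLp.norm_apply_le (momentVec ω x) (i, j)).trans hx

lemma IsRegularlyVarying.tendsto_opNorm_sigmaPop_sub [IsProbabilityMeasure Q]
    (h : IsRegularlyVarying Q μ) (hω : IsScaling Q μ ω) (hk : Tendsto k atTop atTop)
    (hkn : Tendsto (fun n => (k n : ℝ) / n) atTop (𝓝 0)) :
    Tendsto (fun n => opNorm (sigmaPop ω Q n (k n) - sigmaInf ω μ)) atTop (𝓝 0) := by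
  have h1 := ((h.tendsto_exceedMatrix hω).comp (h.tendsto_radiusQuantile hk hkn)).sub_const
    (sigmaInf ω μ)
  have h2 := (continuous_opNorm.tendsto _).comp h1
  rw [sub_self] at h2
  have h3 : opNorm (0 : Matrix (Fin d) (Fin d) ℝ) = 0 := by simp [opNorm]
  rw [h3] at h2
  exact h2

end EmpiricalMatrix

/-! ### Linearization of the projection error in probability. -/

section Linearization

variable {d : ℕ} {Q μ : Measure (EuclideanSpace ℝ (Fin d))}
  {ω : EuclideanSpace ℝ (Fin d) → ℝ}
  {Ω : Type*} [MeasurableSpace Ω] {P : Measure Ω} [IsProbabilityMeasure P]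
  {X : ℕ → Ω → EuclideanSpace ℝ (Fin d)} {k : ℕ → ℕ}
  {lamInf : Fin d → ℝ} {vInf : Fin d → EuclideanSpace ℝ (Fin d)}
  {lamPop : ℕ → Fin d → ℝ} {vPop : ℕ → Fin d → EuclideanSpace ℝ (Fin d)}
  {lamHat : ℕ → Ω → Fin d → ℝ} {vHat : ℕ → Ω → Fin d → EuclideanSpace ℝ (Fin d)}

/-- Up to a remainder that vanishes in probability, the rescaled error of the spectral projections
is a linear function of `extremeSum`. -/
theorem IsRegularlyVarying.tendsto_measure_lt_opNorm (h : IsRegularlyVarying Q μ)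
    (hX : IsIID X P Q) (hω : IsScaling Q μ ω) (hk : Tendsto k atTop atTop)
    (hkn : Tendsto (fun n => (k n : ℝ) / n) atTop (𝓝 0)) (hB : BiasCondition ω Q k)
    (hInf : IsOrderedEigensystem (sigmaInf ω μ) lamInf vInf)
    (hPop : ∀ n, IsOrderedEigensystem (sigmaPop ω Q n (k n)) (lamPop n) (vPop n))
    (hHat : ∀ n w, IsOrderedEigensystem (sigmaHat ω (k n) (fun i : Fin n => X i w))
      (lamHat n w) (vHat n w)) {δ : ℝ} (hδ : 0 < δ) :
    Tendsto (fun n => P {w | ∃ x ∈ distinctValues lamInf, δ < opNorm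
      (√(k n : ℝ) • (projMatrix (matchedSpan lamInf (vHat n w) x) -
        projMatrix (matchedSpan lamInf (vPop n) x)) -
      limitMap (sigmaInf ω μ) (distinctValues lamInf)
        (vecToMatrix d (extremeSum ω Q X n (k n) w)) x)}) atTop (𝓝 0) := by
  have hQP : IsProbabilityMeasure Q := hX.isProbabilityMeasure
  refine tendsto_measure_zero_of_tendstoInDistribution
    (h.tendstoInDistribution_extremeSum hX hω hk hkn) fun K hK => ?_
  obtain ⟨c, hc0, hc⟩ := exists_opNorm_vecToMatrix_le d
  obtain ⟨η, hη0, hη⟩ := exists_opNorm_smul_sub_limitMap_le hInf hδ (mul_nonneg hc0 hK)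
  obtain ⟨ε, hε0, hε⟩ := hB
  -- The budget η is shared equally: 2η' c K ≤ η/2 for the random number of exceedances, and η/2 for
  -- the bias.
  set η' := min (1 / 2) (η / (4 * (c * K + 1))) with hη'
  have hcK : 0 ≤ c * K := mul_nonneg hc0 hK
  have hη'0 : 0 < η' := by positivity
  have hη'1 : η' ≤ 1 / 2 := min_le_left _ _
  have hη'2 : η' * (4 * (c * K + 1)) ≤ η := (le_div_iff₀ (by positivity)).1 (min_le_right _ _)
  set ε' := min (1 / 2) ε with hε'
  have hε'0 : 0 < ε' := by positivity
  have hε'1 : ε' ≤ 1 / 2 := min_le_left _ _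
  have hε'2 : ε' ≤ ε := min_le_right _ _
  have hE1 := h.tendsto_measure_card_extremes_lt hX hk hkn hη'0
  have hE2 := h.tendsto_measure_threshold_le hX hk hkn (s := 1 - ε') (by linarith) (by linarith)
  have hE3 := h.tendsto_measure_lt_threshold hX hk hkn (s := 1 + ε') (by linarith)
  have hE23 := tendsto_measure_zero_of_subset (A := fun n => {w | threshold X n (k n) w ≤
    (1 - ε') * radiusQuantile Q n (k n) ∨ (1 + ε') * radiusQuantile Q n (k n) <
      threshold X n (k n) w}) hE2 hE3 (Eventually.of_forall fun n w hw => hw)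
  refine tendsto_measure_zero_of_subset hE1 hE23 ?_
  have hsqrt : Tendsto (fun n => (√(k n : ℝ))⁻¹) atTop (𝓝 0) :=
    tendsto_inv_atTop_zero.comp (Real.tendsto_sqrt_atTop.comp
      (tendsto_natCast_atTop_atTop.comp hk))
  filter_upwards [hε (η / 2) (half_pos hη0), eventually_lt_of_tendsto_div hkn,
    hk.eventually_gt_atTop 0, (h.tendsto_radiusQuantile hk hkn).eventually_gt_atTop 0,
    hsqrt.eventually_le_const hη0,
    (h.tendsto_opNorm_sigmaPop_sub hω hk hkn).eventually_le_const hη0]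
    with n hbias hkn' hk0 ht hs hA w hw
  obtain ⟨⟨x, hx, hlt⟩, hSK⟩ := hw
  by_contra! hcon
  obtain ⟨hN, hthr⟩ := hcon
  have hN' : (1 - η') * k n ≤ (extremes X n (k n) w).card := hN
  have hk0' : (0 : ℝ) < k n := by exact_mod_cast hk0
  have hsq : 0 < √(k n : ℝ) := Real.sqrt_pos.2 hk0'
  -- Uniformity in s in the bias condition is what allows this random ratio.
  have hb := hbias (threshold X n (k n) w / radiusQuantile Q n (k n))
    ⟨(le_div_iff₀ ht).2 ((mul_le_mul_of_nonneg_right (by linarith) ht.le).trans hthr.1.le),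
      (div_le_iff₀ ht).2 (hthr.2.trans (mul_le_mul_of_nonneg_right (by linarith) ht.le))⟩
  rw [div_mul_cancel₀ _ ht.ne', le_div_iff₀ hsq] at hb
  have hV : opNorm (vecToMatrix d (extremeSum ω Q X n (k n) w)) ≤ c * K :=
    (hc _).trans (mul_le_mul_of_nonneg_left hSK hc0)
  have hdev := h.opNorm_sqrt_smul_sub_add_le hω hk0 hkn' hη'1 hN' (sigmaPop ω Q n (k n))
  have hR : opNorm (√(k n : ℝ) • (((k n : ℝ) / (extremes X n (k n) w).card) •
        (sigmaHat ω (k n) fun i : Fin n => X i w) - sigmaPop ω Q n (k n)) +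
      vecToMatrix d (extremeSum ω Q X n (k n) w)) ≤ η := by
    refine hdev.trans ?_
    have := mul_le_mul_of_nonneg_left hV (show 0 ≤ 2 * η' by positivity)
    nlinarith
  -- The same vectors form an ordered eigensystem of the rescaled matrix, so the scale factor k/N
  -- does not affect the projections.
  exact absurd (hη _ _ _ _ _ _ _ _ hsq hs (hPop n)
    ((hHat n w).smul (c := (k n : ℝ) / (extremes X n (k n) w).card) (by positivity)) hA hV hR x hx)
    (not_le.2 hlt)

end Linearization

end ExtremePCA

/-! ### The limit theorem for the spectral projections. -/

theorem mainTheorem2 {d : ℕ} {Ω : Type*} [MeasurableSpace Ω] (P : Measure Ω)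
    [IsProbabilityMeasure P]
    -- an iid sequence of regularly varying random vectors
    (X : ℕ → Ω → EuclideanSpace ℝ (Fin d)) (hX : ∀ i, Measurable (X i))
    (hindep : iIndepFun X P) (hident : ∀ i, IdentDistrib (X i) (X 0) P P)
    (μ : Measure (EuclideanSpace ℝ (Fin d)))
    (hRV : ExtremePCA.IsRegularlyVarying (P.map (X 0)) μ)
    (ω : EuclideanSpace ℝ (Fin d) → ℝ) (hω : ExtremePCA.IsScaling (P.map (X 0)) μ ω)
    -- an intermediate sequence, for which the bias condition holds
    (k : ℕ → ℕ) (hk : Tendsto k atTop atTop)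
    (hkn : Tendsto (fun n => (k n : ℝ) / n) atTop (𝓝 0))
    (hB : ExtremePCA.BiasCondition ω (P.map (X 0)) k)
    -- ordered eigenvalues and orthonormal eigenvectors of the three matrices
    (lamInf : Fin d → ℝ) (vInf : Fin d → EuclideanSpace ℝ (Fin d))
    (hInf : ExtremePCA.IsOrderedEigensystem (ExtremePCA.sigmaInf ω μ) lamInf vInf)
    (lamPop : ℕ → Fin d → ℝ) (vPop : ℕ → Fin d → EuclideanSpace ℝ (Fin d))
    (hPop : ∀ n, ExtremePCA.IsOrderedEigensystem
      (ExtremePCA.sigmaPop ω (P.map (X 0)) n (k n)) (lamPop n) (vPop n))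
    (lamHat : ℕ → Ω → Fin d → ℝ) (vHat : ℕ → Ω → Fin d → EuclideanSpace ℝ (Fin d))
    (hHat : ∀ n w, ExtremePCA.IsOrderedEigensystem
      (ExtremePCA.sigmaHat ω (k n) (fun i : Fin n => X i w)) (lamHat n w) (vHat n w))
    (hHatMeas : ∀ n m, AEMeasurable (fun w => vHat n w m) P) :
    ∃ (ν : Measure (Matrix (Fin d) (Fin d) ℝ)) (_ : IsGaussian ν),
      ExtremePCA.HasLimitMoments ω μ ν ∧
      TendstoInDistribution
        (fun (n : ℕ) (w : Ω) (x : ExtremePCA.distinctValues lamInf) =>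
          √(k n : ℝ) • (ExtremePCA.projMatrix (ExtremePCA.matchedSpan lamInf (vHat n w) x) -
            ExtremePCA.projMatrix (ExtremePCA.matchedSpan lamInf (vPop n) x)))
        atTop
        (fun (U : Matrix (Fin d) (Fin d) ℝ) (x : ExtremePCA.distinctValues lamInf) =>
          ExtremePCA.limitMap (ExtremePCA.sigmaInf ω μ) (ExtremePCA.distinctValues lamInf) U x)
        (fun _ => P) ν := by
  open ExtremePCA in
  have hiid : IsIID X P (P.map (X 0)) := ⟨hX, hindep, fun i => (hident i).map_eq⟩
  have hQP : IsProbabilityMeasure (P.map (X 0)) := hiid.isProbabilityMeasure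
  have hgauss : IsGaussian ((limitGaussian ω μ).map (vecToMatrix d)) :=
    isGaussian_map_of_measurable measurable_vecToMatrix
  refine ⟨(limitGaussian ω μ).map (vecToMatrix d), hgauss, hRV.hasLimitMoments hω, ?_⟩
  -- the entries, as elements of a normed space
  let G : Matrix (Fin d) (Fin d) ℝ → (distinctValues lamInf → Fin d → Fin d → ℝ) :=
    fun U x i j => limitMap (sigmaInf ω μ) (distinctValues lamInf) U x i j
  let D : ℕ → Ω → (distinctValues lamInf → Fin d → Fin d → ℝ) := fun n w x i j =>
    (√(k n : ℝ) • (projMatrix (matchedSpan lamInf (vHat n w) x) -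
      projMatrix (matchedSpan lamInf (vPop n) x))) i j
  let toMatrices : (distinctValues lamInf → Fin d → Fin d → ℝ) →
    (distinctValues lamInf → Matrix (Fin d) (Fin d) ℝ) := fun f x => Matrix.of (f x)
  have hG : Continuous G := continuous_pi fun x => continuous_pi fun i => continuous_pi fun j =>
    (continuous_limitMap _ _ _).matrix_elem i j
  have hto : Continuous toMatrices := continuous_pi fun x => continuous_matrix fun i j => by
    simp only [toMatrices, Matrix.of_apply]
    fun_prop
  have hD (n : ℕ) : AEMeasurable (D n) P := by
    refine aemeasurable_pi_lambda _ fun x => aemeasurable_pi_lambda _ fun i =>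
      aemeasurable_pi_lambda _ fun j => ?_
    simp only [D, Matrix.smul_apply, Matrix.sub_apply, smul_eq_mul,
      fun w => projMatrix_matchedSpan_apply (lam := lamInf) (hHat n w)]
    refine AEMeasurable.const_mul (AEMeasurable.sub_const ?_ _) _
    refine Finset.aemeasurable_fun_sum _ fun m _ => ?_
    have he (i : Fin d) : AEMeasurable (fun w => vHat n w m i) P :=
      (EuclideanSpace.proj (𝕜 := ℝ) i).measurable.comp_aemeasurable (hHatMeas n m)
    split_ifs
    · exact (he i).mul (he j)
    · exact aemeasurable_const
  have hlin := (hRV.tendstoInDistribution_extremeSum hiid hω hk hkn).continuous_comp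
    (hG.comp (vecToMatrix d).continuous)
  have hrem : TendstoInMeasure P
      (D - fun n => (G ∘ vecToMatrix d) ∘ extremeSum ω (P.map (X 0)) X n (k n)) atTop 0 := by
    rw [tendstoInMeasure_iff_norm]
    intro e he
    refine tendsto_of_tendsto_of_tendsto_of_le_of_le tendsto_const_nhds
      (hRV.tendsto_measure_lt_opNorm hiid hω hk hkn hB hInf hPop hHat (half_pos he))
      (fun _ => zero_le) fun n => measure_mono fun w hw => ?_
    have hw' : e ≤ ‖D n w - G (vecToMatrix d (extremeSum ω (P.map (X 0)) X n (k n) w)) - 0‖ := hw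
    by_contra hcon
    simp only [Set.mem_ofPred_eq, not_exists, not_and, not_lt] at hcon
    refine absurd hw' (not_le.2 (lt_of_le_of_lt ?_ (half_lt_self he)))
    rw [sub_zero]
    refine (pi_norm_le_iff_of_nonneg (half_pos he).le).2 fun x =>
      (pi_norm_le_iff_of_nonneg (half_pos he).le).2 fun i =>
      (pi_norm_le_iff_of_nonneg (half_pos he).le).2 fun j => ?_
    exact (abs_apply_le_opNorm _ i j).trans (hcon x x.2)
  -- Slutsky's lemma in the normed space of entries, then back to families of matrices by continuous
  -- mapping.
  have hmain := (tendstoInDistribution_of_tendstoInMeasure_sub D _ hlin hrem hD).continuous_comp hto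
  have hZ : Continuous fun (U : Matrix (Fin d) (Fin d) ℝ) (x : distinctValues lamInf) =>
      limitMap (sigmaInf ω μ) (distinctValues lamInf) U x :=
    continuous_pi fun x => continuous_limitMap _ _ _
  refine ⟨hmain.forall_aemeasurable, hZ.measurable.aemeasurable, ?_⟩
  -- The limit obtained lives on the vector space of d² coordinates, the required one on matrices;
  -- only their laws have to agree.
  have hmap : ((limitGaussian ω μ).map (vecToMatrix d)).map
      (fun (U : Matrix (Fin d) (Fin d) ℝ) (x : distinctValues lamInf) =>
        limitMap (sigmaInf ω μ) (distinctValues lamInf) U x) =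
      (limitGaussian ω μ).map (toMatrices ∘ (G ∘ vecToMatrix d) ∘ id) :=
    Measure.map_map hZ.measurable measurable_vecToMatrix
  simp only [hmap]
  exact hmain.tendsto
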